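/- Let $\nu>-1$, and let $J_\nu$ be the Bessel function of the first kind. Let $f$ be a real-valued continuous function on $[0,\infty)$ which belongs to $L_1(0,\infty)$, tends to $0$ at $+\infty$, and is of bounded variation on $[0,\delta]$ for some $\delta>0$. For $\alpha>0$ let $B_\alpha(f)$ be the integral operator on $L_2(0,1)$ with kernel $$\int_0^\infty t\sqrt{xy}\,f(t/\alpha)\,J_\nu(tx)J_\nu(ty)\,dt ,\qquad 0<x,y<1 .$$ Let $$K(x,y)=\frac{J_\nu(\sqrt x)\sqrt y\,J_\nu'(\sqrt y)-\sqrt x\,J_\nu'(\sqrt x)J_\nu(\sqrt y)}{2(x-y)},\qquad K(x,x)=\lim_{y\to x}K(x,y),$$ be the Bessel kernel, and let $$\mu=\mu(\alpha)=\int_0^\infty f(\sqrt x/\alpha)\,K(x,x)\,dx$$ be the mean of the linear statistic $\sum_i f(\sqrt{x_i}/\alpha)$ in the Bessel-kernel ensemble. Then for every $\alpha>0$ the integrals above converge absolutely, $B_\alpha(f)$ is a bounded trace class operator, and $\mu(\alpha)=\operatorname{tr}B_\alpha(f)$. Moreover, as $\alpha\to\infty$, $$\mu(\alpha)=\frac{\alpha}{\pi}\int_0^\infty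 f(t)\,dt-\frac{\nu}{2}f(0)+o(1).$$ -/

import Mathlib

open MeasureTheory Filter Topology Set

noncomputable section

/-- The Bessel function of the first kind `J_ν(x)` for real order `ν` and `x > 0`, by its power
series. (`Real.Gamma` vanishes at its poles, so `1 / Γ` is read as `0` there, as usual.) -/
def besselJ (ν x : ℝ) : ℝ :=
  ∑' m : ℕ, (-1 : ℝ) ^ m / ((m.factorial : ℝ) * Real.Gamma ((m : ℝ) + ν + 1)) *
    (x / 2) ^ (2 * (m : ℝ) + ν)

/-- The Bessel kernel of the hard edge, for `x, y > 0`, `x ≠ y`. -/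
def besselKernel (ν x y : ℝ) : ℝ :=
  (besselJ ν (√x) * √y * deriv (besselJ ν) (√y) - √x * deriv (besselJ ν) (√x) * besselJ ν (√y)) /
    (2 * (x - y))

/-- The one-point density of the Bessel-kernel ensemble at `x > 0`: the diagonal value
`lim_{y → x} K(x, y)` of the Bessel kernel. -/
def besselDensity (ν x : ℝ) : ℝ :=
  limUnder (𝓝[≠] x) (fun y => besselKernel ν x y)

/-- The mean of the linear statistic `∑ f(√x_i)` in the Bessel-kernel ensemble. -/
def besselMean (ν : ℝ) (f : ℝ → ℝ) : ℝ :=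
  ∫ x in Ioi (0 : ℝ), f (√x) * besselDensity ν x

/-- The integrand (in `t`) of the kernel of `B(f)`. -/
def besselOpIntegrand (ν : ℝ) (f : ℝ → ℝ) (x y t : ℝ) : ℝ :=
  t * √(x * y) * f t * besselJ ν (t * x) * besselJ ν (t * y)

/-- The kernel of the operator `B(f)` on `L²(0,1)`. -/
def besselOpKernel (ν : ℝ) (f : ℝ → ℝ) (x y : ℝ) : ℝ :=
  ∫ t in Ioi (0 : ℝ), besselOpIntegrand ν f x y t

/-- The complex Hilbert space `L²(0,1)`. -/
abbrev L2Unit : Type := Lp ℂ 2 (volume.restrict (Ioo (0 : ℝ) 1))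

/-- `T` is the integral operator on `L²(0,1)` with the real kernel `k`, the defining integral
converging absolutely at almost every point. -/
def IsIntegralOperator (k : ℝ → ℝ → ℝ) (T : L2Unit →L[ℂ] L2Unit) : Prop :=
  ∀ g : L2Unit,
    (∀ᵐ x ∂(volume.restrict (Ioo (0 : ℝ) 1)),
      IntegrableOn (fun y => (k x y : ℂ) * g y) (Ioo (0 : ℝ) 1)) ∧
    (T g : ℝ → ℂ) =ᵐ[volume.restrict (Ioo (0 : ℝ) 1)]
      fun x => ∫ y in Ioo (0 : ℝ) 1, (k x y : ℂ) * g y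

/-- Trace class operators on a complex Hilbert space: `∑ ⟨e_n, T e'_n⟩` converges absolutely for
all orthonormal sequences `e`, `e'` (equivalently, `|T|` has finite trace). -/
def IsTraceClass {H : Type*} [NormedAddCommGroup H] [InnerProductSpace ℂ H]
    (T : H →L[ℂ] H) : Prop :=
  ∀ e e' : ℕ → H, Orthonormal ℂ e → Orthonormal ℂ e' →
    Summable fun n => ‖inner ℂ (e n) (T (e' n))‖

/-- `T` is trace class and its trace, computed in any Hilbert basis, is `c`. -/
def HasTrace {H : Type*} [NormedAddCommGroup H] [InnerProductSpace ℂ H]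
    (T : H →L[ℂ] H) (c : ℂ) : Prop :=
  IsTraceClass T ∧
    ∀ (w : Set H) (b : HilbertBasis w ℂ H), HasSum (fun i => inner ℂ (b i) (T (b i))) c

end

/-! Substitute x = s². The Lommel integral L(s) = ∫₀ˢ u J_ν(u)² du is explicit in J_ν and J_{ν+1},
and K(x,x) = L(√x)/(2x). So the mean is ∫ f(s/α) N(s) ds with N(s) = L(s)/s (`besselMean_eq`). The
operator is a superposition over t, with weight f(t/α), of the rank-one operators with kernels √(tx)
J_ν(tx) · √(ty) J_ν(ty). Each of these has trace ∫₀¹ tx J_ν(tx)² dx = N(t). As ∫ |f(t/α)| N(t) dt is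
finite, the superposition is trace class and its trace is the same integral
(`exists_integralOperator_hasTrace`).

The asymptotics come from two facts about M = N - 1/π (`besselN_asymptotics`): M(s) = O(1/s), and
∫₀ˢ M converges to P = -ν/2 as s → ∞. The constant 1/π gives the main term. For the rest,
`tendsto_integral_mul_dilation` shows that the dilates α M(αt) act on f like P times a point mass at
0. The integral of M converges only conditionally, which is why bounded variation near 0 is used;
away from 0 a Riemann–Lebesgue argument for L₁ functions suffices.

That N tends to some constant c and that ∫ (N - c) converges to some P follows from an almost
conserved quadratic form in J_ν and J_{ν+1} (`exists_besselN_asymptotics`). To identify c and P for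
ν > 0, the dilation theorem is applied to the test function x K₁(x). The resulting transform T(a) =
∫ u K₀(au) J_ν(u)² du satisfies a solvable differential system: with a = 2 sinh(θ/2) one gets T(a) =
e^{-νθ} / (2a cosh(θ/2)) (`mul_halfCosh_mul_besselT`). Its expansion at a = 0 gives c = 1/π and P =
-ν/2. For -1 < ν ≤ 0 the values follow from N_ν - 2N_{ν+1} + N_{ν+2} = (J_{ν+1}²)', which expresses
order ν through the positive orders ν+1 and ν+2. -/

noncomputable section


/-! ### Power series, recurrences and derivatives of J_ν -/

/-- The coefficients of the entire function `z ↦ (√z)^(-ν) J_ν(2√z)`. -/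
def besselCoeff (ν : ℝ) (m : ℕ) : ℝ :=
  (-1 : ℝ) ^ m / ((m.factorial : ℝ) * Real.Gamma ((m : ℝ) + ν + 1))

/-- The entire function `Φ_ν` with `J_ν(s) = (s/2)^ν Φ_ν(s²/4)`. -/
def besselPhi (ν z : ℝ) : ℝ := ∑' m : ℕ, besselCoeff ν m * z ^ m

lemma besselCoeff_succ (ν : ℝ) (m : ℕ) :
    besselCoeff ν (m + 1) * ((m : ℝ) + 1) = -besselCoeff (ν + 1) m := by
  have h1 : ((m : ℝ) + 1) ≠ 0 := by positivity
  have h2 : ((m + 1 : ℕ) : ℝ) + ν + 1 = (m : ℝ) + (ν + 1) + 1 := by push_cast; ring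
  have h3 : (m.factorial : ℝ) ≠ 0 := by positivity
  unfold besselCoeff
  rw [h2, Nat.factorial_succ]
  push_cast
  -- Here ν is arbitrary, so Γ may be read as 0 at a pole; both sides then vanish because division
  -- by 0 gives 0.
  by_cases hG : Real.Gamma ((m : ℝ) + (ν + 1) + 1) = 0
  · simp [hG]
  · field_simp
    ring

lemma besselCoeff_eq (ν : ℝ) (hν : -1 < ν) (m : ℕ) :
    besselCoeff ν m = ((m : ℝ) + ν + 1) * besselCoeff (ν + 1) m := by
  have h1 : (0 : ℝ) < (m : ℝ) + ν + 1 := by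
    have : (0 : ℝ) ≤ m := m.cast_nonneg
    linarith
  have h3 : (m.factorial : ℝ) ≠ 0 := by positivity
  have h4 := (Real.Gamma_pos_of_pos h1).ne'
  unfold besselCoeff
  rw [show (m : ℝ) + (ν + 1) + 1 = ((m : ℝ) + ν + 1) + 1 by ring, Real.Gamma_add_one h1.ne']
  field_simp

/-- Γ(m+ν+1) is bounded below: Γ(s+1) = sΓ(s) ≥ Γ(s) for s ≥ 1 makes it increase from m = 1 on. The
case m = 0 is kept apart because ν + 1 may be less than 1. -/
lemma exists_abs_besselCoeff_le (ν : ℝ) (hν : -1 < ν) :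
    ∃ C : ℝ, 0 < C ∧ ∀ m : ℕ, |besselCoeff ν m| ≤ C / (m.factorial : ℝ) := by
  have hG : ∀ m : ℕ, 0 < Real.Gamma ((m : ℝ) + ν + 1) := fun m =>
    Real.Gamma_pos_of_pos (by have : (0 : ℝ) ≤ m := m.cast_nonneg
                              linarith)
  have hG1 : ∀ m : ℕ, Real.Gamma (((1 : ℕ) : ℝ) + ν + 1) ≤ Real.Gamma (((m + 1 : ℕ) : ℝ) + ν + 1) := by
    intro m
    induction m with
    | zero => simp
    | succ k ih =>
      refine ih.trans ?_
      have h0 : (0 : ℝ) ≤ k := k.cast_nonneg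
      have h1 : (1 : ℝ) ≤ ((k + 1 : ℕ) : ℝ) + ν + 1 := by push_cast; linarith
      rw [show ((k + 1 + 1 : ℕ) : ℝ) + ν + 1 = (((k + 1 : ℕ) : ℝ) + ν + 1) + 1 by push_cast; ring,
        Real.Gamma_add_one (s := ((k + 1 : ℕ) : ℝ) + ν + 1) (by linarith)]
      exact le_mul_of_one_le_left (hG _).le h1
  refine ⟨1 / Real.Gamma (((0 : ℕ) : ℝ) + ν + 1) + 1 / Real.Gamma (((1 : ℕ) : ℝ) + ν + 1),
    add_pos (one_div_pos.2 (hG 0)) (one_div_pos.2 (hG 1)), fun m => ?_⟩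
  have h3 : (0 : ℝ) < (m.factorial : ℝ) := by positivity
  have : |besselCoeff ν m| = (1 / Real.Gamma ((m : ℝ) + ν + 1)) / (m.factorial : ℝ) := by
    unfold besselCoeff
    rw [abs_div, abs_pow, abs_neg, abs_one, one_pow, abs_of_pos (mul_pos h3 (hG m))]
    have := (hG m).ne'
    field_simp
  rw [this]
  gcongr
  rcases m with _ | k
  · exact le_add_of_nonneg_right (one_div_pos.2 (hG 1)).le
  · exact (one_div_le_one_div_of_le (hG 1) (hG1 k)).trans
      (le_add_of_nonneg_left (one_div_pos.2 (hG 0)).le)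

lemma summable_besselCoeff_mul_pow_abs (ν : ℝ) (hν : -1 < ν) (z : ℝ) :
    Summable fun m : ℕ => |besselCoeff ν m| * |z| ^ m := by
  obtain ⟨C, -, hC⟩ := exists_abs_besselCoeff_le ν hν
  refine Summable.of_nonneg_of_le (fun m => by positivity) (fun m => ?_)
    ((Real.summable_pow_div_factorial |z|).mul_left C)
  calc |besselCoeff ν m| * |z| ^ m ≤ C / (m.factorial : ℝ) * |z| ^ m := by
        gcongr; exact hC m
    _ = C * (|z| ^ m / (m.factorial : ℝ)) := by ring

lemma summable_besselCoeff_mul_pow (ν : ℝ) (hν : -1 < ν) (z : ℝ) :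
    Summable fun m : ℕ => besselCoeff ν m * z ^ m := by
  refine Summable.of_norm ?_
  simpa [abs_mul, abs_pow] using summable_besselCoeff_mul_pow_abs ν hν z

lemma hasDerivAt_besselPhi (ν : ℝ) (hν : -1 < ν) (z : ℝ) :
    HasDerivAt (besselPhi ν) (-besselPhi (ν + 1) z) z := by
  -- The differentiated series is majorised on the ball of radius R by its absolute series at R;
  -- `besselCoeff_succ` turns that into a series of order ν + 1.
  set R : ℝ := |z| + 1 with hR
  have hR0 : 0 ≤ R := by positivity
  have hu : Summable fun m : ℕ => |besselCoeff ν m| * (m : ℝ) * R ^ (m - 1) := by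
    rw [← summable_nat_add_iff 1]
    have := summable_besselCoeff_mul_pow_abs (ν + 1) (by linarith) R
    rw [abs_of_nonneg hR0] at this
    refine this.congr fun m => ?_
    have h := congrArg abs (besselCoeff_succ ν m)
    rw [abs_mul, abs_neg, abs_of_nonneg (by positivity : (0 : ℝ) ≤ (m : ℝ) + 1)] at h
    simp [← h]
  have key := hasDerivAt_tsum_of_isPreconnected (u := fun m : ℕ => |besselCoeff ν m| * (m : ℝ) * R ^ (m - 1))
    (g := fun (m : ℕ) y => besselCoeff ν m * y ^ m)
    (g' := fun (m : ℕ) y => besselCoeff ν m * ((m : ℝ) * y ^ (m - 1)))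
    (t := Metric.ball (0 : ℝ) R) (y₀ := z) (y := z) hu Metric.isOpen_ball
    (convex_ball (0 : ℝ) R).isPreconnected
    (fun m y _ => (hasDerivAt_pow m y).const_mul _) ?_ (by simp [hR])
    (summable_besselCoeff_mul_pow ν hν z) (by simp [hR])
  · have h2 : (∑' m : ℕ, besselCoeff ν m * ((m : ℝ) * z ^ (m - 1))) = -besselPhi (ν + 1) z := by
      have hs : Summable fun m : ℕ => besselCoeff ν m * ((m : ℝ) * z ^ (m - 1)) := by
        rw [← summable_nat_add_iff 1]
        refine (summable_besselCoeff_mul_pow (ν + 1) (by linarith) z).neg.congr fun m => ?_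
        have h := besselCoeff_succ ν m
        simp only [Nat.cast_add, Nat.cast_one, Nat.add_sub_cancel]
        linear_combination (-z ^ m) * h
      rw [hs.tsum_eq_zero_add]
      simp only [CharP.cast_eq_zero, zero_mul, mul_zero, zero_add]
      rw [besselPhi, ← tsum_neg]
      refine tsum_congr fun m => ?_
      have h := besselCoeff_succ ν m
      simp only [Nat.cast_add, Nat.cast_one, Nat.add_sub_cancel]
      linear_combination (z ^ m) * h
    rw [h2] at key
    exact key
  · intro m y hy
    have hy' : |y| ≤ R := by
      have := Metric.mem_ball.1 hy
      simp at this
      exact this.le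
    rw [Real.norm_eq_abs, abs_mul, abs_mul, abs_pow, Nat.abs_cast, ← mul_assoc]
    gcongr

/-- The factor m + ν + 1 of `besselCoeff_eq` is split: ν + 1 gives the first term, and m is absorbed
by an index shift that raises the order once more. -/
lemma besselPhi_eq (ν : ℝ) (hν : -1 < ν) (z : ℝ) :
    besselPhi ν z = (ν + 1) * besselPhi (ν + 1) z - z * besselPhi (ν + 2) z := by
  have hs1 := summable_besselCoeff_mul_pow (ν + 1) (by linarith) z
  have hs2 := summable_besselCoeff_mul_pow (ν + 2) (by linarith) z
  have hs3 : Summable fun m : ℕ => (m : ℝ) * besselCoeff (ν + 1) m * z ^ m := by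
    rw [← summable_nat_add_iff 1]
    refine (hs2.mul_left (-z)).congr fun m => ?_
    have h := besselCoeff_succ (ν + 1) m
    rw [show ν + 1 + 1 = ν + 2 by ring] at h
    push_cast
    rw [pow_succ]
    linear_combination (-z ^ m * z) * h
  have h3 : ∑' m : ℕ, (m : ℝ) * besselCoeff (ν + 1) m * z ^ m = -z * besselPhi (ν + 2) z := by
    rw [hs3.tsum_eq_zero_add]
    simp only [CharP.cast_eq_zero, zero_mul, zero_add]
    rw [besselPhi, ← tsum_mul_left]
    refine tsum_congr fun m => ?_
    have h := besselCoeff_succ (ν + 1) m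
    rw [show ν + 1 + 1 = ν + 2 by ring] at h
    push_cast
    rw [pow_succ]
    linear_combination (z ^ m * z) * h
  have h4 : besselPhi ν z = ∑' m : ℕ, ((ν + 1) * (besselCoeff (ν + 1) m * z ^ m) +
      (m : ℝ) * besselCoeff (ν + 1) m * z ^ m) := by
    rw [besselPhi]
    refine tsum_congr fun m => ?_
    rw [besselCoeff_eq ν hν m]
    ring
  rw [h4, (hs1.mul_left _).tsum_add hs3, h3, tsum_mul_left, ← besselPhi]
  ring

lemma continuous_besselPhi (ν : ℝ) (hν : -1 < ν) : Continuous (besselPhi ν) :=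
  continuous_iff_continuousAt.2 fun z => (hasDerivAt_besselPhi ν hν z).continuousAt

lemma besselPhi_zero (ν : ℝ) : besselPhi ν 0 = 1 / Real.Gamma (ν + 1) := by
  rw [besselPhi, tsum_eq_single 0 (fun m hm => by simp [hm])]
  simp [besselCoeff]

lemma besselJ_eq (ν : ℝ) {s : ℝ} (hs : 0 < s) :
    besselJ ν s = (s / 2) ^ ν * besselPhi ν (s ^ 2 / 4) := by
  rw [besselJ, besselPhi, ← tsum_mul_left]
  refine tsum_congr fun m => ?_
  have h2 : (0 : ℝ) < s / 2 := by positivity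
  rw [Real.rpow_add h2, show (2 * (m : ℝ)) = ((2 * m : ℕ) : ℝ) by push_cast; ring,
    Real.rpow_natCast, pow_mul, show (s / 2) ^ 2 = s ^ 2 / 4 by ring, besselCoeff]
  ring

lemma hasDerivAt_besselJ (ν : ℝ) (hν : -1 < ν) {s : ℝ} (hs : 0 < s) :
    HasDerivAt (besselJ ν) (ν / s * besselJ ν s - besselJ (ν + 1) s) s := by
  have h2 : (0 : ℝ) < s / 2 := by positivity
  have e : besselJ ν =ᶠ[𝓝 s] fun s => (s / 2) ^ ν * besselPhi ν (s ^ 2 / 4) := by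
    filter_upwards [lt_mem_nhds hs] with t ht using besselJ_eq ν ht
  refine HasDerivAt.congr_of_eventuallyEq ?_ e
  have hd1 : HasDerivAt (fun s : ℝ => (s / 2) ^ ν) ((1 / 2) * ν * (s / 2) ^ (ν - 1)) s :=
    ((hasDerivAt_id s).div_const 2).rpow_const (Or.inl h2.ne')
  have hd2 : HasDerivAt (fun s : ℝ => besselPhi ν (s ^ 2 / 4))
      (-besselPhi (ν + 1) (s ^ 2 / 4) * (2 * s / 4)) s := by
    refine ((hasDerivAt_besselPhi ν hν (s ^ 2 / 4)).comp s
      ((hasDerivAt_pow 2 s).div_const 4)).congr_deriv ?_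
    simp
  refine (hd1.mul hd2).congr_deriv ?_
  rw [besselJ_eq ν hs, besselJ_eq (ν + 1) hs, Real.rpow_sub_one h2.ne', Real.rpow_add_one h2.ne']
  field_simp
  ring

lemma besselJ_eq_add_two (ν : ℝ) (hν : -1 < ν) {s : ℝ} (hs : 0 < s) :
    besselJ ν s = 2 * (ν + 1) / s * besselJ (ν + 1) s - besselJ (ν + 2) s := by
  have h2 : (0 : ℝ) < s / 2 := by positivity
  rw [besselJ_eq ν hs, besselJ_eq (ν + 1) hs, besselJ_eq (ν + 2) hs, besselPhi_eq ν hν,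
    show ν + 2 = ν + 1 + 1 by ring, Real.rpow_add_one h2.ne' (ν + 1), Real.rpow_add_one h2.ne']
  field_simp
  ring

/-- Together with `hasDerivAt_besselJ` this makes (J_ν, J_{ν+1}) a closed first-order system, so
derivatives of quadratic expressions in the pair reduce to algebra. -/
lemma hasDerivAt_besselJ_add_one (ν : ℝ) (hν : -1 < ν) {s : ℝ} (hs : 0 < s) :
    HasDerivAt (besselJ (ν + 1)) (besselJ ν s - (ν + 1) / s * besselJ (ν + 1) s) s := by
  refine (hasDerivAt_besselJ (ν + 1) (by linarith) hs).congr_deriv ?_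
  rw [besselJ_eq_add_two ν hν hs, show ν + 1 + 1 = ν + 2 by ring]
  ring

lemma continuousOn_besselJ (ν : ℝ) (hν : -1 < ν) : ContinuousOn (besselJ ν) (Ioi 0) :=
  fun _ hs => (hasDerivAt_besselJ ν hν hs).continuousAt.continuousWithinAt

lemma exists_abs_besselJ_le_rpow (ν : ℝ) (hν : -1 < ν) (R : ℝ) :
    ∃ C : ℝ, 0 < C ∧ ∀ s, 0 < s → s ≤ R → |besselJ ν s| ≤ C * s ^ ν := by
  obtain ⟨C, hC⟩ := (isCompact_Icc (a := (0 : ℝ)) (b := R ^ 2 / 4)).exists_bound_of_continuousOn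
    (continuous_besselPhi ν hν).continuousOn
  have h2 : (0 : ℝ) < (1 / 2) ^ ν := by positivity
  refine ⟨(1 / 2) ^ ν * (|C| + 1), by positivity, fun s hs hsR => ?_⟩
  have hsn : 0 ≤ s := hs.le
  have hb : |besselPhi ν (s ^ 2 / 4)| ≤ C := by
    have := hC (s ^ 2 / 4) ⟨by positivity, by gcongr⟩
    simpa using this
  rw [besselJ_eq ν hs, abs_mul, abs_of_pos (by positivity : 0 < (s / 2) ^ ν),
    show s / 2 = (1 / 2) * s by ring, Real.mul_rpow (by norm_num) hsn]
  have hsν : 0 < s ^ ν := by positivity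
  calc (1 / 2) ^ ν * s ^ ν * |besselPhi ν (s ^ 2 / 4)| ≤ (1 / 2) ^ ν * s ^ ν * (|C| + 1) := by
        gcongr
        linarith [le_abs_self C]
    _ = _ := by ring

/-! ### The Lommel integral and the one-point density -/

/-- The Lommel integral `∫₀ˢ u J_ν(u)² du` in closed form. -/
def besselL (ν s : ℝ) : ℝ :=
  s ^ 2 / 2 * (besselJ ν s ^ 2 + besselJ (ν + 1) s ^ 2) - ν * s * besselJ ν s * besselJ (ν + 1) s

/-- The density of the Bessel ensemble in the variable `s = √x`. -/
def besselN (ν s : ℝ) : ℝ := besselL ν s / s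

lemma hasDerivAt_besselL (ν : ℝ) (hν : -1 < ν) {s : ℝ} (hs : 0 < s) :
    HasDerivAt (besselL ν) (s * besselJ ν s ^ 2) s := by
  have h0 := hasDerivAt_besselJ ν hν hs
  have h1 := hasDerivAt_besselJ_add_one ν hν hs
  have hd := (((hasDerivAt_pow 2 s).div_const 2).mul ((h0.pow 2).add (h1.pow 2))).sub
    ((((hasDerivAt_id s).const_mul ν).mul h0).mul h1)
  refine (hd.congr_deriv ?_ :)
  simp
  field_simp
  ring

/-- It gives N = O(s^(2ν+1)) near 0, which is integrable there precisely because ν > -1. -/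
lemma exists_abs_besselL_le (ν : ℝ) (hν : -1 < ν) (R : ℝ) :
    ∃ C : ℝ, 0 < C ∧ ∀ s, 0 < s → s ≤ R → |besselL ν s| ≤ C * s ^ (2 * ν + 2) := by
  obtain ⟨A, hA, hA'⟩ := exists_abs_besselJ_le_rpow ν hν R
  obtain ⟨B, hB, hB'⟩ := exists_abs_besselJ_le_rpow (ν + 1) (by linarith) R
  refine ⟨(A ^ 2 + B ^ 2 * R ^ 2) / 2 + |ν| * A * B, by positivity, fun s hs hsR => ?_⟩
  have h1 := hA' s hs hsR
  have h2 := hB' s hs hsR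
  have e : s ^ (2 * ν + 2) = s ^ 2 * (s ^ ν) ^ 2 := by
    rw [Real.rpow_add hs, mul_comm 2 ν, Real.rpow_mul hs.le]
    norm_num [mul_comm]
  rw [Real.rpow_add_one hs.ne'] at h2
  have hp : 0 < s ^ ν := by positivity
  set p := s ^ ν
  have q1 : besselJ ν s ^ 2 ≤ A ^ 2 * p ^ 2 := by
    rw [← sq_abs, ← mul_pow]; gcongr
  have q2 : besselJ (ν + 1) s ^ 2 ≤ B ^ 2 * R ^ 2 * p ^ 2 := by
    rw [← sq_abs, ← mul_pow, ← mul_pow]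
    gcongr
    refine h2.trans ?_
    rw [mul_assoc B R p, mul_comm p s]
    gcongr
  rw [e, besselL]
  refine (abs_sub _ _).trans ?_
  have q3 : |ν * s * besselJ ν s * besselJ (ν + 1) s| ≤ |ν| * s * (A * p) * (B * (p * s)) := by
    rw [abs_mul, abs_mul, abs_mul, abs_of_pos hs]
    gcongr
  have q4 : |s ^ 2 / 2 * (besselJ ν s ^ 2 + besselJ (ν + 1) s ^ 2)| ≤
      s ^ 2 / 2 * (A ^ 2 * p ^ 2 + B ^ 2 * R ^ 2 * p ^ 2) := by
    rw [abs_of_nonneg (by positivity)]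
    gcongr
  refine (add_le_add q4 q3).trans (le_of_eq ?_)
  ring

lemma tendsto_besselL_zero (ν : ℝ) (hν : -1 < ν) :
    Tendsto (besselL ν) (𝓝[>] 0) (𝓝 0) := by
  obtain ⟨C, -, hC⟩ := exists_abs_besselL_le ν hν 1
  have h : Tendsto (fun s : ℝ => C * s ^ (2 * ν + 2)) (𝓝[>] 0) (𝓝 0) := by
    have := ((Real.continuousAt_rpow_const 0 (2 * ν + 2) (Or.inr (by linarith))).tendsto.const_mul C)
    rw [Real.zero_rpow (by linarith), mul_zero] at this
    exact this.mono_left nhdsWithin_le_nhds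
  refine squeeze_zero_norm' ?_ h
  filter_upwards [Ioc_mem_nhdsGT (zero_lt_one' ℝ)] with s hs using hC s hs.1 hs.2

lemma exists_mul_besselJ_sq_le (ν : ℝ) (hν : -1 < ν) (R : ℝ) :
    ∃ C : ℝ, 0 < C ∧ ∀ s, 0 < s → s ≤ R → s * besselJ ν s ^ 2 ≤ C * s ^ (2 * ν + 1) := by
  obtain ⟨A, hA, hA'⟩ := exists_abs_besselJ_le_rpow ν hν R
  refine ⟨A ^ 2, by positivity, fun s hs hsR => ?_⟩
  have e : s ^ (2 * ν + 1) = s * (s ^ ν) ^ 2 := by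
    rw [Real.rpow_add hs, mul_comm 2 ν, Real.rpow_mul hs.le]
    norm_num [mul_comm]
  have q1 : besselJ ν s ^ 2 ≤ (A * s ^ ν) ^ 2 := by
    rw [← sq_abs]; gcongr; exact hA' s hs hsR
  rw [e]
  calc s * besselJ ν s ^ 2 ≤ s * (A * s ^ ν) ^ 2 := by gcongr
    _ = _ := by ring

lemma integrableOn_rpow_Ioc {r : ℝ} (hr : -1 < r) (R : ℝ) :
    IntegrableOn (fun s : ℝ => s ^ r) (Ioc 0 R) := by
  rcases le_or_gt 0 R with h | h
  · exact (intervalIntegrable_iff_integrableOn_Ioc_of_le h).1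
      (intervalIntegral.intervalIntegrable_rpow' hr)
  · simp [Ioc_eq_empty_of_le h.le]

lemma continuousOn_mul_besselJ_sq (ν : ℝ) (hν : -1 < ν) :
    ContinuousOn (fun u => u * besselJ ν u ^ 2) (Ioi 0) :=
  continuousOn_id.mul ((continuousOn_besselJ ν hν).pow 2)

lemma integrableOn_mul_besselJ_sq (ν : ℝ) (hν : -1 < ν) (R : ℝ) :
    IntegrableOn (fun u => u * besselJ ν u ^ 2) (Ioc 0 R) := by
  obtain ⟨C, -, hC⟩ := exists_mul_besselJ_sq_le ν hν R
  refine Integrable.mono' ((integrableOn_rpow_Ioc (by linarith : -1 < 2 * ν + 1) R).const_mul C)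
    (((continuousOn_mul_besselJ_sq ν hν).mono Ioc_subset_Ioi_self).aestronglyMeasurable
      measurableSet_Ioc) ?_
  refine (ae_restrict_iff' measurableSet_Ioc).2 (.of_forall fun s hs => ?_)
  rw [Real.norm_of_nonneg (mul_nonneg hs.1.le (sq_nonneg _))]
  exact hC s hs.1 hs.2

lemma integral_mul_besselJ_sq (ν : ℝ) (hν : -1 < ν) {s : ℝ} (hs : 0 < s) :
    ∫ u in (0 : ℝ)..s, u * besselJ ν u ^ 2 = besselL ν s := by
  rw [intervalIntegral.integral_eq_sub_of_hasDerivAt_of_tendsto (f := besselL ν) (fa := 0)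
    (fb := besselL ν s) hs (fun x hx => hasDerivAt_besselL ν hν hx.1)
    ((intervalIntegrable_iff_integrableOn_Ioc_of_le hs.le).2 (integrableOn_mul_besselJ_sq ν hν s))
    (tendsto_besselL_zero ν hν)
    ((hasDerivAt_besselL ν hν hs).continuousAt.tendsto.mono_left nhdsWithin_le_nhds), sub_zero]

lemma besselL_nonneg (ν : ℝ) (hν : -1 < ν) {s : ℝ} (hs : 0 < s) : 0 ≤ besselL ν s := by
  rw [← integral_mul_besselJ_sq ν hν hs]
  exact intervalIntegral.integral_nonneg hs.le fun u hu => mul_nonneg hu.1 (sq_nonneg _)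

lemma besselN_nonneg (ν : ℝ) (hν : -1 < ν) {s : ℝ} (hs : 0 < s) : 0 ≤ besselN ν s :=
  div_nonneg (besselL_nonneg ν hν hs) hs.le

lemma continuousOn_besselL (ν : ℝ) (hν : -1 < ν) : ContinuousOn (besselL ν) (Ioi 0) :=
  fun _ hs => (hasDerivAt_besselL ν hν hs).continuousAt.continuousWithinAt

lemma continuousOn_besselN (ν : ℝ) (hν : -1 < ν) : ContinuousOn (besselN ν) (Ioi 0) :=
  (continuousOn_besselL ν hν).div continuousOn_id fun _ hs => (mem_Ioi.1 hs).ne'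

lemma exists_besselN_le (ν : ℝ) (hν : -1 < ν) (R : ℝ) :
    ∃ C : ℝ, 0 < C ∧ ∀ s, 0 < s → s ≤ R → |besselN ν s| ≤ C * s ^ (2 * ν + 1) := by
  obtain ⟨C, hC, hC'⟩ := exists_abs_besselL_le ν hν R
  refine ⟨C, hC, fun s hs hsR => ?_⟩
  rw [besselN, abs_div, abs_of_pos hs, div_le_iff₀ hs, mul_assoc, ← Real.rpow_add_one hs.ne',
    show 2 * ν + 1 + 1 = 2 * ν + 2 by ring]
  exact hC' s hs hsR

lemma integrableOn_besselN (ν : ℝ) (hν : -1 < ν) (R : ℝ) :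
    IntegrableOn (besselN ν) (Ioc 0 R) := by
  obtain ⟨C, -, hC⟩ := exists_besselN_le ν hν R
  refine Integrable.mono' ((integrableOn_rpow_Ioc (by linarith : -1 < 2 * ν + 1) R).const_mul C)
    (((continuousOn_besselN ν hν).mono Ioc_subset_Ioi_self).aestronglyMeasurable
      measurableSet_Ioc) ?_
  exact (ae_restrict_iff' measurableSet_Ioc).2 (.of_forall fun s hs => hC s hs.1 hs.2)

/-- The numerator of the kernel vanishes on the diagonal, so K(x,y) is -1/2 times a difference
quotient in y and the limit is a derivative. -/
lemma besselDensity_eq (ν : ℝ) (hν : -1 < ν) {x : ℝ} (hx : 0 < x) :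
    besselDensity ν x = besselL ν (√x) / (2 * x) := by
  have hsx : 0 < √x := Real.sqrt_pos.2 hx
  -- The numerator of K(x,y), after replacing s J_ν'(s) by ν J_ν(s) - s J_{ν+1}(s).
  set h : ℝ → ℝ := fun y => besselJ ν (√x) * (ν * besselJ ν (√y) - √y * besselJ (ν + 1) (√y)) -
    (ν * besselJ ν (√x) - √x * besselJ (ν + 1) (√x)) * besselJ ν (√y) with hh
  have hK : ∀ y, 0 < y → besselKernel ν x y = h y / (2 * (x - y)) := by
    intro y hy
    have hsy : 0 < √y := Real.sqrt_pos.2 hy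
    rw [besselKernel, (hasDerivAt_besselJ ν hν hsx).deriv, (hasDerivAt_besselJ ν hν hsy).deriv, hh]
    congr 1
    field_simp
  have hq : HasDerivAt (fun y : ℝ => √y) (1 / (2 * √x)) x := Real.hasDerivAt_sqrt hx.ne'
  have h0 := (hasDerivAt_besselJ ν hν hsx).comp x hq
  have h1 := (hasDerivAt_besselJ_add_one ν hν hsx).comp x hq
  have hd : HasDerivAt h (-(besselL ν (√x) / x)) x := by
    refine ((((h0.const_mul ν).sub (hq.mul h1)).const_mul (besselJ ν (√x))).sub
      (h0.const_mul (ν * besselJ ν (√x) - √x * besselJ (ν + 1) (√x)))).congr_deriv ?_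
    simp only [Function.comp_apply, besselL]
    have e : x = √x ^ 2 := (Real.sq_sqrt hx.le).symm
    clear_value h
    clear hK hh hq h0 h1
    generalize √x = r at *
    subst e
    field_simp
    ring
  have hx0 : h x = 0 := by simp only [hh]; ring
  have ht : Tendsto (fun y => besselKernel ν x y) (𝓝[≠] x) (𝓝 (besselL ν (√x) / (2 * x))) := by
    have := (hasDerivAt_iff_tendsto_slope.1 hd).const_mul (-1 / 2)
    rw [show -1 / 2 * -(besselL ν (√x) / x) = besselL ν (√x) / (2 * x) by field_simp] at this
    refine this.congr' ?_
    filter_upwards [self_mem_nhdsWithin, nhdsWithin_le_nhds (lt_mem_nhds hx)] with y hy hy0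
    rw [hK y hy0, slope_def_field, hx0]
    have h1 : y - x ≠ 0 := sub_ne_zero.2 hy
    have h2 : x - y ≠ 0 := sub_ne_zero.2 (Ne.symm hy)
    field_simp
    ring
  exact ht.limUnder_eq

/-- The left side has the shape produced by the substitution x = s² in
`integral_comp_rpow_Ioi_of_pos`; the Jacobian 2s turns L/(2s²) into L/s. -/
lemma besselDensity_subst (ν : ℝ) (hν : -1 < ν) (f : ℝ → ℝ) {s : ℝ} (hs : 0 < s) :
    ((2 : ℝ) * s ^ ((2 : ℝ) - 1)) • (f √(s ^ (2 : ℝ)) * besselDensity ν (s ^ (2 : ℝ))) =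
      f s * besselN ν s := by
  have h2 : (0 : ℝ) < s ^ (2 : ℝ) := by positivity
  have h3 : √(s ^ (2 : ℝ)) = s := by simp [Real.sqrt_sq hs.le]
  rw [besselDensity_eq ν hν h2, h3, besselN]
  norm_num
  field_simp

lemma besselMean_eq (ν : ℝ) (hν : -1 < ν) (f : ℝ → ℝ) :
    besselMean ν f = ∫ s in Ioi (0 : ℝ), f s * besselN ν s := by
  rw [besselMean, ← integral_comp_rpow_Ioi_of_pos (zero_lt_two' ℝ)]
  exact setIntegral_congr_fun measurableSet_Ioi fun s hs => besselDensity_subst ν hν f hs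

lemma integrableOn_besselDensity_iff (ν : ℝ) (hν : -1 < ν) (f : ℝ → ℝ) :
    IntegrableOn (fun x => f (√x) * besselDensity ν x) (Ioi 0) ↔
      IntegrableOn (fun s => f s * besselN ν s) (Ioi 0) := by
  rw [← integrableOn_Ioi_comp_rpow_iff _ (two_ne_zero' ℝ)]
  refine integrableOn_congr_fun (fun s hs => ?_) measurableSet_Ioi
  simpa using besselDensity_subst ν hν f hs

/-! ### An almost conserved energy and the density at infinity -/

/-- A/(2s²) is the tail integral of A/s³, so h - A/(2s²) increases and h + A/(2s²) decreases. The
limit is taken as the supremum of the increasing function. -/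
lemma exists_limit_of_abs_deriv_le_div_cube {h h' : ℝ → ℝ} {A : ℝ}
    (hd : ∀ s, 1 ≤ s → HasDerivAt h (h' s) s) (hb : ∀ s, 1 ≤ s → |h' s| ≤ A / s ^ 3) :
    ∃ l : ℝ, ∀ s, 1 ≤ s → |h s - l| ≤ A / (2 * s ^ 2) := by
  have hg : ∀ s : ℝ, 1 ≤ s → HasDerivAt (fun s : ℝ => A / (2 * s ^ 2)) (-(A / s ^ 3)) s := by
    intro s hs
    have hs0 : s ≠ 0 := by linarith
    refine ((hasDerivAt_const s A).div ((hasDerivAt_pow 2 s).const_mul 2)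
      (by positivity)).congr_deriv ?_
    field_simp
    ring
  have hmono : MonotoneOn (fun s => h s - A / (2 * s ^ 2)) (Ici 1) := by
    refine monotoneOn_of_hasDerivWithinAt_nonneg (convex_Ici 1) (f' := fun s => h' s - -(A / s ^ 3))
      (fun s hs => ((hd s hs).sub (hg s hs)).continuousAt.continuousWithinAt) (fun s hs => ?_) ?_
    · exact ((hd s (interior_subset hs)).sub (hg s (interior_subset hs))).hasDerivWithinAt
    · intro s hs
      linarith [neg_abs_le (h' s), hb s (interior_subset hs)]
  have hanti : AntitoneOn (fun s => h s + A / (2 * s ^ 2)) (Ici 1) := by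
    refine antitoneOn_of_hasDerivWithinAt_nonpos (convex_Ici 1) (f' := fun s => h' s + -(A / s ^ 3))
      (fun s hs => ((hd s hs).add (hg s hs)).continuousAt.continuousWithinAt) (fun s hs => ?_) ?_
    · exact ((hd s (interior_subset hs)).add (hg s (interior_subset hs))).hasDerivWithinAt
    · intro s hs
      linarith [le_abs_self (h' s), hb s (interior_subset hs)]
  have hA : 0 ≤ A := by
    have := (abs_nonneg _).trans (hb 1 le_rfl)
    simpa using this
  have hle : ∀ s, 1 ≤ s → ∀ t, 1 ≤ t → h s - A / (2 * s ^ 2) ≤ h t + A / (2 * t ^ 2) := by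
    intro s hs t ht
    have hn : ∀ u : ℝ, 0 ≤ A / (2 * u ^ 2) := fun u => by positivity
    rcases le_total s t with h | h
    · have := hmono hs ht h
      simp only at this
      linarith [hn t]
    · have := hanti ht hs h
      simp only at this
      linarith [hn s]
  refine ⟨sSup ((fun s => h s - A / (2 * s ^ 2)) '' Ici 1), fun s hs => ?_⟩
  have h1 : h s - A / (2 * s ^ 2) ≤ sSup ((fun s => h s - A / (2 * s ^ 2)) '' Ici 1) := by
    refine le_csSup ⟨h 1 + A / (2 * 1 ^ 2), ?_⟩ ⟨s, hs, rfl⟩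
    rintro _ ⟨t, ht, rfl⟩
    exact hle t ht 1 le_rfl
  have h2 : sSup ((fun s => h s - A / (2 * s ^ 2)) '' Ici 1) ≤ h s + A / (2 * s ^ 2) := by
    refine csSup_le ⟨_, 1, self_mem_Ici, rfl⟩ ?_
    rintro _ ⟨t, ht, rfl⟩
    exact hle t ht s hs
  rw [abs_le]
  constructor <;> linarith

/-- `s (J_ν² + J_{ν+1}²)`. -/
def besselY (ν s : ℝ) : ℝ := s * (besselJ ν s ^ 2 + besselJ (ν + 1) s ^ 2)
/-- `s J_ν J_{ν+1}`. -/
def besselW (ν s : ℝ) : ℝ := s * (besselJ ν s * besselJ (ν + 1) s)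
/-- `s (J_ν² - J_{ν+1}²)`. -/
def besselR (ν s : ℝ) : ℝ := s * (besselJ ν s ^ 2 - besselJ (ν + 1) s ^ 2)

/-- Y, W, R form a closed linear system, with b = ν + 1/2: Y' = 2bR/s, W' = R, R' = 2bY/s - 4W.
Since |W| ≤ Y/2 and |R| ≤ Y, a bound on Y controls all three. -/
lemma hasDerivAt_besselY (ν : ℝ) (hν : -1 < ν) {s : ℝ} (hs : 0 < s) : HasDerivAt (besselY ν) (2 * (ν + 1 / 2) * besselR ν s / s) s := by
  have h0 := hasDerivAt_besselJ ν hν hs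
  have h1 := hasDerivAt_besselJ_add_one ν hν hs
  refine ((hasDerivAt_id s).mul ((h0.pow 2).add (h1.pow 2))).congr_deriv ?_
  simp [besselR]
  field_simp
  ring

lemma hasDerivAt_besselW (ν : ℝ) (hν : -1 < ν) {s : ℝ} (hs : 0 < s) : HasDerivAt (besselW ν) (besselR ν s) s := by
  have h0 := hasDerivAt_besselJ ν hν hs
  have h1 := hasDerivAt_besselJ_add_one ν hν hs
  refine ((hasDerivAt_id s).mul (h0.mul h1)).congr_deriv ?_
  simp [besselR]
  field_simp
  ring

lemma hasDerivAt_besselR (ν : ℝ) (hν : -1 < ν) {s : ℝ} (hs : 0 < s) :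
    HasDerivAt (besselR ν) (2 * (ν + 1 / 2) * besselY ν s / s - 4 * besselW ν s) s := by
  have h0 := hasDerivAt_besselJ ν hν hs
  have h1 := hasDerivAt_besselJ_add_one ν hν hs
  refine ((hasDerivAt_id s).mul ((h0.pow 2).sub (h1.pow 2))).congr_deriv ?_
  simp [besselY, besselW]
  field_simp
  ring

lemma besselY_nonneg (ν : ℝ) {s : ℝ} (hs : 0 < s) : 0 ≤ besselY ν s := by unfold besselY; positivity

lemma abs_besselW_le (ν : ℝ) {s : ℝ} (hs : 0 < s) : |besselW ν s| ≤ besselY ν s / 2 := by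
  rw [besselW, besselY, abs_mul, abs_of_pos hs, mul_div_assoc]
  gcongr
  rw [abs_le]
  constructor <;> nlinarith [sq_nonneg (besselJ ν s - besselJ (ν + 1) s),
    sq_nonneg (besselJ ν s + besselJ (ν + 1) s)]

lemma abs_besselR_le (ν : ℝ) {s : ℝ} (hs : 0 < s) : |besselR ν s| ≤ besselY ν s := by
  rw [besselR, besselY, abs_mul, abs_of_pos hs]
  gcongr
  rw [abs_le]
  constructor <;> nlinarith [sq_nonneg (besselJ ν s), sq_nonneg (besselJ (ν + 1) s)]

lemma besselN_eq (ν : ℝ) {s : ℝ} (hs : 0 < s) : besselN ν s = besselY ν s / 2 - ν * besselW ν s / s := by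
  rw [besselN, besselL, besselY, besselW]
  field_simp

/-- The energy `Y - 2bW/s`, `b = ν + 1/2`, is almost constant at infinity. -/
lemma hasDerivAt_besselEnergy (ν : ℝ) (hν : -1 < ν) {s : ℝ} (hs : 0 < s) :
    HasDerivAt (fun s => besselY ν s - 2 * (ν + 1 / 2) * besselW ν s / s)
      (2 * (ν + 1 / 2) * besselW ν s / s ^ 2) s := by
  refine ((hasDerivAt_besselY ν hν hs).sub (((hasDerivAt_besselW ν hν hs).const_mul
    (2 * (ν + 1 / 2))).div (hasDerivAt_id s) hs.ne')).congr_deriv ?_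
  simp
  field_simp
  ring

/-- Grönwall for the energy e = Y - 2bW/s: far out Y ≤ 2e, hence |W| ≤ e and e' = 2bW/s² ≤ 2|b|e/s²,
so e · exp(2|b|/s) decreases. -/
lemma exists_besselY_le (ν : ℝ) (hν : -1 < ν) : ∃ K : ℝ, 0 < K ∧ ∀ s, 1 ≤ s → besselY ν s ≤ K := by
  set b := ν + 1 / 2 with hb
  -- For s ≥ 2|b| the correction 2bW/s is at most Y/2 in absolute value, which yields Y ≤ 2e.
  set S := max 1 (2 * |b|) with hS
  have hS1 : 1 ≤ S := le_max_left _ _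
  have hS2 : 2 * |b| ≤ S := le_max_right _ _
  set e : ℝ → ℝ := fun s => besselY ν s - 2 * b * besselW ν s / s with he
  have hYe : ∀ s, S ≤ s → besselY ν s ≤ 2 * e s := by
    intro s hs
    have hs0 : 0 < s := by linarith
    have h1 : |2 * b * besselW ν s / s| ≤ besselY ν s / 2 := by
      rw [abs_div, abs_mul, abs_mul, abs_of_pos hs0, abs_two, div_le_iff₀ hs0]
      calc 2 * |b| * |besselW ν s| ≤ s * (besselY ν s / 2) := by
            gcongr
            · exact hS2.trans hs
            · exact abs_besselW_le ν hs0
        _ = _ := by ring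
    simp only [he]
    linarith [le_abs_self (2 * b * besselW ν s / s)]
  have hanti : AntitoneOn (fun s => e s * Real.exp (2 * |b| / s)) (Ici S) := by
    have hd : ∀ s, S ≤ s → HasDerivAt (fun s => e s * Real.exp (2 * |b| / s))
        (2 * b * besselW ν s / s ^ 2 * Real.exp (2 * |b| / s) +
          e s * (Real.exp (2 * |b| / s) * (-(2 * |b| / s ^ 2)))) s := by
      intro s hs
      have hs0 : 0 < s := by linarith
      refine (hasDerivAt_besselEnergy ν hν hs0).mul (HasDerivAt.exp ?_)
      refine ((hasDerivAt_const s (2 * |b|)).div (hasDerivAt_id s) hs0.ne').congr_deriv ?_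
      simp
      ring
    refine antitoneOn_of_hasDerivWithinAt_nonpos (convex_Ici S)
      (fun s hs => (hd s hs).continuousAt.continuousWithinAt)
      (fun s hs => (hd s (interior_subset hs)).hasDerivWithinAt) (fun s hs => ?_)
    have hs' : S ≤ s := interior_subset hs
    have hs0 : 0 < s := by linarith
    have h1 : b * besselW ν s ≤ |b| * e s := by
      calc b * besselW ν s ≤ |b| * |besselW ν s| := by rw [← abs_mul]; exact le_abs_self _
        _ ≤ |b| * e s := by
          gcongr
          linarith [abs_besselW_le ν hs0, hYe s hs']
    have h2 : 2 * b * besselW ν s / s ^ 2 * Real.exp (2 * |b| / s) +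
          e s * (Real.exp (2 * |b| / s) * (-(2 * |b| / s ^ 2))) =
        -(2 * Real.exp (2 * |b| / s) / s ^ 2 * (|b| * e s - b * besselW ν s)) := by
      ring
    rw [h2, neg_nonpos]
    exact mul_nonneg (by positivity) (by linarith)
  obtain ⟨K, hK⟩ := (isCompact_Icc (a := (1 : ℝ)) (b := S)).exists_bound_of_continuousOn
    (f := besselY ν) (fun s hs => (hasDerivAt_besselY ν hν
      (by linarith [hs.1])).continuousAt.continuousWithinAt)
  refine ⟨max (|K| + 1) (2 * (e S * Real.exp (2 * |b| / S))),
    lt_max_of_lt_left (by positivity), fun s hs => ?_⟩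
  rcases le_total s S with h | h
  · refine le_max_of_le_left ?_
    have := hK s ⟨hs, h⟩
    rw [Real.norm_eq_abs] at this
    linarith [le_abs_self (besselY ν s), le_abs_self K]
  · refine le_max_of_le_right ((hYe s h).trans ?_)
    have h1 := hanti self_mem_Ici h h
    simp only at h1
    have he0 : 0 ≤ e s := by linarith [besselY_nonneg ν (by linarith : 0 < s), hYe s h]
    have h2 : e s ≤ e s * Real.exp (2 * |b| / s) :=
      le_mul_of_one_le_right he0 (Real.one_le_exp (by positivity))
    linarith

/-- The derivative 2bW/s² alone would give only an O(1/s) error, too weak to integrate. Adding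
bR/(2s²) cancels it, since R' contains -4W, and leaves a derivative O(1/s³). -/
lemma exists_besselEnergy_limit (ν : ℝ) (hν : -1 < ν) :
    ∃ l C : ℝ, 0 < C ∧ ∀ s, 1 ≤ s →
      |besselY ν s - 2 * (ν + 1 / 2) * besselW ν s / s - l| ≤ C / s ^ 2 := by
  obtain ⟨K, hK, hY⟩ := exists_besselY_le ν hν
  set b := ν + 1 / 2 with hb
  have hd : ∀ s, 1 ≤ s → HasDerivAt
      (fun s => (besselY ν s - 2 * b * besselW ν s / s) + b * besselR ν s / (2 * s ^ 2))
      ((b ^ 2 * besselY ν s - b * besselR ν s) / s ^ 3) s := by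
    intro s hs
    have hs0 : 0 < s := by linarith
    refine ((hasDerivAt_besselEnergy ν hν hs0).add (((hasDerivAt_besselR ν hν hs0).const_mul b).div
      ((hasDerivAt_pow 2 s).const_mul 2) (by positivity))).congr_deriv ?_
    simp
    field_simp
    ring
  obtain ⟨l, hl⟩ := exists_limit_of_abs_deriv_le_div_cube (A := b ^ 2 * K + |b| * K) hd <| by
    intro s hs
    have hs0 : 0 < s := by linarith
    rw [abs_div, abs_of_pos (by positivity : 0 < s ^ 3)]
    gcongr
    refine (abs_sub _ _).trans ?_
    rw [abs_mul, abs_mul, abs_of_nonneg (sq_nonneg b), abs_of_nonneg (besselY_nonneg ν hs0)]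
    gcongr
    · exact hY s hs
    · exact (abs_besselR_le ν hs0).trans (hY s hs)
  refine ⟨l, (b ^ 2 * K + |b| * K) / 2 + |b| * K / 2 + 1, by positivity, fun s hs => ?_⟩
  have hs0 : 0 < s := by linarith
  have h1 : |b * besselR ν s / (2 * s ^ 2)| ≤ |b| * K / (2 * s ^ 2) := by
    rw [abs_div, abs_mul, abs_of_pos (by positivity : 0 < 2 * s ^ 2)]
    gcongr
    exact (abs_besselR_le ν hs0).trans (hY s hs)
  have h2 := hl s hs
  have h3 : (0 : ℝ) ≤ 1 / s ^ 2 := by positivity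
  calc |besselY ν s - 2 * b * besselW ν s / s - l|
      = |((besselY ν s - 2 * b * besselW ν s / s) + b * besselR ν s / (2 * s ^ 2) - l) -
          b * besselR ν s / (2 * s ^ 2)| := by congr 1; ring
    _ ≤ _ := abs_sub _ _
    _ ≤ (b ^ 2 * K + |b| * K) / (2 * s ^ 2) + |b| * K / (2 * s ^ 2) + 1 / s ^ 2 := by
        linarith
    _ = _ := by field_simp

lemma integrableOn_besselN_sub_const (ν : ℝ) (hν : -1 < ν) (c R : ℝ) :
    IntegrableOn (fun s => besselN ν s - c) (Ioc 0 R) :=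
  (integrableOn_besselN ν hν R).sub (integrableOn_const (by simp))

/-- N = e/2 + W/(2s) for the energy e, whose limit is l; thus c = l/2. The term W/(2s) is O(1/s) and
is controlled only through its oscillation, as a derivative up to O(1/s²). The values of c and P are
left undetermined here. -/
lemma exists_besselN_asymptotics (ν : ℝ) (hν : -1 < ν) :
    ∃ c P C : ℝ, 0 < C ∧ (∀ s, 1 ≤ s → |besselN ν s - c| ≤ C / s) ∧
      Tendsto (fun S => ∫ u in (0 : ℝ)..S, (besselN ν u - c)) atTop (𝓝 P) := by
  obtain ⟨K, hK, hY⟩ := exists_besselY_le ν hν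
  obtain ⟨l, C, hC, hl⟩ := exists_besselEnergy_limit ν hν
  set b := ν + 1 / 2 with hb
  have hN : ∀ s, 1 ≤ s → besselN ν s - l / 2 =
      (besselY ν s - 2 * b * besselW ν s / s - l) / 2 + besselW ν s / (2 * s) := by
    intro s hs
    have hs0 : 0 < s := by linarith
    rw [besselN_eq ν hs0, hb]
    field_simp
    ring
  -- the oscillating part of `N - l/2` is the derivative of `-D`
  set D : ℝ → ℝ := fun s => besselR ν s / (8 * s) with hD
  set D' : ℝ → ℝ := fun s => b * besselY ν s / (4 * s ^ 2) - besselW ν s / (2 * s) -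
    besselR ν s / (8 * s ^ 2) with hD'
  have hDd : ∀ s, 1 ≤ s → HasDerivAt D (D' s) s := by
    intro s hs
    have hs0 : 0 < s := by linarith
    refine ((hasDerivAt_besselR ν hν hs0).div ((hasDerivAt_id s).const_mul 8)
      (by positivity)).congr_deriv ?_
    simp [hD']
    field_simp
    ring
  have hG : ∀ s, 1 ≤ s → |besselN ν s - l / 2 + D' s| ≤ (C / 2 + |b| * K / 4 + K / 8) / s ^ 2 := by
    intro s hs
    have hs0 : 0 < s := by linarith
    have e : besselN ν s - l / 2 + D' s = (besselY ν s - 2 * b * besselW ν s / s - l) / 2 +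
        b * besselY ν s / (4 * s ^ 2) - besselR ν s / (8 * s ^ 2) := by
      rw [hN s hs, hD']; ring
    have h1 : |(besselY ν s - 2 * b * besselW ν s / s - l) / 2| ≤ C / s ^ 2 / 2 := by
      rw [abs_div, abs_two]
      have := hl s hs
      gcongr
    have h2 : |b * besselY ν s / (4 * s ^ 2)| ≤ |b| * K / (4 * s ^ 2) := by
      rw [abs_div, abs_mul, abs_of_pos (by positivity : 0 < 4 * s ^ 2),
        abs_of_nonneg (besselY_nonneg ν hs0)]
      gcongr
      exact hY s hs
    have h3 : |besselR ν s / (8 * s ^ 2)| ≤ K / (8 * s ^ 2) := by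
      rw [abs_div, abs_of_pos (by positivity : 0 < 8 * s ^ 2)]
      gcongr
      exact (abs_besselR_le ν hs0).trans (hY s hs)
    rw [e]
    refine (abs_sub _ _).trans ((add_le_add ((abs_add_le _ _).trans (add_le_add h1 h2)) h3).trans
      (le_of_eq ?_))
    field_simp
  have hcN : ContinuousOn (besselN ν) (Ici 1) :=
    (continuousOn_besselN ν hν).mono fun s hs => lt_of_lt_of_le one_pos (mem_Ici.1 hs)
  have hcD' : ContinuousOn D' (Ici 1) := by
    have hpos : ∀ s ∈ Ici (1 : ℝ), 0 < s := fun s hs => lt_of_lt_of_le one_pos hs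
    have c1 : ContinuousOn (besselY ν) (Ici 1) := fun s hs =>
      (hasDerivAt_besselY ν hν (hpos s hs)).continuousAt.continuousWithinAt
    have c2 : ContinuousOn (besselW ν) (Ici 1) := fun s hs =>
      (hasDerivAt_besselW ν hν (hpos s hs)).continuousAt.continuousWithinAt
    have c3 : ContinuousOn (besselR ν) (Ici 1) := fun s hs =>
      (hasDerivAt_besselR ν hν (hpos s hs)).continuousAt.continuousWithinAt
    refine ((ContinuousOn.div (by fun_prop) (by fun_prop) fun s hs => ?_).sub
      (c2.div (by fun_prop) fun s hs => ?_)).sub (c3.div (by fun_prop) fun s hs => ?_) <;>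
    · have := hpos s hs
      positivity
  have hcG : ContinuousOn (fun s => besselN ν s - l / 2 + D' s) (Ici 1) :=
    (hcN.sub continuousOn_const).add hcD'
  have hintG : IntegrableOn (fun s => besselN ν s - l / 2 + D' s) (Ioi 1) := by
    refine Integrable.mono' (((integrableOn_Ioi_rpow_of_lt (by norm_num : (-2 : ℝ) < -1)
      one_pos)).const_mul (C / 2 + |b| * K / 4 + K / 8))
      ((hcG.mono Ioi_subset_Ici_self).aestronglyMeasurable measurableSet_Ioi) ?_
    refine (ae_restrict_iff' measurableSet_Ioi).2 (.of_forall fun s hs => ?_)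
    have hs1 : 1 ≤ s := le_of_lt hs
    rw [Real.rpow_neg (by linarith), ← div_eq_mul_inv]
    exact_mod_cast hG s hs1
  have hDlim : Tendsto D atTop (𝓝 0) := by
    refine squeeze_zero_norm' (a := fun s => K / (8 * s)) ?_ ?_
    · filter_upwards [eventually_ge_atTop 1] with s hs
      have hs0 : 0 < s := by linarith
      rw [Real.norm_eq_abs, hD, abs_div, abs_of_pos (by positivity : 0 < 8 * s)]
      gcongr
      exact (abs_besselR_le ν hs0).trans (hY s hs)
    · exact Tendsto.const_div_atTop (tendsto_id.const_mul_atTop (by norm_num)) _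
  have hi01 : IntervalIntegrable (fun s => besselN ν s - l / 2) volume 0 1 :=
    (intervalIntegrable_iff_integrableOn_Ioc_of_le zero_le_one).2
      (integrableOn_besselN_sub_const ν hν _ 1)
  have hicc : ∀ {S : ℝ} {g : ℝ → ℝ}, ContinuousOn g (Ici 1) → 1 ≤ S →
      IntervalIntegrable g volume 1 S := fun hg hS =>
    (hg.mono (by rw [uIcc_of_le hS]; exact Icc_subset_Ici_self)).intervalIntegrable
  -- P is the contribution of (0,1], plus the absolutely convergent integral of N - l/2 + D' over
  -- (1,∞), minus the total change 0 - D(1) of D there.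
  refine ⟨l / 2, (∫ u in (0 : ℝ)..1, (besselN ν u - l / 2)) +
    ((∫ u in Ioi (1 : ℝ), (besselN ν u - l / 2 + D' u)) - (0 - D 1)), C / 2 + K / 4 + 1,
    by positivity, fun s hs => ?_, ?_⟩
  · have hs0 : 0 < s := by linarith
    rw [hN s hs]
    have h1 : |(besselY ν s - 2 * b * besselW ν s / s - l) / 2| ≤ C / 2 / s := by
      rw [abs_div, abs_two]
      have h1 := hl s hs
      have h2 : C / s ^ 2 ≤ C / s := by
        gcongr
        nlinarith
      calc _ ≤ (C / s) / 2 := by linarith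
        _ = _ := by ring
    have h2 : |besselW ν s / (2 * s)| ≤ (K / 2) / (2 * s) := by
      rw [abs_div, abs_of_pos (by positivity : 0 < 2 * s)]
      gcongr
      linarith [abs_besselW_le ν hs0, hY s hs]
    have h3 : (0 : ℝ) ≤ 1 / s := by positivity
    calc _ ≤ _ := abs_add_le _ _
      _ ≤ C / 2 / s + (K / 2) / (2 * s) + 1 / s := by linarith
      _ = _ := by field_simp; ring
  · have t1 := (intervalIntegral_tendsto_integral_Ioi 1 hintG tendsto_id).sub
      (hDlim.sub_const (D 1))
    refine (t1.const_add _).congr' ?_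
    filter_upwards [eventually_ge_atTop 1] with S hS
    rw [← intervalIntegral.integral_add_adjacent_intervals hi01
      (hicc (hcN.sub continuousOn_const) hS)]
    congr 1
    simp only [id]
    rw [intervalIntegral.integral_add
      (hicc (g := fun s => besselN ν s - l / 2) (hcN.sub continuousOn_const) hS) (hicc hcD' hS),
      intervalIntegral.integral_eq_sub_of_hasDerivAt (f := D) (f' := D')
        (fun s hs => hDd s (by rw [uIcc_of_le hS] at hs; exact hs.1)) (hicc hcD' hS)]
    simp

/-! ### Dilates of a conditionally integrable function -/

lemma intervalIntegrable_of_forall_integrableOn_Ioc {M : ℝ → ℝ}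
    (hM : ∀ R, IntegrableOn M (Ioc 0 R)) {a b : ℝ} (ha : 0 ≤ a) (hb : 0 ≤ b) :
    IntervalIntegrable M volume a b := by
  rw [intervalIntegrable_iff]
  refine (hM (max a b)).mono_set ?_
  rw [uIoc]
  exact Ioc_subset_Ioc_left (le_min ha hb)

/-- Boundedness of the primitive replaces absolute integrability of M as the source of majorants for
dominated convergence. -/
lemma exists_abs_primitive_le {M : ℝ → ℝ} {P : ℝ} (hM : ∀ R, IntegrableOn M (Ioc 0 R))
    (hP : Tendsto (fun S => ∫ u in (0 : ℝ)..S, M u) atTop (𝓝 P)) :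
    ∃ B, ∀ S, 0 ≤ S → |∫ u in (0 : ℝ)..S, M u| ≤ B := by
  have h1 := hP.abs.eventually (gt_mem_nhds (lt_add_one |P|))
  obtain ⟨R, hR⟩ := eventually_atTop.1 h1
  obtain ⟨B, hB⟩ := (isCompact_Icc (a := (0 : ℝ)) (b := max R 0)).exists_bound_of_continuousOn
    (f := fun S => ∫ u in (0 : ℝ)..S, M u) (by
      have := intervalIntegral.continuousOn_primitive_interval'
        (intervalIntegrable_of_forall_integrableOn_Ioc hM le_rfl (le_max_right R 0))
        (left_mem_uIcc (a := (0 : ℝ)) (b := max R 0))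
      rwa [uIcc_of_le (le_max_right R 0)] at this)
  refine ⟨max B (|P| + 1), fun S hS => ?_⟩
  rcases le_total S (max R 0) with h | h
  · exact le_max_of_le_left (hB S ⟨hS, h⟩)
  · exact le_max_of_le_right (hR S ((le_max_left _ _).trans h)).le

/-- As α → ∞ the right side tends to 0 if 0 < a ≤ b and to P if a = 0 < b: the dilates concentrate
at the origin. -/
lemma integral_dilation {M : ℝ → ℝ} (hM : ∀ R, IntegrableOn M (Ioc 0 R)) {α : ℝ} (hα : 0 < α)
    {a b : ℝ} (ha : 0 ≤ a) (hb : 0 ≤ b) :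
    ∫ t in a..b, α * M (α * t) = (∫ u in (0 : ℝ)..(α * b), M u) - ∫ u in (0 : ℝ)..(α * a), M u := by
  rw [intervalIntegral.integral_const_mul, intervalIntegral.mul_integral_comp_mul_left,
    intervalIntegral.integral_interval_sub_left]
  · exact intervalIntegrable_of_forall_integrableOn_Ioc hM le_rfl (by positivity)
  · exact intervalIntegrable_of_forall_integrableOn_Ioc hM le_rfl (by positivity)

lemma integrableOn_dilation {M : ℝ → ℝ} (hM : ∀ R, IntegrableOn M (Ioc 0 R)) {α : ℝ} (hα : 0 < α)
    (R : ℝ) : IntegrableOn (fun t => α * M (α * t)) (Ioc 0 R) := by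
  refine Integrable.const_mul ?_ α
  have h : IntegrableOn ((Ioc 0 (α * R)).indicator M) (Ioi 0) :=
    ((integrable_indicator_iff measurableSet_Ioc).2 (hM (α * R))).integrableOn
  rw [← mul_zero α, ← integrableOn_Ioi_comp_mul_left_iff _ _ hα] at h
  refine (h.mono_set Ioc_subset_Ioi_self).congr_fun (fun t ht => ?_) measurableSet_Ioc
  have : α * t ∈ Ioc 0 (α * R) := ⟨mul_pos hα ht.1, by gcongr; exact ht.2⟩
  simp [this.1, this.2]

/-- The part of `(0, δ]` where a monotone function exceeds a level is an interval `(c, δ]`, up to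
a null set. -/
lemma exists_superlevel_ae_eq_Ioc {p : ℝ → ℝ} (hp : Monotone p) {δ : ℝ} (hδ : 0 < δ) {y : ℝ}
    (hy : p.rightLim 0 < y) :
    ∃ c, 0 < c ∧ c ≤ δ ∧ ({t | y < p t} ∩ Ioc 0 δ : Set ℝ) =ᵐ[volume] Ioc c δ := by
  have h1 := (hp.tendsto_rightLim 0).eventually (gt_mem_nhds hy)
  obtain ⟨t₀, ht₀, ht₀'⟩ : ∃ t₀, p t₀ < y ∧ t₀ ∈ Ioc 0 δ :=
    (h1.and (Ioc_mem_nhdsGT hδ)).exists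
  by_cases hS : y < p δ
  · set S := {t | y < p t} ∩ Ioc 0 δ with hSd
    have hne : S.Nonempty := ⟨δ, hS, hδ, le_rfl⟩
    have hlb : ∀ t ∈ S, t₀ ≤ t := fun t ht => by
      by_contra hlt
      exact absurd (hp (not_le.1 hlt).le) (not_le.2 (ht₀.trans ht.1))
    have hbdd : BddBelow S := ⟨t₀, hlb⟩
    have hc : t₀ ≤ sInf S := le_csInf hne hlb
    refine ⟨sInf S, ht₀'.1.trans_le hc, csInf_le hbdd ⟨hS, hδ, le_rfl⟩, ?_⟩
    have hsub1 : S ⊆ Icc (sInf S) δ := fun t ht => ⟨csInf_le hbdd ht, ht.2.2⟩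
    have hsub2 : Ioc (sInf S) δ ⊆ S := fun t ht => by
      obtain ⟨u, hu, hut⟩ := exists_lt_of_csInf_lt hne ht.1
      exact ⟨lt_of_lt_of_le hu.1 (hp hut.le), hu.2.1.trans hut, ht.2⟩
    exact (hsub1.eventuallyLE.trans Ioc_ae_eq_Icc.symm.le).antisymm hsub2.eventuallyLE
  · refine ⟨δ, hδ, le_rfl, ?_⟩
    have : ({t | y < p t} ∩ Ioc 0 δ : Set ℝ) = ∅ := by
      ext t
      simp only [mem_inter_iff, mem_ofPred_eq, mem_empty_iff_false, iff_false, not_and]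
      exact fun h h2 => hS (h.trans_le (hp h2.2))
    simp [this]

/-- Layer cake: p(t) - p(0+) is the measure of the levels y in (p(0+), p(δ)] with y < p(t), followed
by Fubini. The superlevel sets are intervals up to null sets, so only primitives of h enter. -/
lemma integral_monotone_mul_eq {p h : ℝ → ℝ} (hp : Monotone p) {δ : ℝ}
    (hh : IntegrableOn h (Ioc 0 δ)) :
    ∫ t in Ioc 0 δ, (p t - p.rightLim 0) * h t =
      ∫ y in Ioc (p.rightLim 0) (p δ), ∫ t in {t | y < p t} ∩ Ioc 0 δ, h t := by
  set p₀ := p.rightLim 0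
  have hmeas : MeasurableSet {z : ℝ × ℝ | z.2 < p z.1} :=
    measurableSet_lt measurable_snd (hp.measurable.comp measurable_fst)
  have hint : Integrable (Function.uncurry fun t y => {z : ℝ × ℝ | z.2 < p z.1}.indicator
      (fun z => h z.1) (t, y)) ((volume.restrict (Ioc 0 δ)).prod (volume.restrict (Ioc p₀ (p δ)))) := by
    have : Integrable (fun z : ℝ × ℝ => h z.1)
        ((volume.restrict (Ioc 0 δ)).prod (volume.restrict (Ioc p₀ (p δ)))) :=
      Integrable.comp_fst hh _
    exact this.indicator hmeas
  have hsw := integral_integral_swap hint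
  have hL : ∫ t in Ioc 0 δ, ∫ y in Ioc p₀ (p δ), {z : ℝ × ℝ | z.2 < p z.1}.indicator
      (fun z => h z.1) (t, y) = ∫ t in Ioc 0 δ, (p t - p₀) * h t := by
    refine setIntegral_congr_fun measurableSet_Ioc fun t ht => ?_
    have e : (fun y => {z : ℝ × ℝ | z.2 < p z.1}.indicator (fun z => h z.1) (t, y)) =
        (Iio (p t)).indicator (fun _ => h t) := by
      ext y; simp [indicator]
    simp only [e]
    rw [setIntegral_indicator measurableSet_Iio, setIntegral_const, smul_eq_mul]
    have e2 : Ioc p₀ (p δ) ∩ Iio (p t) = Ioo p₀ (p t) := by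
      ext y
      simp only [mem_inter_iff, mem_Ioc, mem_Iio, mem_Ioo]
      have := hp ht.2
      constructor
      · rintro ⟨⟨a, b⟩, c⟩; exact ⟨a, c⟩
      · rintro ⟨a, c⟩; exact ⟨⟨a, by linarith⟩, c⟩
    rw [e2, Real.volume_real_Ioo_of_le (hp.rightLim_le ht.1)]
  have hR : ∫ y in Ioc p₀ (p δ), ∫ t in Ioc 0 δ, {z : ℝ × ℝ | z.2 < p z.1}.indicator
      (fun z => h z.1) (t, y) = ∫ y in Ioc p₀ (p δ), ∫ t in {t | y < p t} ∩ Ioc 0 δ, h t := by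
    refine integral_congr_ae (.of_forall fun y => ?_)
    have e : (fun t => {z : ℝ × ℝ | z.2 < p z.1}.indicator (fun z => h z.1) (t, y)) =
        {t | y < p t}.indicator h := by
      ext t; simp [indicator]
    simp only [e]
    rw [setIntegral_indicator (measurableSet_lt measurable_const hp.measurable), inter_comm]
  rw [← hL, ← hR, hsw]

/-- This plays the role of the second mean value theorem. At each level y > p(0+) the inner integral
is a difference of two values of the primitive at points tending to infinity, so it tends to P - P =
0; it is bounded by 2B and the range of levels is bounded. -/
lemma tendsto_integral_monotone_mul_dilation {M : ℝ → ℝ} {P : ℝ}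
    (hM : ∀ R, IntegrableOn M (Ioc 0 R))
    (hP : Tendsto (fun S => ∫ u in (0 : ℝ)..S, M u) atTop (𝓝 P))
    {p : ℝ → ℝ} (hp : Monotone p) {δ : ℝ} (hδ : 0 < δ) :
    Tendsto (fun α : ℝ => ∫ t in Ioc 0 δ, (p t - p.rightLim 0) * (α * M (α * t))) atTop (𝓝 0) := by
  obtain ⟨B, hB⟩ := exists_abs_primitive_le hM hP
  have hinner : ∀ y, p.rightLim 0 < y → ∃ c, 0 < c ∧ c ≤ δ ∧ ∀ α : ℝ, 0 < α →
      ∫ t in {t | y < p t} ∩ Ioc 0 δ, α * M (α * t) =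
        (∫ u in (0 : ℝ)..(α * δ), M u) - ∫ u in (0 : ℝ)..(α * c), M u := by
    intro y hy
    obtain ⟨c, hc, hcδ, hae⟩ := exists_superlevel_ae_eq_Ioc hp hδ hy
    refine ⟨c, hc, hcδ, fun α hα => ?_⟩
    rw [setIntegral_congr_set hae, ← intervalIntegral.integral_of_le hcδ,
      integral_dilation hM hα hc.le hδ.le]
  have key : Tendsto (fun α : ℝ => ∫ y in Ioc (p.rightLim 0) (p δ),
      ∫ t in {t | y < p t} ∩ Ioc 0 δ, α * M (α * t)) atTop (𝓝 (∫ y in Ioc (p.rightLim 0) (p δ), 0)) := by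
    refine tendsto_integral_filter_of_dominated_convergence (fun _ => 2 * B) ?_ ?_ ?_ ?_
    · filter_upwards [eventually_gt_atTop 0] with α hα
      have hmeas : MeasurableSet {z : ℝ × ℝ | z.2 < p z.1} :=
        measurableSet_lt measurable_snd (hp.measurable.comp measurable_fst)
      have hint : Integrable (fun z : ℝ × ℝ => {z : ℝ × ℝ | z.2 < p z.1}.indicator
          (fun z => α * M (α * z.1)) z)
          ((volume.restrict (Ioc 0 δ)).prod (volume.restrict (Ioc (p.rightLim 0) (p δ)))) :=
        (Integrable.comp_fst (integrableOn_dilation hM hα δ) _).indicator hmeas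
      refine hint.integral_prod_right.aestronglyMeasurable.congr (.of_forall fun y => ?_)
      have e : (fun t => {z : ℝ × ℝ | z.2 < p z.1}.indicator (fun z => α * M (α * z.1)) (t, y)) =
          {t | y < p t}.indicator (fun t => α * M (α * t)) := by
        ext t; simp [indicator]
      simp only [e]
      rw [setIntegral_indicator (measurableSet_lt measurable_const hp.measurable), inter_comm]
    · filter_upwards [eventually_gt_atTop 0] with α hα
      refine (ae_restrict_iff' measurableSet_Ioc).2 (.of_forall fun y hy => ?_)
      obtain ⟨c, hc, -, he⟩ := hinner y hy.1
      rw [he α hα, Real.norm_eq_abs]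
      refine (abs_sub _ _).trans ?_
      linarith [hB (α * δ) (by positivity), hB (α * c) (by positivity)]
    · exact integrableOn_const (by simp)
    · refine (ae_restrict_iff' measurableSet_Ioc).2 (.of_forall fun y hy => ?_)
      obtain ⟨c, hc, -, he⟩ := hinner y hy.1
      have t1 := (hP.comp (tendsto_id.atTop_mul_const hδ)).sub
        (hP.comp (tendsto_id.atTop_mul_const hc))
      rw [sub_self] at t1
      refine t1.congr' ?_
      filter_upwards [eventually_gt_atTop 0] with α hα
      exact (he α hα).symm
  rw [integral_zero] at key
  refine key.congr' ?_
  filter_upwards [eventually_gt_atTop 0] with α hα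
  exact (integral_monotone_mul_eq hp (integrableOn_dilation hM hα δ)).symm

/-- Integration by parts moves the dilation onto the primitive, which is bounded and whose
increments over [δ,t] tend to 0. -/
lemma tendsto_integral_smooth_mul_dilation {M : ℝ → ℝ} {P : ℝ} (hMc : ContinuousOn M (Ioi 0))
    (hM : ∀ R, IntegrableOn M (Ioc 0 R))
    (hP : Tendsto (fun S => ∫ u in (0 : ℝ)..S, M u) atTop (𝓝 P))
    {g : ℝ → ℝ} (hg : ContDiff ℝ 1 g) (hgs : HasCompactSupport g) {δ : ℝ} (hδ : 0 < δ) :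
    Tendsto (fun α : ℝ => ∫ t in Ioi δ, g t * (α * M (α * t))) atTop (𝓝 0) := by
  obtain ⟨B, hB⟩ := exists_abs_primitive_le hM hP
  obtain ⟨R, hδR, hR⟩ : ∃ R, δ ≤ R ∧ ∀ t, R ≤ t → g t = 0 := by
    obtain ⟨r, hr⟩ := hgs.isCompact.isBounded.subset_closedBall 0
    refine ⟨max δ (r + 1), le_max_left _ _, fun t ht => ?_⟩
    by_contra h
    have h1 := hr (subset_tsupport g (Function.mem_support.2 h))
    rw [Metric.mem_closedBall, Real.dist_eq, sub_zero] at h1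
    linarith [le_abs_self t, le_max_right δ (r + 1)]
  have hg' : Continuous (deriv g) := hg.continuous_deriv le_rfl
  have hgd : ∀ t, HasDerivAt g (deriv g t) t := fun t =>
    (hg.differentiable one_ne_zero t).hasDerivAt
  -- The primitive is normalised to vanish at δ, and g vanishes at R, so there are no boundary
  -- terms.
  set v : ℝ → ℝ → ℝ := fun α t => (∫ u in (0 : ℝ)..(α * t), M u) - ∫ u in (0 : ℝ)..(α * δ), M u
    with hv
  have hvd : ∀ α : ℝ, 0 < α → ∀ t, 0 < t → HasDerivAt (v α) (α * M (α * t)) t := by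
    intro α hα t ht
    have hαt : 0 < α * t := by positivity
    have h1 := intervalIntegral.integral_hasDerivAt_right
      (intervalIntegrable_of_forall_integrableOn_Ioc hM le_rfl hαt.le)
      (hMc.stronglyMeasurableAtFilter isOpen_Ioi _ hαt)
      (hMc.continuousAt (Ioi_mem_nhds hαt))
    have h2 := (h1.comp t ((hasDerivAt_id t).const_mul α)).sub_const
      (∫ u in (0 : ℝ)..(α * δ), M u)
    refine h2.congr_deriv ?_
    simp [mul_comm]
  have hcv : ∀ α : ℝ, 0 < α → ContinuousOn (v α) (uIcc δ R) := fun α hα t ht => by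
    rw [uIcc_of_le hδR] at ht
    exact (hvd α hα t (hδ.trans_le ht.1)).continuousAt.continuousWithinAt
  have hparts : ∀ α : ℝ, 0 < α → ∫ t in Ioi δ, g t * (α * M (α * t)) =
      -∫ t in δ..R, deriv g t * v α t := by
    intro α hα
    have e1 : ∫ t in Ioi δ, g t * (α * M (α * t)) = ∫ t in δ..R, g t * (α * M (α * t)) := by
      rw [intervalIntegral.integral_of_le hδR]
      refine (setIntegral_eq_of_subset_of_forall_sdiff_eq_zero measurableSet_Ioi
        Ioc_subset_Ioi_self fun t ht => ?_)
      rw [hR t (not_lt.1 fun h => ht.2 ⟨ht.1, h.le⟩), zero_mul]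
    have d1 : ∀ t ∈ uIcc δ R, HasDerivAt (v α) (α * M (α * t)) t := fun t ht => by
      rw [uIcc_of_le hδR] at ht
      exact hvd α hα t (hδ.trans_le ht.1)
    have i1 : IntervalIntegrable (fun t => α * M (α * t)) volume δ R := by
      rw [intervalIntegrable_iff_integrableOn_Ioc_of_le hδR]
      exact (integrableOn_dilation hM hα R).mono_set (Ioc_subset_Ioc_left hδ.le)
    rw [e1, intervalIntegral.integral_mul_deriv_eq_deriv_mul (fun t _ => hgd t) d1
      (hg'.intervalIntegrable _ _) i1, hR R le_rfl]
    simp [hv]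
  have key : Tendsto (fun α : ℝ => ∫ t in δ..R, deriv g t * v α t) atTop
      (𝓝 (∫ t in δ..R, (0 : ℝ))) := by
    refine intervalIntegral.tendsto_integral_filter_of_dominated_convergence
      (fun t => |deriv g t| * (2 * B)) ?_ ?_ ?_ ?_
    · filter_upwards [eventually_gt_atTop 0] with α hα
      exact ((hg'.continuousOn.mul (hcv α hα)).mono uIoc_subset_uIcc).aestronglyMeasurable
        measurableSet_uIoc
    · filter_upwards [eventually_gt_atTop 0] with α hα
      refine .of_forall fun t ht => ?_
      rw [uIoc_of_le hδR] at ht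
      have ht0 : 0 < t := hδ.trans ht.1
      rw [norm_mul, Real.norm_eq_abs, Real.norm_eq_abs]
      gcongr
      refine (abs_sub _ _).trans ?_
      linarith [hB (α * δ) (by positivity), hB (α * t) (by positivity)]
    · exact (hg'.abs.mul continuous_const).intervalIntegrable _ _
    · refine .of_forall fun t ht => ?_
      rw [uIoc_of_le hδR] at ht
      have t1 := (hP.comp (tendsto_id.atTop_mul_const (hδ.trans ht.1))).sub
        (hP.comp (tendsto_id.atTop_mul_const hδ))
      rw [sub_self] at t1
      simpa using t1.const_mul (deriv g t)
  rw [intervalIntegral.integral_zero] at key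
  have key' := key.neg
  rw [neg_zero] at key'
  refine key'.congr' ?_
  filter_upwards [eventually_gt_atTop 0] with α hα using (hparts α hα).symm

/-- The bound M = O(1/s) makes the dilates uniformly bounded on (δ,∞) once α ≥ 1/δ; this lets L₁
approximation of f pass through the limit. -/
lemma abs_dilation_le {M : ℝ → ℝ} {C : ℝ} (hC : 0 < C) (hMb : ∀ s, 1 ≤ s → |M s| ≤ C / s)
    {α δ t : ℝ} (hδ : 0 < δ) (hα : 0 < α) (hαδ : 1 ≤ α * δ) (ht : δ < t) :
    |α * M (α * t)| ≤ C / δ := by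
  have h1 : α * δ ≤ α * t := by gcongr
  have h2 := hMb (α * t) (hαδ.trans h1)
  rw [abs_mul, abs_of_pos hα]
  calc α * |M (α * t)| ≤ α * (C / (α * t)) := by gcongr
    _ = C / t := by field_simp
    _ ≤ C / δ := by gcongr

lemma tendsto_integral_Ioi_mul_dilation {M : ℝ → ℝ} {C P : ℝ} (hMc : ContinuousOn M (Ioi 0))
    (hM : ∀ R, IntegrableOn M (Ioc 0 R)) (hC : 0 < C) (hMb : ∀ s, 1 ≤ s → |M s| ≤ C / s)
    (hP : Tendsto (fun S => ∫ u in (0 : ℝ)..S, M u) atTop (𝓝 P))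
    {f : ℝ → ℝ} {δ : ℝ} (hδ : 0 < δ) (hf : IntegrableOn f (Ioi δ)) :
    Tendsto (fun α : ℝ => ∫ t in Ioi δ, f t * (α * M (α * t))) atTop (𝓝 0) := by
  rw [Metric.tendsto_nhds]
  intro ε hε
  obtain ⟨g, hgs, hg, hgf⟩ := MemLp.exist_eLpNorm_sub_le
    (p := 1) (f := f) (μ := volume.restrict (Ioi δ)) ENNReal.one_ne_top le_rfl
    -- After multiplication by the uniform bound C/δ this tolerance costs ε/2.
    (memLp_one_iff_integrable.2 hf) (show 0 < ε * δ / (2 * C) by positivity)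
  have hgi : IntegrableOn g (Ioi δ) := (hg.continuous.integrable_of_hasCompactSupport hgs).integrableOn
  have hfg : ∫ t in Ioi δ, |f t - g t| ≤ ε * δ / (2 * C) := by
    have h := (hf.sub hgi)
    have h2 := integral_norm_eq_lintegral_enorm h.aestronglyMeasurable
    rw [eLpNorm_one_eq_lintegral_enorm] at hgf
    have h3 := ENNReal.toReal_mono ENNReal.ofReal_ne_top hgf
    rw [ENNReal.toReal_ofReal (by positivity), ← h2] at h3
    exact h3
  have hlim := tendsto_integral_smooth_mul_dilation hMc hM hP (hg.of_le (by simp)) hgs hδ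
  filter_upwards [(Metric.tendsto_nhds.1 hlim) (ε / 2) (by positivity), eventually_gt_atTop 0,
    eventually_ge_atTop (1 / δ)] with α h1 hα hα2
  have hαδ : 1 ≤ α * δ := by rwa [div_le_iff₀ hδ] at hα2
  rw [Real.dist_eq, sub_zero] at h1 ⊢
  have hb : ∀ᵐ t ∂volume.restrict (Ioi δ), ‖α * M (α * t)‖ ≤ C / δ :=
    (ae_restrict_iff' measurableSet_Ioi).2 (.of_forall fun t ht =>
      abs_dilation_le hC hMb hδ hα hαδ ht)
  have hms : AEStronglyMeasurable (fun t => α * M (α * t)) (volume.restrict (Ioi δ)) := by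
    refine ContinuousOn.aestronglyMeasurable (continuousOn_const.mul (hMc.comp
      (continuousOn_const.mul continuousOn_id) fun t ht => ?_)) measurableSet_Ioi
    exact mul_pos hα (hδ.trans ht)
  have i1 : IntegrableOn (fun t => (f t - g t) * (α * M (α * t))) (Ioi δ) :=
    (hf.sub hgi).mul_bdd hms hb
  have i2 : IntegrableOn (fun t => g t * (α * M (α * t))) (Ioi δ) := hgi.mul_bdd hms hb
  have e : ∫ t in Ioi δ, f t * (α * M (α * t)) = (∫ t in Ioi δ, (f t - g t) * (α * M (α * t))) +
      ∫ t in Ioi δ, g t * (α * M (α * t)) := by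
    rw [← integral_add i1 i2]
    refine integral_congr_ae (.of_forall fun t => ?_)
    simp only
    ring
  have h3 : |∫ t in Ioi δ, (f t - g t) * (α * M (α * t))| ≤ ε / 2 := by
    rw [← Real.norm_eq_abs]
    refine (norm_integral_le_integral_norm _).trans ?_
    calc ∫ t in Ioi δ, ‖(f t - g t) * (α * M (α * t))‖ ≤ ∫ t in Ioi δ, |f t - g t| * (C / δ) := by
          refine integral_mono_ae i1.norm ((hf.sub hgi).norm.mul_const _) ?_
          filter_upwards [hb] with t ht
          rw [norm_mul, Real.norm_eq_abs (f t - g t)]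
          gcongr
      _ = (∫ t in Ioi δ, |f t - g t|) * (C / δ) := integral_mul_const _ _
      _ ≤ ε * δ / (2 * C) * (C / δ) := by gcongr
      _ = ε / 2 := by field_simp
  rw [e]
  exact (abs_add_le _ _).trans_lt (by linarith)

lemma exists_monotone_sub_monotone {f : ℝ → ℝ} {δ : ℝ} (hδ : 0 < δ)
    (hf : BoundedVariationOn f (Icc 0 δ)) :
    ∃ p q : ℝ → ℝ, Monotone p ∧ Monotone q ∧ ∀ t ∈ Icc 0 δ, f t = p t - q t := by
  obtain ⟨p, q, hp, hq, hpq⟩ := hf.locallyBoundedVariationOn.exists_monotoneOn_sub_monotoneOn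
  -- Freezing p outside [0,δ] makes it monotone on the whole line, as the right-limit lemmas
  -- require.
  have ext : ∀ {p : ℝ → ℝ}, MonotoneOn p (Icc 0 δ) →
      Monotone fun t => p (projIcc 0 δ hδ.le t) := fun {p} hp x y hxy =>
    hp (projIcc 0 δ hδ.le x).2 (projIcc 0 δ hδ.le y).2 (monotone_projIcc hδ.le hxy)
  refine ⟨_, _, ext hp, ext hq, fun t ht => ?_⟩
  simp only [projIcc_of_mem hδ.le ht, hpq, Pi.sub_apply]

/-- After rescaling, f on (0,δ] is f(0) plus a difference of monotone functions with right limit 0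
at the origin. The constant contributes f(0)P; the monotone parts and the integral over (δ,∞) vanish
in the limit. -/
theorem tendsto_integral_mul_dilation {M : ℝ → ℝ} {C P : ℝ} (hMc : ContinuousOn M (Ioi 0))
    (hM : ∀ R, IntegrableOn M (Ioc 0 R)) (hC : 0 < C) (hMb : ∀ s, 1 ≤ s → |M s| ≤ C / s)
    (hP : Tendsto (fun S => ∫ u in (0 : ℝ)..S, M u) atTop (𝓝 P))
    {f : ℝ → ℝ} (hfc : ContinuousOn f (Ici 0)) (hfi : IntegrableOn f (Ioi 0))
    (hbv : ∃ δ > 0, BoundedVariationOn f (Icc 0 δ)) :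
    Tendsto (fun α : ℝ => ∫ s in Ioi 0, f (s / α) * M s) atTop (𝓝 (f 0 * P)) := by
  obtain ⟨δ, hδ, hbv⟩ := hbv
  obtain ⟨p, q, hp, hq, hpq⟩ := exists_monotone_sub_monotone hδ hbv
  -- Continuity of f at 0 matters here: p and q may jump at 0, but the jumps cancel.
  have h0 : f 0 = p.rightLim 0 - q.rightLim 0 := by
    have h1 : Tendsto f (𝓝[>] 0) (𝓝 (f 0)) :=
      (hfc 0 self_mem_Ici).mono_left (nhdsWithin_mono _ Ioi_subset_Ici_self)
    refine tendsto_nhds_unique h1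
      (((hp.tendsto_rightLim 0).sub (hq.tendsto_rightLim 0)).congr' ?_)
    filter_upwards [Ioc_mem_nhdsGT hδ] with t ht
    exact (hpq t ⟨ht.1.le, ht.2⟩).symm
  have t1 := tendsto_integral_monotone_mul_dilation hM hP hp hδ
  have t2 := tendsto_integral_monotone_mul_dilation hM hP hq hδ
  have t3 := tendsto_integral_Ioi_mul_dilation hMc hM hC hMb hP hδ
    (hfi.mono_set (Ioi_subset_Ioi hδ.le))
  have t4 := (hP.comp (tendsto_id.atTop_mul_const hδ)).const_mul (f 0)
  have t5 := ((t1.sub t2).add t4).add t3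
  simp only [sub_self, zero_add, add_zero] at t5
  refine t5.congr' ?_
  filter_upwards [eventually_gt_atTop 0, eventually_ge_atTop (1 / δ)] with α hα hα2
  have hαδ : 1 ≤ α * δ := by rwa [div_le_iff₀ hδ] at hα2
  have hd := integrableOn_dilation hM hα δ
  have hbd : ∀ {p : ℝ → ℝ}, Monotone p →
      IntegrableOn (fun t => (p t - p.rightLim 0) * (α * M (α * t))) (Ioc 0 δ) := by
    intro p hp
    refine Integrable.bdd_mul (c := p δ - p.rightLim 0) hd
      (hp.measurable.sub_const _).aestronglyMeasurable ?_
    refine (ae_restrict_iff' measurableSet_Ioc).2 (.of_forall fun t ht => ?_)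
    rw [Real.norm_eq_abs, abs_of_nonneg (sub_nonneg.2 (hp.rightLim_le ht.1))]
    linarith [hp ht.2]
  have e1 : ∫ t in Ioc 0 δ, f t * (α * M (α * t)) =
      (∫ t in Ioc 0 δ, (p t - p.rightLim 0) * (α * M (α * t))) -
      (∫ t in Ioc 0 δ, (q t - q.rightLim 0) * (α * M (α * t))) +
      f 0 * ∫ u in (0 : ℝ)..(α * δ), M u := by
    have := integral_dilation hM hα le_rfl hδ.le
    rw [mul_zero, intervalIntegral.integral_same, sub_zero] at this
    rw [← this, intervalIntegral.integral_of_le hδ.le, ← integral_sub (hbd hp) (hbd hq),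
      ← integral_const_mul]
    refine Eq.trans ?_ (integral_add ((hbd hp).sub (hbd hq)) (hd.const_mul (f 0)))
    refine setIntegral_congr_fun measurableSet_Ioc fun t ht => ?_
    show f t * (α * M (α * t)) = (p t - p.rightLim 0) * (α * M (α * t)) -
      (q t - q.rightLim 0) * (α * M (α * t)) + f 0 * (α * M (α * t))
    rw [hpq t ⟨ht.1.le, ht.2⟩, h0]
    ring
  have hi1 : IntegrableOn (fun t => f t * (α * M (α * t))) (Ioc 0 δ) := by
    have := ((hbd hp).sub (hbd hq)).add (hd.const_mul (f 0))
    refine IntegrableOn.congr_fun this (fun t ht => ?_) measurableSet_Ioc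
    simp only [Pi.add_apply, Pi.sub_apply]
    rw [hpq t ⟨ht.1.le, ht.2⟩, h0]
    ring
  have hi2 : IntegrableOn (fun t => f t * (α * M (α * t))) (Ioi δ) := by
    refine Integrable.mul_bdd (c := C / δ) (hfi.mono_set (Ioi_subset_Ioi hδ.le)) ?_ ?_
    · refine ContinuousOn.aestronglyMeasurable (continuousOn_const.mul (hMc.comp
        (continuousOn_const.mul continuousOn_id) fun t ht => ?_)) measurableSet_Ioi
      exact mul_pos hα (hδ.trans ht)
    · exact (ae_restrict_iff' measurableSet_Ioi).2 (.of_forall fun t ht =>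
        abs_dilation_le hC hMb hδ hα hαδ ht)
  simp only [Function.comp, id]
  rw [← e1, ← setIntegral_union (Ioc_disjoint_Ioi le_rfl) measurableSet_Ioi hi1 hi2,
    Ioc_union_Ioi_eq_Ioi hδ.le]
  have hsub := integral_comp_mul_left_Ioi (fun s => f (s / α) * M s) 0 hα
  rw [mul_zero] at hsub
  have e2 : ∫ s in Ioi 0, f (s / α) * M s = α * ∫ t in Ioi 0, f (α * t / α) * M (α * t) := by
    rw [hsub, smul_eq_mul, mul_inv_cancel_left₀ hα.ne']
  rw [e2, ← integral_const_mul]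
  refine integral_congr_ae (.of_forall fun t => ?_)
  simp only
  rw [mul_div_cancel_left₀ _ hα.ne']
  ring

/-! ### The Macdonald functions K₀ and x K₁ -/

/-- `x K₁(x)` for the modified Bessel function `K₁`, by its heat kernel representation. -/
def xMacdonaldOne (x : ℝ) : ℝ := ∫ τ in Ioi (0 : ℝ), Real.exp (-τ) * Real.exp (-(x ^ 2 / 4 / τ))

/-- The modified Bessel function `K₀`. -/
def macdonaldZero (x : ℝ) : ℝ :=
  ∫ τ in Ioi (0 : ℝ), Real.exp (-τ) * (Real.exp (-(x ^ 2 / 4 / τ)) / τ) / 2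

lemma integrableOn_exp_neg_Ioi_zero : IntegrableOn (fun τ : ℝ => Real.exp (-τ)) (Ioi 0) := by
  simpa using integrableOn_exp_neg_Ioi 0

/-- This bound and the next absorb negative powers of τ at τ = 0, so that e^{-τ} times a constant
majorises the integrands. -/
lemma exp_neg_div_div_le {c τ : ℝ} (hc : 0 < c) (hτ : 0 < τ) :
    Real.exp (-(c / τ)) / τ ≤ 1 / c := by
  have h : c / τ ≤ Real.exp (c / τ) := by linarith [Real.add_one_le_exp (c / τ)]
  rw [Real.exp_neg, inv_eq_one_div, div_div, one_div_le_one_div (by positivity) hc]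
  rwa [div_le_iff₀ hτ] at h

lemma exp_neg_div_div_sq_le {c τ : ℝ} (hc : 0 < c) (hτ : 0 < τ) :
    Real.exp (-(c / τ)) / τ ^ 2 ≤ 2 / c ^ 2 := by
  have h : (c / τ) ^ 2 / 2 ≤ Real.exp (c / τ) := by
    have := Real.quadratic_le_exp_of_nonneg (show 0 ≤ c / τ by positivity)
    have h0 : 0 < c / τ := by positivity
    linarith
  rw [Real.exp_neg, inv_eq_one_div, div_div, div_le_div_iff₀ (by positivity) (by positivity)]
  rw [div_pow, div_div, div_le_iff₀ (by positivity)] at h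
  linarith

lemma measurable_macdonald_kernel (x : ℝ) :
    Measurable fun τ : ℝ => Real.exp (-τ) * Real.exp (-(x ^ 2 / 4 / τ)) := by fun_prop

lemma exp_neg_sq_div_le_one (x : ℝ) {τ : ℝ} (hτ : 0 < τ) : Real.exp (-(x ^ 2 / 4 / τ)) ≤ 1 := by
  rw [Real.exp_le_one_iff, neg_nonpos]; positivity

lemma integrableOn_xMacdonaldOne (x : ℝ) :
    IntegrableOn (fun τ : ℝ => Real.exp (-τ) * Real.exp (-(x ^ 2 / 4 / τ))) (Ioi 0) := by
  refine Integrable.mono' integrableOn_exp_neg_Ioi_zero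
    (measurable_macdonald_kernel x).aestronglyMeasurable ?_
  refine (ae_restrict_iff' measurableSet_Ioi).2 (.of_forall fun τ hτ => ?_)
  rw [Real.norm_of_nonneg (by positivity)]
  exact mul_le_of_le_one_right (by positivity) (exp_neg_sq_div_le_one x hτ)

lemma integrableOn_macdonaldZero {x : ℝ} (hx : 0 < x) :
    IntegrableOn (fun τ : ℝ => Real.exp (-τ) * (Real.exp (-(x ^ 2 / 4 / τ)) / τ) / 2) (Ioi 0) := by
  refine Integrable.mono' (integrableOn_exp_neg_Ioi_zero.mul_const (1 / (x ^ 2 / 4) / 2))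
    (by fun_prop) ?_
  refine (ae_restrict_iff' measurableSet_Ioi).2 (.of_forall fun τ hτ => ?_)
  have hτ0 : 0 < τ := hτ
  rw [Real.norm_of_nonneg (by positivity), mul_div_assoc]
  have h := exp_neg_div_div_le (show 0 < x ^ 2 / 4 by positivity) hτ0
  gcongr Real.exp (-τ) * (?_ / 2)

lemma xMacdonaldOne_nonneg (x : ℝ) : 0 ≤ xMacdonaldOne x :=
  setIntegral_nonneg measurableSet_Ioi fun τ _ => by positivity

lemma macdonaldZero_nonneg (x : ℝ) : 0 ≤ macdonaldZero x :=
  setIntegral_nonneg measurableSet_Ioi fun τ hτ => by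
    have : (0 : ℝ) < τ := hτ
    positivity

lemma integral_exp_neg_Ioi_zero' : ∫ τ in Ioi (0 : ℝ), Real.exp (-τ) = 1 := by
  rw [integral_exp_neg_Ioi 0, neg_zero, Real.exp_zero]

lemma xMacdonaldOne_zero : xMacdonaldOne 0 = 1 := by
  rw [xMacdonaldOne, ← integral_exp_neg_Ioi_zero']
  simp

lemma xMacdonaldOne_antitoneOn : AntitoneOn xMacdonaldOne (Ici 0) := by
  intro x hx y hy hxy
  refine setIntegral_mono_on (integrableOn_xMacdonaldOne y) (integrableOn_xMacdonaldOne x)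
    measurableSet_Ioi fun τ hτ => ?_
  have : (0 : ℝ) < τ := hτ
  have h0 : 0 ≤ x := hx
  gcongr

lemma xMacdonaldOne_le_one {x : ℝ} (hx : 0 ≤ x) : xMacdonaldOne x ≤ 1 :=
  xMacdonaldOne_zero ▸ xMacdonaldOne_antitoneOn self_mem_Ici hx hx

lemma macdonaldZero_antitoneOn : AntitoneOn macdonaldZero (Ioi 0) := by
  intro x hx y hy hxy
  refine setIntegral_mono_on (integrableOn_macdonaldZero hy) (integrableOn_macdonaldZero hx)
    measurableSet_Ioi fun τ hτ => ?_
  have : (0 : ℝ) < τ := hτ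
  have h0 : 0 < x := hx
  gcongr

lemma continuous_xMacdonaldOne : Continuous xMacdonaldOne := by
  refine continuous_of_dominated (bound := fun τ => Real.exp (-τ))
    (fun x => (measurable_macdonald_kernel x).aestronglyMeasurable) (fun x => ?_)
    integrableOn_exp_neg_Ioi_zero (.of_forall fun τ => by fun_prop)
  refine (ae_restrict_iff' measurableSet_Ioi).2 (.of_forall fun τ hτ => ?_)
  rw [Real.norm_of_nonneg (by positivity)]
  exact mul_le_of_le_one_right (by positivity) (exp_neg_sq_div_le_one x hτ)

lemma hasDerivAt_exp_neg_sq_div (τ x : ℝ) :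
    HasDerivAt (fun x : ℝ => Real.exp (-(x ^ 2 / 4 / τ)))
      (-(x / 2) * (Real.exp (-(x ^ 2 / 4 / τ)) / τ)) x := by
  refine ((((hasDerivAt_pow 2 x).div_const 4).div_const τ).neg.exp).congr_deriv ?_
  simp
  ring

lemma hasDerivAt_xMacdonaldOne {x : ℝ} (hx : 0 < x) :
    HasDerivAt xMacdonaldOne (-(x * macdonaldZero x)) x := by
  have hs : Ioo (x / 2) (2 * x) ∈ 𝓝 x := Ioo_mem_nhds (by linarith) (by linarith)
  have := (hasDerivAt_integral_of_dominated_loc_of_deriv_le (μ := volume.restrict (Ioi 0))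
    (F := fun (x τ : ℝ) => Real.exp (-τ) * Real.exp (-(x ^ 2 / 4 / τ)))
    (F' := fun (x τ : ℝ) => Real.exp (-τ) * (-(x / 2) * (Real.exp (-(x ^ 2 / 4 / τ)) / τ)))
    (x₀ := x) (bound := fun τ => Real.exp (-τ) * (x * (1 / (x ^ 2 / 16)))) hs
    (.of_forall fun y => (measurable_macdonald_kernel y).aestronglyMeasurable)
    (integrableOn_xMacdonaldOne x) (by fun_prop) ?_ (integrableOn_exp_neg_Ioi_zero.mul_const _)
    (.of_forall fun τ y _ => (hasDerivAt_exp_neg_sq_div τ y).const_mul _)).2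
  · refine this.congr_deriv ?_
    rw [macdonaldZero, ← integral_const_mul, ← integral_neg]
    refine integral_congr_ae (.of_forall fun τ => ?_)
    simp only
    ring
  · refine (ae_restrict_iff' measurableSet_Ioi).2 (.of_forall fun τ hτ y hy => ?_)
    have hτ0 : 0 < τ := hτ
    have hy0 : 0 < y := by linarith [hy.1]
    rw [norm_mul, norm_mul, norm_neg, Real.norm_of_nonneg (Real.exp_pos _).le,
      Real.norm_of_nonneg (by positivity), Real.norm_of_nonneg (by positivity)]
    have h1 : y / 2 ≤ x := by linarith [hy.2]
    have h2 : Real.exp (-(y ^ 2 / 4 / τ)) / τ ≤ 1 / (x ^ 2 / 16) := by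
      refine (exp_neg_div_div_le (by positivity) hτ0).trans ?_
      have h3 : x ^ 2 / 16 ≤ y ^ 2 / 4 := by nlinarith [hy.1]
      gcongr
    gcongr

lemma hasDerivAt_exp_neg_sub_div (c : ℝ) {τ : ℝ} (hτ : 0 < τ) :
    HasDerivAt (fun τ : ℝ => Real.exp (-τ) * Real.exp (-(c / τ)))
      (Real.exp (-τ) * (c * (Real.exp (-(c / τ)) / τ ^ 2)) - Real.exp (-τ) * Real.exp (-(c / τ)))
      τ := by
  refine ((hasDerivAt_neg τ).exp.mul
    (((hasDerivAt_const τ c).div (hasDerivAt_id τ) hτ.ne').neg.exp)).congr_deriv ?_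
  simp
  ring

/-- The fundamental theorem with limits at both ends, obtained from integration by parts against the
constant 1. -/
lemma integral_Ioi_of_hasDerivAt_of_tendsto_nhdsGT {f f' : ℝ → ℝ} {a l m : ℝ}
    (hd : ∀ x ∈ Ioi a, HasDerivAt f (f' x) x) (hi : IntegrableOn f' (Ioi a))
    (h0 : Tendsto f (𝓝[>] a) (𝓝 l)) (h1 : Tendsto f atTop (𝓝 m)) :
    ∫ x in Ioi a, f' x = m - l := by
  have := integral_Ioi_deriv_mul_eq_sub (u := f) (u' := f') (v := fun _ => 1) (v' := fun _ => 0)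
    hd (fun x _ => hasDerivAt_const x 1) (a' := l) (b' := m)
    (hi.congr_fun (fun x _ => by simp) measurableSet_Ioi)
    (h0.congr fun x => by simp) (h1.congr fun x => by simp)
  simpa using this

lemma integrableOn_exp_neg_div_sq {c : ℝ} (hc : 0 < c) :
    IntegrableOn (fun τ : ℝ => Real.exp (-τ) * (c * (Real.exp (-(c / τ)) / τ ^ 2))) (Ioi 0) := by
  refine Integrable.mono' (integrableOn_exp_neg_Ioi_zero.mul_const (c * (2 / c ^ 2)))
    (by fun_prop) ?_
  refine (ae_restrict_iff' measurableSet_Ioi).2 (.of_forall fun τ hτ => ?_)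
  have hτ0 : 0 < τ := hτ
  rw [Real.norm_of_nonneg (by positivity)]
  have h := exp_neg_div_div_sq_le hc hτ0
  gcongr Real.exp (-τ) * (c * ?_)

/-- The function e^{-τ - c/τ} vanishes at both ends, so its derivative integrates to 0. This second
representation of x K₁ identifies K₀' with -K₁. -/
lemma integral_exp_neg_div_sq {x : ℝ} (hx : 0 < x) :
    ∫ τ in Ioi (0 : ℝ), Real.exp (-τ) * (x ^ 2 / 4 * (Real.exp (-(x ^ 2 / 4 / τ)) / τ ^ 2)) =
      xMacdonaldOne x := by
  have hc : 0 < x ^ 2 / 4 := by positivity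
  have h := integral_Ioi_of_hasDerivAt_of_tendsto_nhdsGT (a := 0) (l := 0) (m := 0)
    (fun τ hτ => hasDerivAt_exp_neg_sub_div (x ^ 2 / 4) hτ)
    ((integrableOn_exp_neg_div_sq hc).sub (integrableOn_xMacdonaldOne x)) ?_ ?_
  · rw [integral_sub (integrableOn_exp_neg_div_sq hc) (integrableOn_xMacdonaldOne x), sub_zero,
      sub_eq_zero] at h
    exact h
  · refine squeeze_zero_norm' (a := fun τ => 1 / (x ^ 2 / 4) * τ) ?_ ?_
    · filter_upwards [self_mem_nhdsWithin] with τ hτ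
      have hτ0 : 0 < τ := hτ
      rw [Real.norm_of_nonneg (by positivity)]
      have h1 := exp_neg_div_div_le hc hτ0
      rw [div_le_iff₀ hτ0] at h1
      refine (mul_le_of_le_one_left (by positivity) ?_).trans h1
      rw [Real.exp_le_one_iff]
      linarith
    · have : Tendsto (fun τ : ℝ => 1 / (x ^ 2 / 4) * τ) (𝓝 0) (𝓝 (1 / (x ^ 2 / 4) * 0)) :=
        tendsto_id.const_mul _
      rw [mul_zero] at this
      exact this.mono_left nhdsWithin_le_nhds
  · refine squeeze_zero_norm' (a := fun τ => Real.exp (-τ)) ?_ ?_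
    · filter_upwards [eventually_gt_atTop 0] with τ hτ
      rw [Real.norm_of_nonneg (by positivity)]
      exact mul_le_of_le_one_right (by positivity) (exp_neg_sq_div_le_one x hτ)
    · exact Real.tendsto_exp_neg_atTop_nhds_zero

lemma hasDerivAt_macdonaldZero {x : ℝ} (hx : 0 < x) :
    HasDerivAt macdonaldZero (-(xMacdonaldOne x / x)) x := by
  have hs : Ioo (x / 2) (2 * x) ∈ 𝓝 x := Ioo_mem_nhds (by linarith) (by linarith)
  have := (hasDerivAt_integral_of_dominated_loc_of_deriv_le (μ := volume.restrict (Ioi 0))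
    (F := fun (x τ : ℝ) => Real.exp (-τ) * (Real.exp (-(x ^ 2 / 4 / τ)) / τ) / 2)
    (F' := fun (x τ : ℝ) =>
      Real.exp (-τ) * ((-(x / 2) * (Real.exp (-(x ^ 2 / 4 / τ)) / τ)) / τ) / 2)
    (x₀ := x) (bound := fun τ => Real.exp (-τ) * (x * (2 / (x ^ 2 / 16) ^ 2)) / 2) hs
    (.of_forall fun y => by fun_prop)
    (integrableOn_macdonaldZero hx) (by fun_prop) ?_
    ((integrableOn_exp_neg_Ioi_zero.mul_const _).div_const 2)
    (.of_forall fun τ y _ =>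
      (((hasDerivAt_exp_neg_sq_div τ y).div_const τ).const_mul _).div_const 2)).2
  · refine this.congr_deriv ?_
    rw [← integral_exp_neg_div_sq hx, ← integral_div, ← integral_neg]
    refine integral_congr_ae (.of_forall fun τ => ?_)
    simp only
    field_simp
    ring
  · refine (ae_restrict_iff' measurableSet_Ioi).2 (.of_forall fun τ hτ y hy => ?_)
    have hτ0 : 0 < τ := hτ
    have hy0 : 0 < y := by linarith [hy.1]
    have e : Real.exp (-τ) * ((-(y / 2) * (Real.exp (-(y ^ 2 / 4 / τ)) / τ)) / τ) / 2 =
        -(Real.exp (-τ) * (y / 2 * (Real.exp (-(y ^ 2 / 4 / τ)) / τ ^ 2)) / 2) := by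
      field_simp
    rw [e, norm_neg, Real.norm_of_nonneg (by positivity)]
    have h1 : y / 2 ≤ x := by linarith [hy.2]
    have h2 : Real.exp (-(y ^ 2 / 4 / τ)) / τ ^ 2 ≤ 2 / (x ^ 2 / 16) ^ 2 := by
      refine (exp_neg_div_div_sq_le (by positivity) hτ0).trans ?_
      have h3 : x ^ 2 / 16 ≤ y ^ 2 / 4 := by nlinarith [hy.1]
      gcongr
    gcongr

lemma integrableOn_exp_neg_mul_rpow {r : ℝ} (hr : -1 < r) :
    IntegrableOn (fun τ : ℝ => Real.exp (-τ) * τ ^ r) (Ioi 0) := by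
  simpa using Real.GammaIntegral_convergent (s := r + 1) (by linarith)

/-- Polynomial decay is enough for the boundary terms at infinity; it follows from e^{-c/τ} ≤ 2τ²/c²
with c = x²/4 and a Gamma integral. -/
lemma xMacdonaldOne_le_div_pow {x : ℝ} (hx : 0 < x) : xMacdonaldOne x ≤ 64 / x ^ 4 := by
  have hG : ∫ τ in Ioi (0 : ℝ), Real.exp (-τ) * τ ^ (2 : ℝ) = 2 := by
    have := Real.Gamma_eq_integral (s := 3) (by norm_num)
    rw [show (3 : ℝ) = 2 + 1 by norm_num, Real.Gamma_add_one two_ne_zero, Real.Gamma_two] at this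
    simpa using this.symm
  have : xMacdonaldOne x ≤ ∫ τ in Ioi (0 : ℝ), Real.exp (-τ) * τ ^ (2 : ℝ) * (32 / x ^ 4) := by
    refine setIntegral_mono_on (integrableOn_xMacdonaldOne x)
      ((integrableOn_exp_neg_mul_rpow (by norm_num)).mul_const _) measurableSet_Ioi fun τ hτ => ?_
    have hτ0 : 0 < τ := hτ
    have h := exp_neg_div_div_sq_le (show 0 < x ^ 2 / 4 by positivity) hτ0
    rw [div_le_iff₀ (by positivity)] at h
    rw [mul_assoc]
    gcongr
    refine h.trans (le_of_eq ?_)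
    rw [Real.rpow_two]
    field_simp
    norm_num
  rw [integral_mul_const, hG] at this
  exact this.trans (le_of_eq (by ring))

lemma macdonaldZero_le_div_pow {x : ℝ} (hx : 0 < x) : macdonaldZero x ≤ 16 / x ^ 4 := by
  have hG : ∫ τ in Ioi (0 : ℝ), Real.exp (-τ) * τ ^ (1 : ℝ) = 1 := by
    have := Real.Gamma_eq_integral (s := 2) (by norm_num)
    rw [Real.Gamma_two] at this
    rw [show (2 : ℝ) - 1 = 1 by norm_num] at this
    exact this.symm
  have : macdonaldZero x ≤ ∫ τ in Ioi (0 : ℝ), Real.exp (-τ) * τ ^ (1 : ℝ) * (16 / x ^ 4) := by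
    refine setIntegral_mono_on (integrableOn_macdonaldZero hx)
      ((integrableOn_exp_neg_mul_rpow (by norm_num)).mul_const _) measurableSet_Ioi fun τ hτ => ?_
    have hτ0 : 0 < τ := hτ
    have h := exp_neg_div_div_sq_le (show 0 < x ^ 2 / 4 by positivity) hτ0
    rw [mul_assoc, mul_div_assoc]
    gcongr
    rw [Real.rpow_one]
    calc Real.exp (-(x ^ 2 / 4 / τ)) / τ / 2
        = Real.exp (-(x ^ 2 / 4 / τ)) / τ ^ 2 * (τ / 2) := by field_simp
      _ ≤ 2 / (x ^ 2 / 4) ^ 2 * (τ / 2) := by gcongr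
      _ = τ * (16 / x ^ 4) := by field_simp; norm_num
  rw [integral_mul_const, hG] at this
  exact this.trans (le_of_eq (by ring))

/-- A crude bound near 0, sufficient because K₀(au) is always accompanied by a factor at least as
small as u. -/
lemma exists_macdonaldZero_le_div : ∃ C : ℝ, 0 < C ∧ ∀ x, 0 < x → macdonaldZero x ≤ C / x := by
  set G := ∫ τ in Ioi (0 : ℝ), Real.exp (-τ) * τ ^ (-(1 / 2) : ℝ)
  have hG0 : 0 ≤ G := setIntegral_nonneg measurableSet_Ioi fun τ hτ => by
    have : (0 : ℝ) < τ := hτ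
    positivity
  refine ⟨G + 1, by positivity, fun x hx => ?_⟩
  have : macdonaldZero x ≤ ∫ τ in Ioi (0 : ℝ), Real.exp (-τ) * τ ^ (-(1 / 2) : ℝ) * (1 / x) := by
    refine setIntegral_mono_on (integrableOn_macdonaldZero hx)
      ((integrableOn_exp_neg_mul_rpow (by norm_num)).mul_const _) measurableSet_Ioi fun τ hτ => ?_
    have hτ0 : 0 < τ := hτ
    have hsq : 0 < √τ := Real.sqrt_pos.2 hτ0
    have h1 : x / (2 * √τ) ≤ Real.exp (x ^ 2 / 4 / τ) := by
      have h2 : x ^ 2 / 4 / τ = (x / (2 * √τ)) ^ 2 := by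
        rw [div_pow, mul_pow, Real.sq_sqrt hτ0.le]; field_simp; norm_num
      rw [h2]
      have := Real.add_one_le_exp ((x / (2 * √τ)) ^ 2)
      nlinarith [sq_nonneg (x / (2 * √τ) - 1 / 2)]
    rw [mul_assoc, mul_div_assoc]
    gcongr
    rw [Real.rpow_neg hτ0.le, ← Real.sqrt_eq_rpow, Real.exp_neg]
    rw [div_le_iff₀ (by positivity)] at h1
    have hτs : τ = √τ ^ 2 := (Real.sq_sqrt hτ0.le).symm
    have he := Real.exp_pos (x ^ 2 / 4 / τ)
    set E := Real.exp (x ^ 2 / 4 / τ)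
    have e1 : E⁻¹ / τ / 2 = 1 / (E * (2 * √τ) * √τ) := by
      nth_rewrite 1 [hτs]
      field_simp
    have e2 : (√τ)⁻¹ * (1 / x) = 1 / (x * √τ) := by field_simp
    rw [e1, e2]
    gcongr
  rw [integral_mul_const] at this
  refine this.trans ?_
  rw [mul_one_div]
  gcongr
  linarith

/-- Integrating first in v gives a Gaussian moment, then in τ a Gamma integral. The case r = 1 gives
∫ x K₁ = π/2; r = 2ν fixes the normalisation of S at large a. -/
lemma integrable_prod_xMacdonaldOne_moment {r : ℝ} (hr : 0 < r) :
    Integrable (Function.uncurry fun v τ : ℝ =>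
      v ^ (r - 1) * (Real.exp (-τ) * Real.exp (-(v ^ 2 / 4 / τ))))
      ((volume.restrict (Ioi 0)).prod (volume.restrict (Ioi 0))) ∧
    ∫ τ in Ioi (0 : ℝ), ∫ v in Ioi (0 : ℝ),
      v ^ (r - 1) * (Real.exp (-τ) * Real.exp (-(v ^ 2 / 4 / τ))) =
      2 ^ (r - 1) * Real.Gamma (r / 2) * Real.Gamma (r / 2 + 1) := by
  have hinner : ∀ τ : ℝ, 0 < τ → ∫ v in Ioi (0 : ℝ),
      v ^ (r - 1) * (Real.exp (-τ) * Real.exp (-(v ^ 2 / 4 / τ))) =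
      Real.exp (-τ) * τ ^ (r / 2) * (2 ^ (r - 1) * Real.Gamma (r / 2)) := by
    intro τ hτ
    have h := integral_rpow_mul_exp_neg_mul_rpow (p := 2) (q := r - 1) (b := 1 / (4 * τ)) two_pos
      (by linarith) (by positivity)
    have e : ∀ v : ℝ, v ^ (r - 1) * (Real.exp (-τ) * Real.exp (-(v ^ 2 / 4 / τ))) =
        Real.exp (-τ) * (v ^ (r - 1) * Real.exp (-(1 / (4 * τ)) * v ^ (2 : ℝ))) := by
      intro v
      rw [Real.rpow_two, show -(1 / (4 * τ)) * v ^ 2 = -(v ^ 2 / 4 / τ) by field_simp]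
      ring
    simp only [e]
    rw [integral_const_mul, h, sub_add_cancel, mul_assoc (Real.exp (-τ))]
    congr 1
    have e2 : (1 / (4 * τ)) ^ (-r / 2) = 2 ^ r * τ ^ (r / 2) := by
      rw [one_div, Real.inv_rpow (by positivity), ← Real.rpow_neg (by positivity),
        show -(-r / 2) = r / 2 by ring, Real.mul_rpow (by norm_num) hτ.le,
        show (4 : ℝ) = 2 ^ (2 : ℝ) by norm_num, ← Real.rpow_mul (by norm_num)]
      congr 2
      ring
    rw [e2, Real.rpow_sub_one two_ne_zero]
    ring
  have hmeas : AEStronglyMeasurable (Function.uncurry fun v τ : ℝ =>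
      v ^ (r - 1) * (Real.exp (-τ) * Real.exp (-(v ^ 2 / 4 / τ))))
      ((volume.restrict (Ioi 0)).prod (volume.restrict (Ioi 0))) := by
    refine Measurable.aestronglyMeasurable ?_
    unfold Function.uncurry
    fun_prop
  refine ⟨(integrable_prod_iff' hmeas).2 ⟨?_, ?_⟩, ?_⟩
  · refine (ae_restrict_iff' measurableSet_Ioi).2 (.of_forall fun τ hτ => ?_)
    have hτ0 : 0 < τ := hτ
    have h := integrableOn_rpow_mul_exp_neg_mul_rpow (p := 2) (s := r - 1) (b := 1 / (4 * τ))
      (by linarith) (by norm_num) (by positivity)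
    refine IntegrableOn.congr_fun (h.const_mul (Real.exp (-τ))) (fun v hv => ?_) measurableSet_Ioi
    simp only [Function.uncurry]
    rw [Real.rpow_two, show -(1 / (4 * τ)) * v ^ 2 = -(v ^ 2 / 4 / τ) by field_simp]
    ring
  · refine IntegrableOn.congr_fun ((integrableOn_exp_neg_mul_rpow (r := r / 2)
      (by linarith)).mul_const (2 ^ (r - 1) * Real.Gamma (r / 2))) (fun τ hτ => ?_) measurableSet_Ioi
    rw [← hinner τ hτ]
    refine setIntegral_congr_fun measurableSet_Ioi fun v hv => ?_
    have hv0 : (0 : ℝ) < v := hv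
    simp only [Function.uncurry]
    rw [Real.norm_of_nonneg (by positivity)]
  · rw [setIntegral_congr_fun measurableSet_Ioi fun τ hτ => hinner τ hτ, integral_mul_const,
      Real.Gamma_eq_integral (show 0 < r / 2 + 1 by positivity)]
    simp only [add_sub_cancel_right]
    ring

lemma integrableOn_rpow_mul_xMacdonaldOne {r : ℝ} (hr : 0 < r) :
    IntegrableOn (fun v => v ^ (r - 1) * xMacdonaldOne v) (Ioi 0) := by
  refine (integrable_prod_xMacdonaldOne_moment hr).1.integral_prod_left.congr
    (.of_forall fun v => ?_)
  simp only [Function.uncurry]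
  rw [integral_const_mul, xMacdonaldOne]

lemma integral_rpow_mul_xMacdonaldOne {r : ℝ} (hr : 0 < r) :
    ∫ v in Ioi (0 : ℝ), v ^ (r - 1) * xMacdonaldOne v =
      2 ^ (r - 1) * Real.Gamma (r / 2) * Real.Gamma (r / 2 + 1) := by
  rw [← (integrable_prod_xMacdonaldOne_moment hr).2,
    ← integral_integral_swap (integrable_prod_xMacdonaldOne_moment hr).1]
  simp only [integral_const_mul, xMacdonaldOne]

lemma integrableOn_xMacdonaldOne_Ioi : IntegrableOn xMacdonaldOne (Ioi 0) := by
  simpa using integrableOn_rpow_mul_xMacdonaldOne one_pos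

lemma integral_xMacdonaldOne : ∫ v in Ioi (0 : ℝ), xMacdonaldOne v = Real.pi / 2 := by
  have := integral_rpow_mul_xMacdonaldOne one_pos
  rw [Real.Gamma_add_one (by norm_num), Real.Gamma_one_half_eq] at this
  simp only [sub_self, Real.rpow_zero, one_mul] at this
  rw [this]
  have := Real.mul_self_sqrt Real.pi_pos.le
  linear_combination (1 / 2) * this

/-! ### Transforms of J_ν² against Macdonald functions, for ν > 0 -/

lemma exists_besselJ_bounds (ν : ℝ) (hν : 0 < ν) : ∃ C : ℝ, 0 < C ∧ ∀ u, 0 < u →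
    besselJ ν u ^ 2 ≤ C * u ^ (2 * ν) ∧ besselJ ν u ^ 2 ≤ C ∧ u * besselJ ν u ^ 2 ≤ C ∧
      |besselW ν u| ≤ C ∧ (u ≤ 1 → |besselW ν u| ≤ C * u) := by
  obtain ⟨A, hA, hA'⟩ := exists_abs_besselJ_le_rpow ν (by linarith) 1
  obtain ⟨B, hB, hB'⟩ := exists_abs_besselJ_le_rpow (ν + 1) (by linarith) 1
  obtain ⟨K, hK, hK'⟩ := exists_besselY_le ν (by linarith)
  have hAB : 0 < A ^ 2 + A * B := by positivity
  refine ⟨A ^ 2 + A * B + K, by positivity, fun u hu => ?_⟩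
  rcases le_total u 1 with h1 | h1
  · have hJ : |besselJ ν u| ≤ A := (hA' u hu h1).trans
      (mul_le_of_le_one_right hA.le (Real.rpow_le_one hu.le h1 hν.le))
    have hJ1 : |besselJ (ν + 1) u| ≤ B := (hB' u hu h1).trans
      (mul_le_of_le_one_right hB.le (Real.rpow_le_one hu.le h1 (by linarith)))
    have e : u ^ (2 * ν) = (u ^ ν) ^ 2 := by
      rw [mul_comm, Real.rpow_mul hu.le]; norm_num
    have hsq : besselJ ν u ^ 2 ≤ A ^ 2 := by rw [← sq_abs]; gcongr
    have hAu : A ^ 2 ≤ A ^ 2 + A * B + K := by nlinarith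
    have hW : |besselW ν u| ≤ (A ^ 2 + A * B + K) * u := by
      rw [besselW, abs_mul, abs_mul, abs_of_pos hu, mul_comm]
      have : |besselJ ν u| * |besselJ (ν + 1) u| ≤ A * B := by gcongr
      gcongr
      nlinarith [sq_nonneg A]
    refine ⟨?_, hsq.trans hAu, ?_, hW.trans (mul_le_of_le_one_right (by positivity) h1), fun _ => hW⟩
    · have : besselJ ν u ^ 2 ≤ (A * u ^ ν) ^ 2 := by
        rw [← sq_abs]; gcongr; exact hA' u hu h1
      rw [e]
      rw [mul_pow] at this
      exact this.trans (by gcongr)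
    · exact (mul_le_of_le_one_left (sq_nonneg _) h1).trans (hsq.trans hAu)
  · have hY := hK' u h1
    have huy : u * besselJ ν u ^ 2 ≤ K := by
      refine le_trans ?_ hY
      rw [besselY]
      gcongr
      nlinarith [sq_nonneg (besselJ (ν + 1) u)]
    have hy : besselJ ν u ^ 2 ≤ K := (le_mul_of_one_le_left (sq_nonneg _) h1).trans huy
    have hu1 : 1 ≤ u ^ (2 * ν) := Real.one_le_rpow h1 (by positivity)
    have hW : |besselW ν u| ≤ A ^ 2 + A * B + K := by
      linarith [abs_besselW_le ν hu]
    refine ⟨?_, by linarith, by linarith, hW, fun h2 => ?_⟩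
    · nlinarith
    · rwa [le_antisymm h2 h1, mul_one, ← le_antisymm h2 h1]

lemma exists_besselN_le_const (ν : ℝ) (hν : 0 < ν) :
    ∃ C : ℝ, 0 < C ∧ ∀ s, 0 < s → besselN ν s ≤ C := by
  obtain ⟨A, hA, hA'⟩ := exists_besselN_le ν (by linarith) 1
  obtain ⟨c, P, C, hC, hb, -⟩ := exists_besselN_asymptotics ν (by linarith)
  refine ⟨A + (|c| + C), by positivity, fun s hs => ?_⟩
  rcases le_total s 1 with h1 | h1
  · have h2 := (le_abs_self _).trans (hA' s hs h1)
    have h3 : A * s ^ (2 * ν + 1) ≤ A :=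
      mul_le_of_le_one_right hA.le (Real.rpow_le_one hs.le h1 (by linarith))
    have := abs_nonneg c
    linarith
  · have h2 := (le_abs_self _).trans (hb s h1)
    have h3 : C / s ≤ C := div_le_self hC.le h1
    linarith [le_abs_self c]

lemma integrableOn_Ioi_of_le_const_of_le_div_pow {g : ℝ → ℝ} {A B : ℝ} (hg : ContinuousOn g (Ioi 0))
    (h0 : ∀ u, 0 < u → u ≤ 1 → |g u| ≤ A) (h1 : ∀ u > 1, |g u| ≤ B / u ^ 2) :
    IntegrableOn g (Ioi 0) := by
  rw [← Ioc_union_Ioi_eq_Ioi (zero_le_one' ℝ)]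
  refine IntegrableOn.union ?_ ?_
  · refine Integrable.mono' (integrableOn_const (C := A) (by simp))
      ((hg.mono Ioc_subset_Ioi_self).aestronglyMeasurable measurableSet_Ioc) ?_
    exact (ae_restrict_iff' measurableSet_Ioc).2 (.of_forall fun u hu => h0 u hu.1 hu.2)
  · refine Integrable.mono' ((integrableOn_Ioi_rpow_of_lt (by norm_num : (-2 : ℝ) < -1)
      one_pos).const_mul B) ((hg.mono (Ioi_subset_Ioi zero_le_one)).aestronglyMeasurable
      measurableSet_Ioi) ?_
    refine (ae_restrict_iff' measurableSet_Ioi).2 (.of_forall fun u hu => ?_)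
    have hu0 : (0 : ℝ) < u := zero_lt_one.trans hu
    rw [Real.rpow_neg hu0.le, ← div_eq_mul_inv]
    exact_mod_cast h1 u hu

lemma continuousOn_macdonaldZero_mul {a : ℝ} (ha : 0 < a) :
    ContinuousOn (fun u => macdonaldZero (a * u)) (Ioi 0) := fun _ hu =>
  ((hasDerivAt_macdonaldZero (mul_pos ha hu)).continuousAt.comp
    (continuous_const_mul a).continuousAt).continuousWithinAt

/-- `∫ u K₀(au) J_ν(u)² du`. -/
def besselT (ν a : ℝ) : ℝ := ∫ u in Ioi (0 : ℝ), u * besselJ ν u ^ 2 * macdonaldZero (a * u)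
/-- `∫ (au) K₁(au) J_ν(u)² du / u`. -/
def besselS (ν a : ℝ) : ℝ := ∫ u in Ioi (0 : ℝ), besselJ ν u ^ 2 / u * xMacdonaldOne (a * u)
/-- `∫ (au) K₁(au) J_ν(u)² u du`. -/
def besselV (ν a : ℝ) : ℝ := ∫ u in Ioi (0 : ℝ), u * besselJ ν u ^ 2 * xMacdonaldOne (a * u)

lemma integrableOn_besselT {ν a : ℝ} (hν : 0 < ν) (ha : 0 < a) :
    IntegrableOn (fun u => u * besselJ ν u ^ 2 * macdonaldZero (a * u)) (Ioi 0) := by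
  obtain ⟨C, hC, hC'⟩ := exists_besselJ_bounds ν hν
  obtain ⟨D, hD, hD'⟩ := exists_macdonaldZero_le_div
  refine integrableOn_Ioi_of_le_const_of_le_div_pow (A := C * D / a) (B := C * (16 / a ^ 4))
    ((continuousOn_mul_besselJ_sq ν (by linarith)).mul (continuousOn_macdonaldZero_mul ha))
    (fun u hu _ => ?_) (fun u hu => ?_)
  · have hK := macdonaldZero_nonneg (a * u)
    obtain ⟨-, h2, -⟩ := hC' u hu
    rw [abs_of_nonneg (by positivity)]
    calc u * besselJ ν u ^ 2 * macdonaldZero (a * u) ≤ u * C * (D / (a * u)) := by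
          gcongr
          exact hD' _ (by positivity)
      _ = C * D / a := by field_simp
  · have hu0 : 0 < u := by linarith
    have hK := macdonaldZero_nonneg (a * u)
    obtain ⟨-, -, h3, -⟩ := hC' u hu0
    rw [abs_of_nonneg (by positivity)]
    calc u * besselJ ν u ^ 2 * macdonaldZero (a * u) ≤ C * (16 / (a * u) ^ 4) := by
          gcongr
          exact macdonaldZero_le_div_pow (by positivity)
      _ = C * (16 / a ^ 4) / u ^ 4 := by field_simp
      _ ≤ C * (16 / a ^ 4) / u ^ 2 := by
          gcongr
          · exact hu.le
          · norm_num

lemma integrableOn_xMacdonaldOne_mul {a : ℝ} (ha : 0 < a) :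
    IntegrableOn (fun u => xMacdonaldOne (a * u)) (Ioi 0) := by
  rw [integrableOn_Ioi_comp_mul_left_iff _ _ ha, mul_zero]
  exact integrableOn_xMacdonaldOne_Ioi

lemma continuous_xMacdonaldOne_mul (a : ℝ) : Continuous fun u => xMacdonaldOne (a * u) :=
  continuous_xMacdonaldOne.comp (continuous_const_mul a)

lemma integrableOn_besselV {ν a : ℝ} (hν : 0 < ν) (ha : 0 < a) :
    IntegrableOn (fun u => u * besselJ ν u ^ 2 * xMacdonaldOne (a * u)) (Ioi 0) := by
  obtain ⟨C, hC, hC'⟩ := exists_besselJ_bounds ν hν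
  refine Integrable.mono' ((integrableOn_xMacdonaldOne_mul ha).const_mul C)
    (((continuousOn_mul_besselJ_sq ν (by linarith)).mul
      (continuous_xMacdonaldOne_mul a).continuousOn).aestronglyMeasurable measurableSet_Ioi) ?_
  refine (ae_restrict_iff' measurableSet_Ioi).2 (.of_forall fun u hu => ?_)
  have hu0 : (0 : ℝ) < u := hu
  have hK := xMacdonaldOne_nonneg (a * u)
  rw [Real.norm_of_nonneg (by positivity)]
  gcongr
  exact (hC' u hu0).2.2.1

lemma integrableOn_rpow_mul_xMacdonaldOne_mul {r a : ℝ} (hr : 0 < r) (ha : 0 < a) :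
    IntegrableOn (fun u => u ^ (r - 1) * xMacdonaldOne (a * u)) (Ioi 0) := by
  have h := integrableOn_rpow_mul_xMacdonaldOne hr
  rw [← mul_zero a, ← integrableOn_Ioi_comp_mul_left_iff _ _ ha] at h
  refine IntegrableOn.congr_fun (h.const_mul (a ^ (r - 1))⁻¹) (fun u hu => ?_) measurableSet_Ioi
  have hu0 : (0 : ℝ) < u := hu
  have : a ^ (r - 1) ≠ 0 := by positivity
  rw [Real.mul_rpow ha.le hu0.le]
  field_simp

lemma continuousOn_besselS_integrand {ν : ℝ} (hν : 0 < ν) (a : ℝ) :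
    ContinuousOn (fun u => besselJ ν u ^ 2 / u * xMacdonaldOne (a * u)) (Ioi 0) :=
  (((continuousOn_besselJ ν (by linarith)).pow 2).div continuousOn_id
    fun _ hu => (mem_Ioi.1 hu).ne').mul (continuous_xMacdonaldOne_mul a).continuousOn

lemma integrableOn_besselS {ν a : ℝ} (hν : 0 < ν) (ha : 0 < a) :
    IntegrableOn (fun u => besselJ ν u ^ 2 / u * xMacdonaldOne (a * u)) (Ioi 0) := by
  obtain ⟨C, hC, hC'⟩ := exists_besselJ_bounds ν hν
  refine Integrable.mono' ((integrableOn_rpow_mul_xMacdonaldOne_mul (r := 2 * ν)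
    (by positivity) ha).const_mul C)
    ((continuousOn_besselS_integrand hν a).aestronglyMeasurable measurableSet_Ioi) ?_
  refine (ae_restrict_iff' measurableSet_Ioi).2 (.of_forall fun u hu => ?_)
  have hu0 : (0 : ℝ) < u := hu
  have hK := xMacdonaldOne_nonneg (a * u)
  rw [Real.norm_of_nonneg (by positivity), Real.rpow_sub_one hu0.ne', ← mul_assoc, ← mul_div_assoc]
  gcongr
  exact (hC' u hu0).1

lemma hasDerivAt_macdonaldZero_mul {a u : ℝ} (ha : 0 < a) (hu : 0 < u) :
    HasDerivAt (fun u => macdonaldZero (a * u)) (-(xMacdonaldOne (a * u) / u)) u := by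
  refine ((hasDerivAt_macdonaldZero (mul_pos ha hu)).comp u
    ((hasDerivAt_id u).const_mul a)).congr_deriv ?_
  field_simp

lemma hasDerivAt_xMacdonaldOne_mul {a u : ℝ} (ha : 0 < a) (hu : 0 < u) :
    HasDerivAt (fun u => xMacdonaldOne (a * u)) (-(a ^ 2 * u * macdonaldZero (a * u))) u := by
  refine ((hasDerivAt_xMacdonaldOne (mul_pos ha hu)).comp u
    ((hasDerivAt_id u).const_mul a)).congr_deriv ?_
  ring

lemma hasDerivAt_macdonaldZero_mul_left {a u : ℝ} (ha : 0 < a) (hu : 0 < u) :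
    HasDerivAt (fun a => macdonaldZero (a * u)) (-(xMacdonaldOne (a * u) / a)) a := by
  refine ((hasDerivAt_macdonaldZero (mul_pos ha hu)).comp a
    ((hasDerivAt_id a).mul_const u)).congr_deriv ?_
  field_simp

lemma hasDerivAt_xMacdonaldOne_mul_left {a u : ℝ} (ha : 0 < a) (hu : 0 < u) :
    HasDerivAt (fun a => xMacdonaldOne (a * u)) (-(a * u ^ 2 * macdonaldZero (a * u))) a := by
  refine ((hasDerivAt_xMacdonaldOne (mul_pos ha hu)).comp a
    ((hasDerivAt_id a).mul_const u)).congr_deriv ?_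
  ring

lemma hasDerivAt_besselT {ν a : ℝ} (hν : 0 < ν) (ha : 0 < a) :
    HasDerivAt (besselT ν) (-(besselV ν a / a)) a := by
  have hs : Ioo (a / 2) (2 * a) ∈ 𝓝 a := Ioo_mem_nhds (by linarith) (by linarith)
  have hpos : ∀ b ∈ Ioo (a / 2) (2 * a), 0 < b := fun b hb => by linarith [hb.1]
  have hmeas : AEStronglyMeasurable (fun u => u * besselJ ν u ^ 2 * -(xMacdonaldOne (a * u) / a))
      (volume.restrict (Ioi 0)) :=
    (((continuousOn_mul_besselJ_sq ν (by linarith)).mul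
      ((continuous_xMacdonaldOne_mul a).div_const a).neg.continuousOn)).aestronglyMeasurable
      measurableSet_Ioi
  have key := (hasDerivAt_integral_of_dominated_loc_of_deriv_le (μ := volume.restrict (Ioi 0))
    (F := fun a u => u * besselJ ν u ^ 2 * macdonaldZero (a * u))
    (F' := fun a u => u * besselJ ν u ^ 2 * -(xMacdonaldOne (a * u) / a))
    -- x K₁ decreases, so its value at (a/2)u dominates those for all parameters in (a/2, 2a).
    (x₀ := a) (bound := fun u => u * besselJ ν u ^ 2 * xMacdonaldOne (a / 2 * u) * (2 / a)) hs
    ?_ (integrableOn_besselT hν ha) hmeas ?_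
    ((integrableOn_besselV hν (by positivity)).mul_const _) ?_).2
  · refine key.congr_deriv ?_
    rw [besselV, ← integral_div, ← integral_neg]
    refine integral_congr_ae (.of_forall fun u => ?_)
    simp only
    ring
  · filter_upwards [hs] with b hb
    exact (integrableOn_besselT hν (hpos b hb)).aestronglyMeasurable
  · refine (ae_restrict_iff' measurableSet_Ioi).2 (.of_forall fun u hu b hb => ?_)
    have hu0 : (0 : ℝ) < u := hu
    have hb0 := hpos b hb
    have hK := xMacdonaldOne_nonneg (b * u)
    rw [norm_mul, norm_neg, Real.norm_of_nonneg (by positivity), Real.norm_of_nonneg (by positivity),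
      mul_assoc _ _ (2 / a)]
    have h1 : xMacdonaldOne (b * u) ≤ xMacdonaldOne (a / 2 * u) :=
      xMacdonaldOne_antitoneOn (mem_Ici.2 (by positivity)) (mem_Ici.2 (by positivity))
        (by have := hb.1; gcongr)
    have h2 : 1 / b ≤ 2 / a := by
      rw [div_le_div_iff₀ hb0 ha]; linarith [hb.1]
    rw [div_eq_mul_one_div]
    gcongr
    exact hK.trans h1
  · refine (ae_restrict_iff' measurableSet_Ioi).2 (.of_forall fun u hu b hb => ?_)
    exact (hasDerivAt_macdonaldZero_mul_left (hpos b hb) hu).const_mul _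

lemma hasDerivAt_besselS {ν a : ℝ} (hν : 0 < ν) (ha : 0 < a) :
    HasDerivAt (besselS ν) (-(a * besselT ν a)) a := by
  have hs : Ioo (a / 2) (2 * a) ∈ 𝓝 a := Ioo_mem_nhds (by linarith) (by linarith)
  have hpos : ∀ b ∈ Ioo (a / 2) (2 * a), 0 < b := fun b hb => by linarith [hb.1]
  have e : ∀ b u : ℝ, 0 < u → besselJ ν u ^ 2 / u * -(b * u ^ 2 * macdonaldZero (b * u)) =
      -(b * (u * besselJ ν u ^ 2 * macdonaldZero (b * u))) := by
    intro b u hu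
    field_simp
  have hmeas : AEStronglyMeasurable
      (fun u => besselJ ν u ^ 2 / u * -(a * u ^ 2 * macdonaldZero (a * u)))
      (volume.restrict (Ioi 0)) := by
    refine (IntegrableOn.congr_fun ((integrableOn_besselT hν ha).const_mul a).neg (fun u hu => ?_)
      measurableSet_Ioi).aestronglyMeasurable
    exact (e a u hu).symm
  have key := (hasDerivAt_integral_of_dominated_loc_of_deriv_le (μ := volume.restrict (Ioi 0))
    (F := fun a u => besselJ ν u ^ 2 / u * xMacdonaldOne (a * u))
    (F' := fun a u => besselJ ν u ^ 2 / u * -(a * u ^ 2 * macdonaldZero (a * u)))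
    (x₀ := a) (bound := fun u => 2 * a * (u * besselJ ν u ^ 2 * macdonaldZero (a / 2 * u))) hs
    ?_ (integrableOn_besselS hν ha) hmeas ?_
    ((integrableOn_besselT hν (by positivity)).const_mul _) ?_).2
  · refine key.congr_deriv ?_
    rw [besselT, ← integral_const_mul, ← integral_neg]
    exact setIntegral_congr_fun measurableSet_Ioi fun u hu => e a u hu
  · filter_upwards [hs] with b hb
    exact (integrableOn_besselS hν (hpos b hb)).aestronglyMeasurable
  · refine (ae_restrict_iff' measurableSet_Ioi).2 (.of_forall fun u hu b hb => ?_)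
    have hu0 : (0 : ℝ) < u := hu
    have hb0 := hpos b hb
    have hK := macdonaldZero_nonneg (b * u)
    rw [e b u hu0, norm_neg, Real.norm_of_nonneg (by positivity)]
    have h1 : macdonaldZero (b * u) ≤ macdonaldZero (a / 2 * u) :=
      macdonaldZero_antitoneOn (mem_Ioi.2 (by positivity)) (mem_Ioi.2 (by positivity))
        (by have := hb.1; gcongr)
    have := hb.2
    gcongr
  · refine (ae_restrict_iff' measurableSet_Ioi).2 (.of_forall fun u hu b hb => ?_)
    exact (hasDerivAt_xMacdonaldOne_mul_left (hpos b hb) hu).const_mul _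

lemma tendsto_const_mul_rpow_nhdsGT_zero (C : ℝ) {r : ℝ} (hr : 0 < r) :
    Tendsto (fun u : ℝ => C * u ^ r) (𝓝[>] 0) (𝓝 0) := by
  have := ((Real.continuousAt_rpow_const 0 r (Or.inr hr.le)).tendsto.const_mul C)
  rw [Real.zero_rpow hr.ne', mul_zero] at this
  exact this.mono_left nhdsWithin_le_nhds

lemma tendsto_const_mul_nhdsGT_zero (C : ℝ) : Tendsto (fun u : ℝ => C * u) (𝓝[>] 0) (𝓝 0) := by
  simpa using tendsto_const_mul_rpow_nhdsGT_zero C one_pos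

lemma tendsto_const_div_pow_atTop (C : ℝ) {n : ℕ} (hn : n ≠ 0) :
    Tendsto (fun u : ℝ => C / u ^ n) atTop (𝓝 0) :=
  (tendsto_pow_atTop hn).const_div_atTop C

lemma besselL_le {ν C s : ℝ} (hs : 0 < s) (h : besselN ν s ≤ C) : besselL ν s ≤ C * s := by
  rwa [besselN, div_le_iff₀ hs] at h

lemma tendsto_macdonaldZero_mul_besselL_zero {ν a : ℝ} (hν : 0 < ν) (ha : 0 < a) :
    Tendsto (fun u => macdonaldZero (a * u) * besselL ν u) (𝓝[>] 0) (𝓝 0) := by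
  obtain ⟨C, hC, hC'⟩ := exists_abs_besselL_le ν (by linarith) 1
  obtain ⟨D, hD, hD'⟩ := exists_macdonaldZero_le_div
  refine squeeze_zero_norm' (a := fun u => D / a * C * u ^ (2 * ν + 1)) ?_
    (tendsto_const_mul_rpow_nhdsGT_zero _ (by linarith))
  filter_upwards [Ioc_mem_nhdsGT (zero_lt_one' ℝ)] with u hu
  have hu0 : 0 < u := hu.1
  have hK := macdonaldZero_nonneg (a * u)
  rw [norm_mul, Real.norm_of_nonneg hK, Real.norm_eq_abs]
  calc macdonaldZero (a * u) * |besselL ν u| ≤ D / (a * u) * (C * u ^ (2 * ν + 2)) := by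
        gcongr
        · exact hD' _ (by positivity)
        · exact hC' u hu.1 hu.2
    _ = D / a * C * u ^ (2 * ν + 1) := by
        rw [show 2 * ν + 2 = 2 * ν + 1 + 1 by ring, Real.rpow_add_one hu0.ne']
        field_simp

lemma tendsto_macdonaldZero_mul_besselL_atTop {ν a : ℝ} (hν : 0 < ν) (ha : 0 < a) :
    Tendsto (fun u => macdonaldZero (a * u) * besselL ν u) atTop (𝓝 0) := by
  obtain ⟨C, hC, hC'⟩ := exists_besselN_le_const ν hν
  refine squeeze_zero_norm' (a := fun u => 16 / a ^ 4 * C / u ^ 3) ?_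
    (tendsto_const_div_pow_atTop _ (by norm_num))
  filter_upwards [eventually_gt_atTop 0] with u hu
  have hK := macdonaldZero_nonneg (a * u)
  have hL := besselL_nonneg ν (by linarith) hu
  rw [Real.norm_of_nonneg (by positivity)]
  calc macdonaldZero (a * u) * besselL ν u ≤ 16 / (a * u) ^ 4 * (C * u) := by
        gcongr
        · exact macdonaldZero_le_div_pow (by positivity)
        · exact besselL_le hu (hC' u hu)
    _ = _ := by field_simp

/-- `∫ (as) K₁(as) N(s) ds = ∫ u K₀(au) J_ν(u)² du`. -/
lemma integral_xMacdonaldOne_mul_besselN {ν a : ℝ} (hν : 0 < ν) (ha : 0 < a) :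
    IntegrableOn (fun s => xMacdonaldOne (a * s) * besselN ν s) (Ioi 0) ∧
    ∫ s in Ioi (0 : ℝ), xMacdonaldOne (a * s) * besselN ν s = besselT ν a := by
  have hν' : -1 < ν := by linarith
  obtain ⟨C, hC, hC'⟩ := exists_besselN_le_const ν hν
  have hi : IntegrableOn (fun s => xMacdonaldOne (a * s) * besselN ν s) (Ioi 0) := by
    refine Integrable.mul_bdd (c := C) (integrableOn_xMacdonaldOne_mul ha)
      ((continuousOn_besselN ν hν').aestronglyMeasurable measurableSet_Ioi) ?_
    refine (ae_restrict_iff' measurableSet_Ioi).2 (.of_forall fun s hs => ?_)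
    rw [Real.norm_of_nonneg (besselN_nonneg ν hν' hs)]
    exact hC' s hs
  refine ⟨hi, ?_⟩
  -- K₀(au)L(u) vanishes at both ends, and its derivative is the difference of the two integrands
  -- because L' = uJ_ν² and (K₀(au))' = -K₁(au)a.
  have hd : ∀ s ∈ Ioi (0 : ℝ), HasDerivAt (fun u => macdonaldZero (a * u) * besselL ν u)
      (s * besselJ ν s ^ 2 * macdonaldZero (a * s) - xMacdonaldOne (a * s) * besselN ν s) s := by
    intro s hs
    refine ((hasDerivAt_macdonaldZero_mul ha hs).mul (hasDerivAt_besselL ν hν' hs)).congr_deriv ?_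
    rw [besselN]
    ring
  have h := integral_Ioi_of_hasDerivAt_of_tendsto_nhdsGT hd ((integrableOn_besselT hν ha).sub hi)
    (tendsto_macdonaldZero_mul_besselL_zero hν ha) (tendsto_macdonaldZero_mul_besselL_atTop hν ha)
  rw [integral_sub (integrableOn_besselT hν ha) hi, sub_zero, sub_eq_zero] at h
  exact h.symm

/-- The function with derivative `(2a²+4) u K₀ J² - (a²+4) u κ J² + 4ν² κ J²/u`. -/
def besselConcomitant (ν a u : ℝ) : ℝ :=
  4 * (macdonaldZero (a * u) * besselL ν u) +
    2 * (ν * besselJ ν u ^ 2 - besselW ν u) * xMacdonaldOne (a * u) +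
    a ^ 2 * u ^ 2 * macdonaldZero (a * u) * besselJ ν u ^ 2

lemma hasDerivAt_besselConcomitant {ν a u : ℝ} (hν : -1 < ν) (ha : 0 < a) (hu : 0 < u) :
    HasDerivAt (besselConcomitant ν a)
      ((2 * a ^ 2 + 4) * (u * besselJ ν u ^ 2 * macdonaldZero (a * u)) -
        (a ^ 2 + 4) * (u * besselJ ν u ^ 2 * xMacdonaldOne (a * u)) +
        4 * ν ^ 2 * (besselJ ν u ^ 2 / u * xMacdonaldOne (a * u))) u := by
  have h0 := hasDerivAt_besselJ ν hν hu
  have hK := hasDerivAt_macdonaldZero_mul ha hu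
  have hX := hasDerivAt_xMacdonaldOne_mul ha hu
  have hL := hasDerivAt_besselL ν hν hu
  have hW := hasDerivAt_besselW ν hν hu
  refine (((((hK.mul hL).const_mul 4)).add ((((((h0.pow 2).const_mul ν).sub hW).const_mul 2).mul
    hX))).add ((((hasDerivAt_pow 2 u).const_mul (a ^ 2)).mul hK).mul (h0.pow 2))).congr_deriv ?_
  simp only [besselL, besselR, besselW, Pi.mul_apply, Pi.sub_apply, Pi.pow_apply]
  field_simp
  ring

lemma tendsto_besselConcomitant_zero {ν a : ℝ} (hν : 0 < ν) (ha : 0 < a) :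
    Tendsto (besselConcomitant ν a) (𝓝[>] 0) (𝓝 0) := by
  obtain ⟨C, hC, hC'⟩ := exists_besselJ_bounds ν hν
  obtain ⟨D, hD, hD'⟩ := exists_macdonaldZero_le_div
  have t1 := (tendsto_macdonaldZero_mul_besselL_zero hν ha).const_mul 4
  have t2 : Tendsto (fun u => 2 * (ν * besselJ ν u ^ 2 - besselW ν u) * xMacdonaldOne (a * u))
      (𝓝[>] 0) (𝓝 0) := by
    refine squeeze_zero_norm' (a := fun u => 2 * ν * C * u ^ (2 * ν) + 2 * C * u) ?_
      (by simpa using (tendsto_const_mul_rpow_nhdsGT_zero (2 * ν * C) (by positivity)).add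
            (tendsto_const_mul_nhdsGT_zero (2 * C)))
    filter_upwards [Ioc_mem_nhdsGT (zero_lt_one' ℝ)] with u hu
    have hu0 : 0 < u := hu.1
    obtain ⟨h1, -, -, -, h2⟩ := hC' u hu.1
    have h2 := h2 hu.2
    have hX := xMacdonaldOne_nonneg (a * u)
    have hX1 := xMacdonaldOne_le_one (show 0 ≤ a * u by positivity)
    rw [norm_mul, norm_mul, Real.norm_two, Real.norm_of_nonneg hX, Real.norm_eq_abs]
    have h3 : |ν * besselJ ν u ^ 2 - besselW ν u| ≤ ν * (C * u ^ (2 * ν)) + C * u := by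
      refine (abs_sub _ _).trans ?_
      rw [abs_of_nonneg (by positivity)]
      gcongr
    refine (mul_le_of_le_one_right (by positivity) hX1).trans ?_
    linarith
  have t3 : Tendsto (fun u => a ^ 2 * u ^ 2 * macdonaldZero (a * u) * besselJ ν u ^ 2)
      (𝓝[>] 0) (𝓝 0) := by
    refine squeeze_zero_norm' (a := fun u => a * D * C * u) ?_ (tendsto_const_mul_nhdsGT_zero _)
    filter_upwards [self_mem_nhdsWithin] with u hu
    have hu0 : 0 < u := hu
    have hK := macdonaldZero_nonneg (a * u)
    rw [Real.norm_of_nonneg (by positivity)]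
    calc a ^ 2 * u ^ 2 * macdonaldZero (a * u) * besselJ ν u ^ 2
        ≤ a ^ 2 * u ^ 2 * (D / (a * u)) * C := by
          gcongr
          · exact hD' _ (by positivity)
          · exact (hC' u hu0).2.1
      _ = _ := by field_simp
  simpa [besselConcomitant] using! (t1.add t2).add t3

lemma tendsto_besselConcomitant_atTop {ν a : ℝ} (hν : 0 < ν) (ha : 0 < a) :
    Tendsto (besselConcomitant ν a) atTop (𝓝 0) := by
  obtain ⟨C, hC, hC'⟩ := exists_besselJ_bounds ν hν
  have t1 := (tendsto_macdonaldZero_mul_besselL_atTop hν ha).const_mul 4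
  have t2 : Tendsto (fun u => 2 * (ν * besselJ ν u ^ 2 - besselW ν u) * xMacdonaldOne (a * u))
      atTop (𝓝 0) := by
    refine squeeze_zero_norm' (a := fun u => 2 * (ν * C + C) * (64 / a ^ 4) / u ^ 4) ?_
      (tendsto_const_div_pow_atTop _ (by norm_num))
    filter_upwards [eventually_gt_atTop 0] with u hu
    obtain ⟨-, h1, -, h2, -⟩ := hC' u hu
    have hX := xMacdonaldOne_nonneg (a * u)
    have hX1 := xMacdonaldOne_le_div_pow (show 0 < a * u by positivity)
    rw [norm_mul, norm_mul, Real.norm_two, Real.norm_of_nonneg hX, Real.norm_eq_abs]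
    have h3 : |ν * besselJ ν u ^ 2 - besselW ν u| ≤ ν * C + C := by
      refine (abs_sub _ _).trans ?_
      rw [abs_of_nonneg (by positivity)]
      gcongr
    calc 2 * |ν * besselJ ν u ^ 2 - besselW ν u| * xMacdonaldOne (a * u)
        ≤ 2 * (ν * C + C) * (64 / (a * u) ^ 4) := by gcongr
      _ = _ := by field_simp
  have t3 : Tendsto (fun u => a ^ 2 * u ^ 2 * macdonaldZero (a * u) * besselJ ν u ^ 2)
      atTop (𝓝 0) := by
    refine squeeze_zero_norm' (a := fun u => 16 / a ^ 2 * C / u ^ 2) ?_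
      (tendsto_const_div_pow_atTop _ (by norm_num))
    filter_upwards [eventually_gt_atTop 0] with u hu
    have hK := macdonaldZero_nonneg (a * u)
    rw [Real.norm_of_nonneg (by positivity)]
    calc a ^ 2 * u ^ 2 * macdonaldZero (a * u) * besselJ ν u ^ 2
        ≤ a ^ 2 * u ^ 2 * (16 / (a * u) ^ 4) * C := by
          gcongr
          · exact macdonaldZero_le_div_pow (by positivity)
          · exact (hC' u hu).2.1
      _ = _ := by field_simp
  simpa [besselConcomitant] using! (t1.add t2).add t3

/-- The equations T' = -V/a and S' = -aT involve three unknowns. Integrating the derivative of the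
concomitant, whose boundary values vanish, eliminates V and closes the system. -/
lemma besselT_besselV_besselS {ν a : ℝ} (hν : 0 < ν) (ha : 0 < a) :
    (2 * a ^ 2 + 4) * besselT ν a - (a ^ 2 + 4) * besselV ν a + 4 * ν ^ 2 * besselS ν a = 0 := by
  have iT := (integrableOn_besselT hν ha).const_mul (2 * a ^ 2 + 4)
  have iV := (integrableOn_besselV hν ha).const_mul (a ^ 2 + 4)
  have iS := (integrableOn_besselS hν ha).const_mul (4 * ν ^ 2)
  have h := integral_Ioi_of_hasDerivAt_of_tendsto_nhdsGT
    (fun u hu => hasDerivAt_besselConcomitant (by linarith) ha hu) ((iT.sub iV).add iS)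
    (tendsto_besselConcomitant_zero hν ha) (tendsto_besselConcomitant_atTop hν ha)
  rw [sub_zero] at h
  rw [besselT, besselV, besselS, ← integral_const_mul, ← integral_const_mul, ← integral_const_mul,
    ← integral_sub iT iV]
  exact (integral_add (iT.sub iV) iS).symm.trans h

lemma besselT_nonneg {ν a : ℝ} : 0 ≤ besselT ν a :=
  setIntegral_nonneg measurableSet_Ioi fun u hu => by
    have : (0 : ℝ) < u := hu
    have := macdonaldZero_nonneg (a * u)
    positivity

lemma besselS_nonneg {ν a : ℝ} : 0 ≤ besselS ν a :=
  setIntegral_nonneg measurableSet_Ioi fun u hu => by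
    have : (0 : ℝ) < u := hu
    have := xMacdonaldOne_nonneg (a * u)
    positivity

/-! ### Solving the differential system for T and S -/

/-- `√(1 + a²/4)`, i.e. `cosh (θ/2)` for `a = 2 sinh (θ/2)`. -/
def halfCosh (a : ℝ) : ℝ := √(1 + a ^ 2 / 4)
/-- `exp (θ/2)` for `a = 2 sinh (θ/2)`. -/
def halfExp (a : ℝ) : ℝ := a / 2 + halfCosh a

lemma halfCosh_pos (a : ℝ) : 0 < halfCosh a := Real.sqrt_pos.2 (by positivity)

lemma halfCosh_sq (a : ℝ) : halfCosh a ^ 2 = 1 + a ^ 2 / 4 := Real.sq_sqrt (by positivity)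

lemma hasDerivAt_halfCosh (a : ℝ) : HasDerivAt halfCosh (a / (4 * halfCosh a)) a := by
  have h : HasDerivAt (fun a : ℝ => 1 + a ^ 2 / 4) (a / 2) a := by
    refine (((hasDerivAt_pow 2 a).div_const 4).const_add 1).congr_deriv ?_
    simp; ring
  refine (h.sqrt (by positivity)).congr_deriv ?_
  rw [halfCosh]
  have := (halfCosh_pos a).ne'
  rw [halfCosh] at this
  field_simp
  norm_num

lemma hasDerivAt_halfExp (a : ℝ) : HasDerivAt halfExp (halfExp a / (2 * halfCosh a)) a := by
  refine (((hasDerivAt_id a).div_const 2).add (hasDerivAt_halfCosh a)).congr_deriv ?_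
  have := (halfCosh_pos a).ne'
  rw [halfExp]
  field_simp
  ring

lemma halfExp_pos {a : ℝ} (ha : 0 ≤ a) : 0 < halfExp a := by
  have := halfCosh_pos a
  rw [halfExp]; positivity

lemma eqOn_const_of_hasDerivAt_zero {g : ℝ → ℝ} (hg : ∀ a, 0 < a → HasDerivAt g 0 a) :
    ∃ c, ∀ a, 0 < a → g a = c := by
  refine ⟨g 1, fun a ha => ?_⟩
  refine (convex_Ioi (0 : ℝ)).is_const_of_fderivWithin_eq_zero (𝕜 := ℝ)
    (fun x hx => (hg x hx).differentiableAt.differentiableWithinAt) (fun x hx => ?_) ha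
    (mem_Ioi.2 one_pos)
  rw [fderivWithin_of_isOpen isOpen_Ioi hx, (hg x hx).hasFDerivAt.fderiv]
  ext; simp

/-- The solution of the differential system for `T` and `S` up to constants. -/
lemma exists_besselT_besselS_eq {ν : ℝ} (hν : 0 < ν) : ∃ c d : ℝ, ∀ a, 0 < a →
    a * halfCosh a * besselT ν a + ν * besselS ν a = c * (halfExp a ^ (2 * ν))⁻¹ ∧
    a * halfCosh a * besselT ν a - ν * besselS ν a = d * halfExp a ^ (2 * ν) := by
  -- With dθ = da / `halfCosh a` and X = a · `halfCosh a` · T the system is dX/dθ = -ν²S, dS/dθ =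
  -- -X. Hence X + νS and X - νS are multiples of e^{-νθ} and e^{νθ}, where e^{νθ} is `halfExp a ^
  -- (2 * ν)`.
  have hX : ∀ a, 0 < a → HasDerivAt (fun a => a * halfCosh a * besselT ν a)
      (-(ν ^ 2 * besselS ν a / halfCosh a)) a := by
    intro a ha
    have hp := halfCosh_pos a
    refine (((hasDerivAt_id a).mul (hasDerivAt_halfCosh a)).mul
      (hasDerivAt_besselT hν ha)).congr_deriv ?_
    have h1 := besselT_besselV_besselS hν ha
    have h2 := halfCosh_sq a
    simp only [id, Pi.mul_apply]
    field_simp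
    simp only [h2]
    linear_combination h1
  have hS : ∀ a, 0 < a → HasDerivAt (besselS ν) (-(a * halfCosh a * besselT ν a / halfCosh a)) a := by
    intro a ha
    have hp := halfCosh_pos a
    refine (hasDerivAt_besselS hν ha).congr_deriv ?_
    field_simp
  have hE : ∀ a, 0 < a → HasDerivAt (fun a => halfExp a ^ (2 * ν))
      (ν * halfExp a ^ (2 * ν) / halfCosh a) a := by
    intro a ha
    have hp := halfCosh_pos a
    have he := halfExp_pos ha.le
    refine ((hasDerivAt_halfExp a).rpow_const (Or.inl he.ne')).congr_deriv ?_
    rw [Real.rpow_sub_one he.ne']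
    field_simp
  obtain ⟨c, hc⟩ := eqOn_const_of_hasDerivAt_zero
    (g := fun a => (a * halfCosh a * besselT ν a + ν * besselS ν a) * halfExp a ^ (2 * ν))
    (fun a ha => by
      refine (((hX a ha).add ((hS a ha).const_mul ν)).mul (hE a ha)).congr_deriv ?_
      have hp := halfCosh_pos a
      simp only [Pi.add_apply]
      field_simp
      ring)
  obtain ⟨d, hd⟩ := eqOn_const_of_hasDerivAt_zero
    (g := fun a => (a * halfCosh a * besselT ν a - ν * besselS ν a) * (halfExp a ^ (2 * ν))⁻¹)
    (fun a ha => by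
      have he : 0 < halfExp a ^ (2 * ν) := Real.rpow_pos_of_pos (halfExp_pos ha.le) _
      refine (((hX a ha).sub ((hS a ha).const_mul ν)).mul ((hE a ha).inv he.ne')).congr_deriv ?_
      have hp := halfCosh_pos a
      simp only [Pi.sub_apply, Pi.inv_apply]
      generalize halfExp a ^ (2 * ν) = e at *
      field_simp
      ring)
  refine ⟨c, d, fun a ha => ?_⟩
  have he : 0 < halfExp a ^ (2 * ν) := Real.rpow_pos_of_pos (halfExp_pos ha.le) _
  rw [← hc a ha, ← hd a ha]
  generalize halfExp a ^ (2 * ν) = e at *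
  constructor <;> field_simp

lemma tendsto_halfExp_div : Tendsto (fun a => halfExp a / a) atTop (𝓝 1) := by
  have h : Tendsto (fun a : ℝ => 1 / 2 + √(1 / a ^ 2 + 1 / 4)) atTop (𝓝 (1 / 2 + √(0 + 1 / 4))) :=
    (((tendsto_const_div_pow_atTop 1 two_ne_zero).add_const _).sqrt).const_add _
  have e : √((0 : ℝ) + 1 / 4) = 1 / 2 := by
    rw [show (0 : ℝ) + 1 / 4 = (1 / 2) ^ 2 by norm_num, Real.sqrt_sq (by norm_num)]
  rw [e, add_halves] at h
  refine h.congr' ?_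
  filter_upwards [eventually_gt_atTop 0] with a ha
  rw [halfExp, halfCosh, show (1 : ℝ) + a ^ 2 / 4 = a ^ 2 * (1 / a ^ 2 + 1 / 4) by field_simp,
    Real.sqrt_mul (sq_nonneg a), Real.sqrt_sq ha.le]
  field_simp

/-- For large a the weight (au)K₁(au) lives at u of order 1/a, where J_ν(u) behaves like (u/2)^ν /
Γ(ν+1). Rescaling and dominated convergence leave the moment r = 2ν. -/
lemma tendsto_rpow_mul_besselS {ν : ℝ} (hν : 0 < ν) :
    Tendsto (fun a => a ^ (2 * ν) * besselS ν a) atTop (𝓝 (1 / (2 * ν))) := by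
  obtain ⟨C, hC, hC'⟩ := exists_besselJ_bounds ν hν
  have hG1 := Real.Gamma_pos_of_pos hν
  have hG2 := Real.Gamma_pos_of_pos (show 0 < ν + 1 by linarith)
  set b : ℝ := (1 / 2) ^ ν * (1 / Real.Gamma (ν + 1)) with hb
  have hlim : ∫ v in Ioi (0 : ℝ), b ^ 2 * (v ^ (2 * ν - 1) * xMacdonaldOne v) = 1 / (2 * ν) := by
    rw [integral_const_mul, integral_rpow_mul_xMacdonaldOne (by positivity),
      mul_div_cancel_left₀ _ (two_ne_zero' ℝ), hb, mul_pow, Real.rpow_sub_one two_ne_zero,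
      one_div, Real.inv_rpow (by norm_num), mul_comm 2 ν, Real.rpow_mul (by norm_num), Real.rpow_two,
      Real.Gamma_add_one hν.ne']
    have : (2 : ℝ) ^ ν ≠ 0 := by positivity
    field_simp
  rw [← hlim]
  have hsub : ∀ a, 0 < a → a ^ (2 * ν) * besselS ν a =
      ∫ v in Ioi (0 : ℝ), a ^ (2 * ν) * (besselJ ν (v / a) ^ 2 / v * xMacdonaldOne v) := by
    intro a ha
    have h := integral_comp_mul_left_Ioi
      (fun v => besselJ ν (v / a) ^ 2 / v * xMacdonaldOne v) 0 ha
    rw [mul_zero, smul_eq_mul] at h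
    rw [integral_const_mul]
    congr 1
    rw [← mul_right_inj' (inv_pos.2 ha).ne', ← h, besselS, ← integral_const_mul]
    refine setIntegral_congr_fun measurableSet_Ioi fun u hu => ?_
    have hu0 : (0 : ℝ) < u := hu
    rw [mul_div_cancel_left₀ _ ha.ne']
    field_simp
  have hcont : ∀ a, 0 < a → ContinuousOn
      (fun v => a ^ (2 * ν) * (besselJ ν (v / a) ^ 2 / v * xMacdonaldOne v)) (Ioi 0) := by
    intro a ha
    refine continuousOn_const.mul (ContinuousOn.mul (ContinuousOn.div (ContinuousOn.pow
      ((continuousOn_besselJ ν (by linarith)).comp (continuousOn_id.div_const a)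
        fun v hv => div_pos hv ha) 2) continuousOn_id fun v hv => (mem_Ioi.1 hv).ne')
      continuous_xMacdonaldOne.continuousOn)
  refine Tendsto.congr' (f₁ := fun a => ∫ v in Ioi (0 : ℝ),
    a ^ (2 * ν) * (besselJ ν (v / a) ^ 2 / v * xMacdonaldOne v)) ?_ ?_
  · filter_upwards [eventually_gt_atTop 0] with a ha using (hsub a ha).symm
  refine tendsto_integral_filter_of_dominated_convergence
    (fun v => C * (v ^ (2 * ν - 1) * xMacdonaldOne v)) ?_ ?_
    ((integrableOn_rpow_mul_xMacdonaldOne (by positivity)).const_mul C) ?_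
  · filter_upwards [eventually_gt_atTop 0] with a ha
    exact (hcont a ha).aestronglyMeasurable measurableSet_Ioi
  · filter_upwards [eventually_gt_atTop 0] with a ha
    refine (ae_restrict_iff' measurableSet_Ioi).2 (.of_forall fun v hv => ?_)
    have hv0 : (0 : ℝ) < v := hv
    have hX := xMacdonaldOne_nonneg v
    rw [Real.norm_of_nonneg (by positivity), ← mul_assoc, ← mul_assoc, Real.rpow_sub_one hv0.ne',
      ← mul_div_assoc, ← mul_div_assoc]
    gcongr ?_ / v * xMacdonaldOne v
    have h1 := (hC' (v / a) (by positivity)).1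
    rw [Real.div_rpow hv0.le ha.le] at h1
    calc a ^ (2 * ν) * besselJ ν (v / a) ^ 2 ≤ a ^ (2 * ν) * (C * (v ^ (2 * ν) / a ^ (2 * ν))) := by
          gcongr
      _ = C * v ^ (2 * ν) := by
          have : a ^ (2 * ν) ≠ 0 := by positivity
          field_simp
  · refine (ae_restrict_iff' measurableSet_Ioi).2 (.of_forall fun v hv => ?_)
    have hv0 : (0 : ℝ) < v := hv
    have h0 : Tendsto (fun a : ℝ => (v / a) ^ 2 / 4) atTop (𝓝 0) := by
      have := tendsto_const_div_pow_atTop (v ^ 2 / 4) two_ne_zero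
      refine this.congr fun a => ?_
      rw [div_pow]; ring
    have h1 := ((continuous_besselPhi ν (by linarith)).tendsto 0).comp h0
    rw [besselPhi_zero] at h1
    have h2 := ((((h1.const_mul ((1 / 2) ^ ν)).pow 2).mul_const (v ^ (2 * ν - 1))).mul_const
      (xMacdonaldOne v))
    rw [← hb, mul_assoc] at h2
    refine h2.congr' ?_
    filter_upwards [eventually_gt_atTop 0] with a ha
    have haν : (a ^ ν) ≠ 0 := by positivity
    simp only [Function.comp]
    rw [besselJ_eq ν (show 0 < v / a by positivity), show v / a / 2 = (1 / 2) * v / a by ring,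
      Real.div_rpow (by positivity) ha.le, Real.mul_rpow (by norm_num) hv0.le,
      Real.rpow_sub_one hv0.ne', mul_comm 2 ν, Real.rpow_mul hv0.le, Real.rpow_mul ha.le,
      Real.rpow_two, Real.rpow_two]
    field_simp

lemma tendsto_halfExp_rpow_atTop {r : ℝ} (hr : 0 < r) :
    Tendsto (fun a => halfExp a ^ r) atTop atTop := by
  refine (tendsto_rpow_atTop hr).comp (tendsto_atTop_mono (fun a => ?_)
    (tendsto_id.atTop_div_const two_pos))
  rw [halfExp]
  linarith [halfCosh_pos a, show id a = a from rfl]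

lemma mul_halfCosh_mul_besselT {ν a : ℝ} (hν : 0 < ν) (ha : 0 < a) :
    a * halfCosh a * besselT ν a = (halfExp a ^ (2 * ν))⁻¹ / 2 := by
  obtain ⟨c, d, h⟩ := exists_besselT_besselS_eq hν
  have hE := tendsto_halfExp_rpow_atTop (show 0 < 2 * ν by positivity)
  -- Since T and S are nonnegative, |X - νS| ≤ X + νS, so |d| e^{νθ} ≤ c e^{-νθ} for all θ > 0: the
  -- growing solution is excluded.
  have hd : d = 0 := by
    have h1 : Tendsto (fun a => c * ((halfExp a ^ (2 * ν))⁻¹ * (halfExp a ^ (2 * ν))⁻¹)) atTop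
        (𝓝 0) := by
      simpa using ((tendsto_inv_atTop_zero.comp hE).mul (tendsto_inv_atTop_zero.comp hE)).const_mul c
    have h2 : |d| ≤ 0 := by
      refine ge_of_tendsto h1 ?_
      filter_upwards [eventually_gt_atTop 0] with a ha
      have he : 0 < halfExp a ^ (2 * ν) := Real.rpow_pos_of_pos (halfExp_pos ha.le) _
      obtain ⟨h3, h4⟩ := h a ha
      have hT : 0 ≤ a * halfCosh a * besselT ν a :=
        mul_nonneg (mul_nonneg ha.le (halfCosh_pos a).le) besselT_nonneg
      have hS : 0 ≤ ν * besselS ν a := mul_nonneg hν.le besselS_nonneg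
      have h5 : |d * halfExp a ^ (2 * ν)| ≤ c * (halfExp a ^ (2 * ν))⁻¹ := by
        rw [← h3, ← h4, abs_le]
        constructor <;> linarith
      rw [abs_mul, abs_of_pos he, ← le_div_iff₀ he] at h5
      exact h5.trans (le_of_eq (by rw [div_eq_mul_inv, mul_assoc]))
    exact abs_nonpos_iff.1 h2
  -- With d = 0, 2νS = c · `halfExp a ^ (-2ν)`; as `halfExp a` is asymptotic to a, the limit of
  -- a^(2ν) S gives c.
  have hc : c = 1 := by
    have h1 : Tendsto (fun a => 2 * ν * (a ^ (2 * ν) * besselS ν a) * (halfExp a / a) ^ (2 * ν))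
        atTop (𝓝 (2 * ν * (1 / (2 * ν)) * 1 ^ (2 * ν))) :=
      ((tendsto_rpow_mul_besselS hν).const_mul _).mul
        (tendsto_halfExp_div.rpow_const (Or.inl one_ne_zero))
    rw [Real.one_rpow, mul_one, mul_one_div_cancel (by positivity)] at h1
    refine tendsto_nhds_unique (tendsto_const_nhds.congr' ?_) h1
    filter_upwards [eventually_gt_atTop 0] with a ha
    obtain ⟨h3, h4⟩ := h a ha
    have he : 0 < halfExp a ^ (2 * ν) := Real.rpow_pos_of_pos (halfExp_pos ha.le) _
    have ha' : 0 < a ^ (2 * ν) := Real.rpow_pos_of_pos ha _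
    rw [Real.div_rpow (halfExp_pos ha.le).le ha.le]
    rw [hd, zero_mul] at h4
    generalize halfExp a ^ (2 * ν) = e at *
    generalize a ^ (2 * ν) = q at *
    have h6 : 2 * (ν * besselS ν a) = c * e⁻¹ := by linarith
    field_simp
    field_simp at h6
    linarith
  obtain ⟨h3, h4⟩ := h a ha
  rw [hd, zero_mul] at h4
  rw [hc, one_mul] at h3
  linarith

/-! ### The two constants for positive order -/

lemma boundedVariationOn_xMacdonaldOne : BoundedVariationOn xMacdonaldOne (Icc 0 1) := by
  have h : MonotoneOn (fun x => -xMacdonaldOne x) (Icc 0 1) :=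
    (xMacdonaldOne_antitoneOn.mono Icc_subset_Ici_self).neg
  have h2 : BoundedVariationOn (fun x => -xMacdonaldOne x) (Icc 0 1) := by
    refine h.boundedVariationOn (C := 1) fun x hx => ?_
    rw [abs_neg, abs_of_nonneg (xMacdonaldOne_nonneg x)]
    exact xMacdonaldOne_le_one hx.1
  have h3 := (LipschitzWith.id.neg (α := ℝ)).comp_boundedVariationOn h2
  refine (Eq.mp (congrArg (fun g => BoundedVariationOn g (Icc (0 : ℝ) 1)) ?_) h3)
  ext x
  simp

/-- The dilation theorem with test function x K₁(x) and α = 1/a. The test function is 1 at the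
origin and has integral π/2, so P is isolated as the constant term of T at a = 0. -/
lemma tendsto_besselT_sub {ν c P C : ℝ} (hν : 0 < ν) (hC : 0 < C)
    (hb : ∀ s, 1 ≤ s → |besselN ν s - c| ≤ C / s)
    (hP : Tendsto (fun S => ∫ u in (0 : ℝ)..S, (besselN ν u - c)) atTop (𝓝 P)) :
    Tendsto (fun a => besselT ν a - c * (Real.pi / 2) / a) (𝓝[>] 0) (𝓝 P) := by
  have hν' : -1 < ν := by linarith
  have key := tendsto_integral_mul_dilation ((continuousOn_besselN ν hν').sub continuousOn_const)
    (integrableOn_besselN_sub_const ν hν' c) hC hb hP continuous_xMacdonaldOne.continuousOn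
    integrableOn_xMacdonaldOne_Ioi ⟨1, one_pos, boundedVariationOn_xMacdonaldOne⟩
  rw [xMacdonaldOne_zero, one_mul] at key
  refine (key.comp tendsto_inv_nhdsGT_zero).congr' ?_
  filter_upwards [self_mem_nhdsWithin] with a ha
  have ha0 : (0 : ℝ) < a := ha
  obtain ⟨hi, he⟩ := integral_xMacdonaldOne_mul_besselN hν ha0
  have h := integral_comp_mul_left_Ioi xMacdonaldOne 0 ha0
  rw [mul_zero, integral_xMacdonaldOne, smul_eq_mul] at h
  rw [← he, mul_div_assoc, div_eq_inv_mul (Real.pi / 2), ← h, ← integral_const_mul,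
    ← integral_sub hi ((integrableOn_xMacdonaldOne_mul ha0).const_mul c)]
  refine integral_congr_ae (.of_forall fun s => ?_)
  simp only [div_inv_eq_mul, Pi.sub_apply]
  rw [mul_comm s a]
  ring

lemma hasDerivAt_inv_halfExp_rpow_div (ν : ℝ) :
    HasDerivAt (fun a => (halfExp a ^ (2 * ν))⁻¹ / halfCosh a) (-ν) 0 := by
  have hc : halfCosh 0 = 1 := by simp [halfCosh]
  have he : halfExp 0 = 1 := by simp [halfExp, hc]
  have h1 := (hasDerivAt_halfExp 0).rpow_const (p := 2 * ν) (Or.inl (by rw [he]; exact one_ne_zero))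
  refine ((h1.inv (by rw [he]; simp)).div (hasDerivAt_halfCosh 0)
    (by rw [hc]; exact one_ne_zero)).congr_deriv ?_
  simp [hc, he]

/-- The asymptotics of the one-point density for positive order. -/
lemma besselN_asymptotics_of_pos {ν : ℝ} (hν : 0 < ν) :
    ∃ C : ℝ, 0 < C ∧ (∀ s, 1 ≤ s → |besselN ν s - 1 / Real.pi| ≤ C / s) ∧
      Tendsto (fun S => ∫ u in (0 : ℝ)..S, (besselN ν u - 1 / Real.pi)) atTop (𝓝 (-(ν / 2))) := by
  obtain ⟨c, P, C, hC, hb, hP⟩ := exists_besselN_asymptotics ν (by linarith)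
  -- T = g(a)/(2a) with g(0) = 1 and g'(0) = -ν. Matching the pole at a = 0 gives cπ/2 = 1/2; the
  -- constant term g'(0)/2 is then P.
  set g : ℝ → ℝ := fun a => (halfExp a ^ (2 * ν))⁻¹ / halfCosh a with hg
  have hgd : HasDerivAt g (-ν) 0 := hasDerivAt_inv_halfExp_rpow_div ν
  have hg0 : g 0 = 1 := by simp [hg, halfExp, halfCosh]
  have hT : ∀ a, 0 < a → besselT ν a = g a / (2 * a) := by
    intro a ha
    have h := mul_halfCosh_mul_besselT hν ha
    have hc := halfCosh_pos a
    simp only [hg]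
    generalize (halfExp a ^ (2 * ν))⁻¹ = e at *
    field_simp
    linarith
  have hlim := tendsto_besselT_sub hν hC hb hP
  have hid : Tendsto (fun a : ℝ => a) (𝓝[>] 0) (𝓝 0) := nhdsWithin_le_nhds
  have hcv : c = 1 / Real.pi := by
    have h1 := hid.mul hlim
    rw [zero_mul] at h1
    have h2 : Tendsto (fun a => g a / 2 - c * (Real.pi / 2)) (𝓝[>] 0)
        (𝓝 (g 0 / 2 - c * (Real.pi / 2))) :=
      ((hgd.continuousAt.tendsto.mono_left nhdsWithin_le_nhds).div_const 2).sub_const _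
    have h3 := tendsto_nhds_unique (h1.congr' ?_) h2
    · rw [hg0] at h3
      have := Real.pi_pos
      field_simp
      linarith
    · filter_upwards [self_mem_nhdsWithin] with a ha
      have ha0 : (0 : ℝ) < a := ha
      rw [hT a ha0]
      field_simp
  have hPv : P = -(ν / 2) := by
    have h1 := ((hasDerivAt_iff_tendsto_slope.1 hgd).mono_left
      (nhdsWithin_mono 0 (fun x (hx : 0 < x) => hx.ne'))).div_const 2
    rw [← neg_div]
    refine tendsto_nhds_unique (hlim.congr' ?_) h1
    filter_upwards [self_mem_nhdsWithin] with a ha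
    have ha0 : (0 : ℝ) < a := ha
    rw [hT a ha0, slope_def_field, hg0, hcv, sub_zero]
    have := Real.pi_pos
    field_simp
  exact ⟨C, hC, hcv ▸ hb, by rw [← hcv, ← hPv]; exact hP⟩

/-! ### Descent to all orders ν > -1 -/

lemma besselN_add_two (ν : ℝ) (hν : -1 < ν) {s : ℝ} (hs : 0 < s) :
    2 * (besselW ν s / s) - 2 * (ν + 1) / s * besselJ (ν + 1) s ^ 2 =
      besselN ν s - 2 * besselN (ν + 1) s + besselN (ν + 2) s := by
  have h0 := besselJ_eq_add_two ν hν hs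
  have h1 := besselJ_eq_add_two (ν + 1) (by linarith) hs
  rw [show ν + 1 + 1 = ν + 2 by ring, show ν + 1 + 2 = ν + 3 by ring] at h1
  have h3 : besselJ (ν + 3) s = 2 * (ν + 2) / s * besselJ (ν + 2) s - besselJ (ν + 1) s := by
    rw [h1]; ring
  simp only [besselN, besselL, besselW]
  rw [show ν + 1 + 1 = ν + 2 by ring, show ν + 2 + 1 = ν + 3 by ring, h0, h3]
  field_simp
  ring

/-- The second difference of the density in the order is an exact derivative. It carries both
constants from the positive orders ν+1 and ν+2 down to ν. -/
lemma hasDerivAt_besselJ_add_one_sq (ν : ℝ) (hν : -1 < ν) {s : ℝ} (hs : 0 < s) :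
    HasDerivAt (fun s => besselJ (ν + 1) s ^ 2)
      (besselN ν s - 2 * besselN (ν + 1) s + besselN (ν + 2) s) s := by
  refine ((hasDerivAt_besselJ_add_one ν hν hs).pow 2).congr_deriv ?_
  rw [← besselN_add_two ν hν hs, besselW]
  field_simp
  ring

lemma tendsto_besselJ_add_one_sq (ν : ℝ) (hν : -1 < ν) :
    Tendsto (fun s => besselJ (ν + 1) s ^ 2) atTop (𝓝 0) := by
  obtain ⟨K, hK, hY⟩ := exists_besselY_le ν hν
  refine squeeze_zero' (.of_forall fun s => sq_nonneg _) ?_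
    (by simpa using tendsto_const_div_pow_atTop K one_ne_zero)
  filter_upwards [eventually_ge_atTop 1] with s hs
  have hs0 : 0 < s := by linarith
  rw [le_div_iff₀ hs0]
  refine le_trans ?_ (hY s hs)
  rw [besselY]
  nlinarith [sq_nonneg (besselJ ν s)]

lemma tendsto_besselN_second_difference (ν : ℝ) (hν : -1 < ν) :
    Tendsto (fun s => besselN ν s - 2 * besselN (ν + 1) s + besselN (ν + 2) s) atTop (𝓝 0) := by
  obtain ⟨K, hK, hY⟩ := exists_besselY_le ν hν
  have h1 : Tendsto (fun s => besselW ν s / s) atTop (𝓝 0) := by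
    refine squeeze_zero_norm' (a := fun s => K / s) ?_
      (by simpa using tendsto_const_div_pow_atTop K one_ne_zero)
    filter_upwards [eventually_ge_atTop 1] with s hs
    have hs0 : 0 < s := by linarith
    rw [Real.norm_eq_abs, abs_div, abs_of_pos hs0]
    gcongr
    linarith [abs_besselW_le ν hs0, hY s hs, besselY_nonneg ν hs0]
  have h2 : Tendsto (fun s : ℝ => 2 * (ν + 1) / s) atTop (𝓝 0) := by
    simpa using tendsto_const_div_pow_atTop (2 * (ν + 1)) one_ne_zero
  have h3 := (h1.const_mul 2).sub (h2.mul (tendsto_besselJ_add_one_sq ν hν))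
  simp only [mul_zero, sub_zero] at h3
  refine h3.congr' ?_
  filter_upwards [eventually_gt_atTop 0] with s hs using besselN_add_two ν hν hs

lemma tendsto_of_abs_sub_le_div {g : ℝ → ℝ} {c C : ℝ} (h : ∀ s, 1 ≤ s → |g s - c| ≤ C / s) :
    Tendsto g atTop (𝓝 c) := by
  rw [tendsto_iff_norm_sub_tendsto_zero]
  refine squeeze_zero' (.of_forall fun s => norm_nonneg _) ?_
    (by simpa using tendsto_const_div_pow_atTop C one_ne_zero)
  filter_upwards [eventually_ge_atTop 1] with s hs using h s hs

/-- The asymptotics of the one-point density. -/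
theorem besselN_asymptotics {ν : ℝ} (hν : -1 < ν) :
    ∃ C : ℝ, 0 < C ∧ (∀ s, 1 ≤ s → |besselN ν s - 1 / Real.pi| ≤ C / s) ∧
      Tendsto (fun S => ∫ u in (0 : ℝ)..S, (besselN ν u - 1 / Real.pi)) atTop (𝓝 (-(ν / 2))) := by
  obtain ⟨c, P, C, hC, hb, hP⟩ := exists_besselN_asymptotics ν hν
  obtain ⟨C1, hC1, hb1, hP1⟩ := besselN_asymptotics_of_pos (show 0 < ν + 1 by linarith)
  obtain ⟨C2, hC2, hb2, hP2⟩ := besselN_asymptotics_of_pos (show 0 < ν + 2 by linarith)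
  -- The limits of N_ν, N_{ν+1}, N_{ν+2} have second difference 0, and the last two are 1/π.
  have hcv : c = 1 / Real.pi := by
    have h1 := ((tendsto_of_abs_sub_le_div hb).sub
      ((tendsto_of_abs_sub_le_div hb1).const_mul 2)).add (tendsto_of_abs_sub_le_div hb2)
    have h2 := tendsto_nhds_unique h1 (tendsto_besselN_second_difference ν hν)
    linarith
  rw [hcv] at hb hP
  refine ⟨C, hC, hb, ?_⟩
  -- On [0,S] the integral of N_ν - 1/π is 2∫(N_{ν+1} - 1/π) - ∫(N_{ν+2} - 1/π) + J_{ν+1}(S)². There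
  -- is no term at 0 because ν + 1 > 0.
  have h1 := ((hP1.const_mul 2).sub hP2).add (tendsto_besselJ_add_one_sq ν hν)
  have e : 2 * -((ν + 1) / 2) - -((ν + 2) / 2) + 0 = -(ν / 2) := by ring
  rw [e] at h1
  refine h1.congr' ?_
  filter_upwards [eventually_gt_atTop 0] with S hS
  have hi : ∀ {μ : ℝ}, -1 < μ → IntervalIntegrable (besselN μ) volume 0 S := fun hμ =>
    (intervalIntegrable_iff_integrableOn_Ioc_of_le hS.le).2 (integrableOn_besselN _ hμ S)
  have hc : IntervalIntegrable (fun _ : ℝ => 1 / Real.pi) volume 0 S := intervalIntegrable_const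
  have hJ0 : Tendsto (fun s => besselJ (ν + 1) s ^ 2) (𝓝[>] 0) (𝓝 0) := by
    obtain ⟨D, hD, hD'⟩ := exists_besselJ_bounds (ν + 1) (by linarith)
    refine squeeze_zero' (.of_forall fun s => sq_nonneg _) ?_
      (tendsto_const_mul_rpow_nhdsGT_zero D (show 0 < 2 * (ν + 1) by linarith))
    filter_upwards [self_mem_nhdsWithin] with s hs using (hD' s hs).1
  have i0 := hi hν
  have i1 := hi (show -1 < ν + 1 by linarith)
  have i2 := hi (show -1 < ν + 2 by linarith)
  have hFTC := intervalIntegral.integral_eq_sub_of_hasDerivAt_of_tendsto hS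
    (fun s hs => hasDerivAt_besselJ_add_one_sq ν hν hs.1) ((i0.sub (i1.const_mul 2)).add i2)
    hJ0 (((hasDerivAt_besselJ_add_one_sq ν hν hS).continuousAt.tendsto).mono_left
      nhdsWithin_le_nhds)
  rw [intervalIntegral.integral_add (i0.sub (i1.const_mul 2)) i2,
    intervalIntegral.integral_sub i0 (i1.const_mul 2), intervalIntegral.integral_const_mul] at hFTC
  rw [intervalIntegral.integral_sub i1 hc, intervalIntegral.integral_sub i2 hc,
    intervalIntegral.integral_sub i0 hc]
  linarith

/-! ### Integral operators on L² and superpositions of rank-one operators -/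

/-- The Cauchy–Schwarz inequality for functions whose squares are integrable. -/
lemma integral_abs_mul_le_norm_toLp_mul {X : Type*} [MeasurableSpace X] {μ : Measure X}
    {f h : X → ℝ} (hf : MemLp f 2 μ) (hh : MemLp h 2 μ) :
    ∫ x, |f x * h x| ∂μ ≤ ‖hf.toLp f‖ * ‖hh.toLp h‖ := by
  have e1 : ∫ x, |f x * h x| ∂μ = inner ℝ (hf.norm.toLp _) (hh.norm.toLp _) := by
    rw [L2.inner_def]
    refine integral_congr_ae ?_
    filter_upwards [hf.norm.coeFn_toLp, hh.norm.coeFn_toLp] with x h1 h2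
    rw [h1, h2, abs_mul]
    simp [mul_comm]
  rw [e1]
  refine (real_inner_le_norm _ _).trans (le_of_eq ?_)
  simp only [Lp.norm_toLp, eLpNorm_norm]

/-- A kernel dominated by `a x * a y` with `a` square integrable defines a bounded operator on
`L²`, the integrals converging absolutely. -/
lemma exists_integralOperator {X : Type*} [MeasurableSpace X] {μ : Measure X} [SFinite μ]
    {k : X → X → ℝ} {a : X → ℝ}
    (hk : AEStronglyMeasurable (fun p : X × X => k p.1 p.2) (μ.prod μ)) (ha : MemLp a 2 μ)
    (hka : ∀ᵐ x ∂μ, ∀ᵐ y ∂μ, |k x y| ≤ a x * a y) :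
    ∃ B : Lp ℂ 2 μ →L[ℂ] Lp ℂ 2 μ, ∀ g : Lp ℂ 2 μ,
      (∀ᵐ x ∂μ, Integrable (fun y => (k x y : ℂ) * g y) μ) ∧
      (B g : X → ℂ) =ᵐ[μ] fun x => ∫ y, (k x y : ℂ) * g y ∂μ := by
  have hag : ∀ g : Lp ℂ 2 μ, Integrable (fun y => |a y * ‖g y‖|) μ := fun g =>
    (ha.integrable_mul (Lp.memLp g).norm).abs
  have hkc : AEStronglyMeasurable (fun p : X × X => (k p.1 p.2 : ℂ)) (μ.prod μ) :=
    Complex.continuous_ofReal.comp_aestronglyMeasurable hk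
  have hbd : ∀ g : Lp ℂ 2 μ, ∀ᵐ x ∂μ, ∀ᵐ y ∂μ,
      ‖(k x y : ℂ) * g y‖ ≤ |a x| * |a y * ‖g y‖| := by
    intro g
    filter_upwards [hka] with x hx
    filter_upwards [hx] with y hy
    rw [norm_mul, Complex.norm_real, Real.norm_eq_abs, abs_mul (a y), abs_norm, ← mul_assoc,
      ← abs_mul]
    exact mul_le_mul_of_nonneg_right (hy.trans (le_abs_self _)) (norm_nonneg _)
  have hint : ∀ g : Lp ℂ 2 μ, ∀ᵐ x ∂μ, Integrable (fun y => (k x y : ℂ) * g y) μ := by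
    intro g
    filter_upwards [hbd g, hkc.prodMk_left] with x hx hxm
    exact ((hag g).const_mul |a x|).mono' (hxm.mul (Lp.aestronglyMeasurable g)) hx
  have hle : ∀ g : Lp ℂ 2 μ, ∀ᵐ x ∂μ,
      ‖∫ y, (k x y : ℂ) * g y ∂μ‖ ≤ (∫ y, |a y * ‖g y‖| ∂μ) * ‖a x‖ := by
    intro g
    filter_upwards [hbd g] with x hx
    rw [mul_comm, Real.norm_eq_abs, ← integral_const_mul]
    exact norm_integral_le_of_norm_le ((hag g).const_mul _) hx
  have hmeas : ∀ g : Lp ℂ 2 μ,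
      AEStronglyMeasurable (fun x => ∫ y, (k x y : ℂ) * g y ∂μ) μ := fun g =>
    (hkc.mul (Lp.aestronglyMeasurable g).comp_snd).integral_prod_right'
  have hmem : ∀ g : Lp ℂ 2 μ, MemLp (fun x => ∫ y, (k x y : ℂ) * g y ∂μ) 2 μ := fun g =>
    ha.of_le_mul (hmeas g) (hle g)
  let A : Lp ℂ 2 μ →ₗ[ℂ] Lp ℂ 2 μ :=
    { toFun := fun g => (hmem g).toLp _
      map_add' := by
        intro g h
        apply Lp.ext
        filter_upwards [(hmem (g + h)).coeFn_toLp, (hmem g).coeFn_toLp, (hmem h).coeFn_toLp,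
          Lp.coeFn_add ((hmem g).toLp _) ((hmem h).toLp _), hint g, hint h]
          with x h1 h2 h3 h4 h5 h6
        rw [h1, h4, Pi.add_apply, h2, h3, ← integral_add h5 h6]
        refine integral_congr_ae ?_
        filter_upwards [Lp.coeFn_add g h] with y hy
        rw [hy, Pi.add_apply, mul_add]
      map_smul' := by
        intro c g
        apply Lp.ext
        filter_upwards [(hmem (c • g)).coeFn_toLp, (hmem g).coeFn_toLp,
          Lp.coeFn_smul c ((hmem g).toLp _)] with x h1 h2 h3
        rw [h1, RingHom.id_apply, h3, Pi.smul_apply, h2, ← integral_smul]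
        refine integral_congr_ae ?_
        filter_upwards [Lp.coeFn_smul c g] with y hy
        rw [hy, Pi.smul_apply, smul_eq_mul, smul_eq_mul]
        ring }
  refine ⟨A.mkContinuous (‖ha.toLp a‖ * ‖ha.toLp a‖) ?_, fun g => ⟨hint g, (hmem g).coeFn_toLp⟩⟩
  intro g
  have h1 : ‖A g‖ ≤ (∫ y, |a y * ‖g y‖| ∂μ) * ‖ha.toLp a‖ := by
    refine Lp.norm_le_mul_norm_of_ae_le_mul ?_
    filter_upwards [(hmem g).coeFn_toLp, ha.coeFn_toLp, hle g] with x e1 e2 e3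
    change ‖((hmem g).toLp _ : X → ℂ) x‖ ≤ _
    rw [e1, e2]
    exact e3
  have h2 : ∫ y, |a y * ‖g y‖| ∂μ ≤ ‖ha.toLp a‖ * ‖g‖ := by
    refine (integral_abs_mul_le_norm_toLp_mul ha (Lp.memLp g).norm).trans (le_of_eq ?_)
    rw [Lp.norm_toLp _ (Lp.memLp g).norm, eLpNorm_norm, ← Lp.norm_def]
  calc ‖A g‖ ≤ (∫ y, |a y * ‖g y‖| ∂μ) * ‖ha.toLp a‖ := h1
    _ ≤ ‖ha.toLp a‖ * ‖g‖ * ‖ha.toLp a‖ := by gcongr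
    _ = _ := by ring

/-- Orthonormal families in a second-countable inner product space are countable. -/
lemma Orthonormal.countable_of_secondCountable {H ι : Type*} [NormedAddCommGroup H]
    [InnerProductSpace ℂ H] [SecondCountableTopology H] {b : ι → H} (hb : Orthonormal ℂ b) :
    Countable ι := by
  -- Orthonormal vectors are √2 apart, so the balls of radius 1/2 around them are disjoint.
  have hdist : ∀ i j, i ≠ j → 1 < dist (b i) (b j) := by
    intro i j hij
    have h0 : inner ℂ (b i) (b j) = 0 := hb.2 hij
    have h1 := norm_sub_sq (𝕜 := ℂ) (b i) (b j)
    rw [h0, hb.1 i, hb.1 j] at h1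
    rw [dist_eq_norm]
    norm_num at h1
    nlinarith [norm_nonneg (b i - b j)]
  have hd : (univ : Set ι).PairwiseDisjoint fun i => Metric.ball (b i) (1 / 2) := by
    intro i _ j _ hij
    refine Metric.ball_disjoint_ball ?_
    linarith [hdist i j hij]
  rw [← countable_univ_iff]
  exact hd.countable_of_isOpen (fun i _ => Metric.isOpen_ball)
    fun i _ => ⟨b i, Metric.mem_ball_self (by norm_num)⟩

section RankOne

variable {H : Type*} [NormedAddCommGroup H] [InnerProductSpace ℂ H] {T : Type*}
  [MeasurableSpace T] {ρ : Measure T} {σ : T → ℝ} {v : T → H}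

lemma integrable_rankOne (hσ : AEStronglyMeasurable σ ρ) (hσ1 : ∀ t, |σ t| ≤ 1)
    (hv : ∀ e : H, AEStronglyMeasurable (fun t => inner ℂ e (v t)) ρ)
    (hvi : Integrable (fun t => ‖v t‖ ^ 2) ρ) (e e' : H) :
    Integrable (fun t => (σ t : ℂ) * (inner ℂ e (v t) * inner ℂ (v t) e')) ρ := by
  have hv' : AEStronglyMeasurable (fun t => inner ℂ (v t) e') ρ := by
    have := Complex.continuous_conj.comp_aestronglyMeasurable (hv e')
    refine this.congr (Eventually.of_forall fun t => ?_)
    exact inner_conj_symm _ _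
  refine (hvi.const_mul (‖e‖ * ‖e'‖)).mono'
    ((Complex.continuous_ofReal.comp_aestronglyMeasurable hσ).mul ((hv e).mul hv'))
    (Eventually.of_forall fun t => ?_)
  rw [norm_mul, norm_mul, Complex.norm_real, Real.norm_eq_abs]
  calc |σ t| * (‖inner ℂ e (v t)‖ * ‖inner ℂ (v t) e'‖)
      ≤ 1 * ((‖e‖ * ‖v t‖) * (‖v t‖ * ‖e'‖)) := by
        gcongr
        · exact hσ1 t
        · exact norm_inner_le_norm _ _
        · exact norm_inner_le_norm _ _
    _ = _ := by ring

/-- Pointwise in t: |ab| ≤ (a² + b²)/2 and Bessel's inequality for each of the two families. The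
bound does not depend on the finite set, which is what trace class asks for. -/
lemma sum_integral_norm_rankOne_le {ι : Type*} (hσ : AEStronglyMeasurable σ ρ)
    (hσ1 : ∀ t, |σ t| ≤ 1)
    (hv : ∀ e : H, AEStronglyMeasurable (fun t => inner ℂ e (v t)) ρ)
    (hvi : Integrable (fun t => ‖v t‖ ^ 2) ρ) {e e' : ι → H} (he : Orthonormal ℂ e)
    (he' : Orthonormal ℂ e') (s : Finset ι) :
    ∑ i ∈ s, ∫ t, ‖(σ t : ℂ) * (inner ℂ (e i) (v t) * inner ℂ (v t) (e' i))‖ ∂ρ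
      ≤ ∫ t, ‖v t‖ ^ 2 ∂ρ := by
  rw [← integral_finsetSum _ fun i _ => (integrable_rankOne hσ hσ1 hv hvi (e i) (e' i)).norm]
  refine integral_mono (integrable_finsetSum _ fun i _ =>
    (integrable_rankOne hσ hσ1 hv hvi (e i) (e' i)).norm) hvi fun t => ?_
  have h1 := he.sum_inner_products_le (x := v t) (s := s)
  have h2 := he'.sum_inner_products_le (x := v t) (s := s)
  calc ∑ i ∈ s, ‖(σ t : ℂ) * (inner ℂ (e i) (v t) * inner ℂ (v t) (e' i))‖
      ≤ ∑ i ∈ s, (‖inner ℂ (e i) (v t)‖ ^ 2 / 2 + ‖inner ℂ (e' i) (v t)‖ ^ 2 / 2) := by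
        refine Finset.sum_le_sum fun i _ => ?_
        rw [norm_mul, norm_mul, Complex.norm_real, Real.norm_eq_abs, norm_inner_symm (v t) (e' i)]
        calc |σ t| * (‖inner ℂ (e i) (v t)‖ * ‖inner ℂ (e' i) (v t)‖)
            ≤ 1 * (‖inner ℂ (e i) (v t)‖ * ‖inner ℂ (e' i) (v t)‖) := by
              gcongr
              exact hσ1 t
          _ ≤ _ := by nlinarith [sq_nonneg (‖inner ℂ (e i) (v t)‖ - ‖inner ℂ (e' i) (v t)‖)]
    _ = (∑ i ∈ s, ‖inner ℂ (e i) (v t)‖ ^ 2) / 2 + (∑ i ∈ s, ‖inner ℂ (e' i) (v t)‖ ^ 2) / 2 := by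
        rw [Finset.sum_add_distrib, Finset.sum_div, Finset.sum_div]
    _ ≤ ‖v t‖ ^ 2 := by linarith

/-- An operator which is weakly an integral of rank-one operators `σ t • |v t⟩⟨v t|` with
`‖v t‖ ^ 2` integrable is trace class, with trace the integral of the traces. -/
lemma hasTrace_of_integral_rankOne [SecondCountableTopology H]
    (hσ : AEStronglyMeasurable σ ρ) (hσ1 : ∀ t, |σ t| ≤ 1)
    (hv : ∀ e : H, AEStronglyMeasurable (fun t => inner ℂ e (v t)) ρ)
    (hvi : Integrable (fun t => ‖v t‖ ^ 2) ρ) {B : H →L[ℂ] H}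
    (hB : ∀ e e' : H, inner ℂ e (B e') =
      ∫ t, (σ t : ℂ) * (inner ℂ e (v t) * inner ℂ (v t) e') ∂ρ) :
    HasTrace B ((∫ t, σ t * ‖v t‖ ^ 2 ∂ρ : ℝ) : ℂ) := by
  refine ⟨fun e e' he he' => ?_, fun w b => ?_⟩
  · refine summable_of_sum_le (c := ∫ t, ‖v t‖ ^ 2 ∂ρ) (fun _ => norm_nonneg _) fun s => ?_
    refine le_trans (Finset.sum_le_sum fun n _ => ?_)
      (sum_integral_norm_rankOne_le hσ hσ1 hv hvi he he' s)
    rw [hB]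
    exact norm_integral_le_integral_norm _
  · have : Countable w := b.orthonormal.countable_of_secondCountable
    have hS : Summable fun i => ∫ t, ‖(σ t : ℂ) * (inner ℂ (b i) (v t) * inner ℂ (v t) (b i))‖ ∂ρ :=
      summable_of_sum_le (fun _ => integral_nonneg fun _ => norm_nonneg _)
        (sum_integral_norm_rankOne_le hσ hσ1 hv hvi b.orthonormal b.orthonormal)
    have h := hasSum_integral_of_summable_integral_norm
      (fun i => integrable_rankOne hσ hσ1 hv hvi (b i) (b i)) hS
    simp only [hB]
    refine (congrArg (HasSum _) ?_).mpr h
    rw [← integral_complex_ofReal]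
    refine integral_congr_ae (Eventually.of_forall fun t => ?_)
    have h3 := (b.hasSum_inner_mul_inner (v t) (v t)).mul_left (σ t : ℂ)
    simp only [inner_self_eq_norm_sq_to_K] at h3
    have h4 : (fun i => (σ t : ℂ) * (inner ℂ (b i) (v t) * inner ℂ (v t) (b i))) =
        fun i => (σ t : ℂ) * (inner ℂ (v t) (b i) * inner ℂ (b i) (v t)) := by
      funext i
      ring
    simp only [h4, h3.tsum_eq]
    push_cast
    rfl

end RankOne

lemma norm_toLp_eq_sqrt_integral_sq {X : Type*} [MeasurableSpace X] {μ : Measure X} {f : X → ℝ}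
    (hf : MemLp f 2 μ) : ‖hf.toLp f‖ = √(∫ x, f x ^ 2 ∂μ) := by
  rw [← Real.sqrt_sq (norm_nonneg (hf.toLp _)), ← real_inner_self_eq_norm_sq, L2.inner_def]
  congr 1
  refine integral_congr_ae ?_
  filter_upwards [hf.coeFn_toLp] with t ht
  rw [ht]
  simp [sq]

lemma integral_norm_ofReal_mul_le {X : Type*} [MeasurableSpace X] {μ : Measure X} {f : X → ℝ}
    (hf : MemLp f 2 μ) (e : Lp ℂ 2 μ) :
    ∫ x, ‖(f x : ℂ) * e x‖ ∂μ ≤ √(∫ x, f x ^ 2 ∂μ) * ‖e‖ := by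
  have h := integral_abs_mul_le_norm_toLp_mul hf (Lp.memLp e).norm
  rw [Lp.norm_toLp _ (Lp.memLp e).norm, eLpNorm_norm, ← Lp.norm_def,
    norm_toLp_eq_sqrt_integral_sq] at h
  simpa [abs_mul] using h

section SuperposedKernel

variable {X T : Type*} [MeasurableSpace X] [MeasurableSpace T] {μ : Measure X} {ρ : Measure T}
  [SFinite μ] [SFinite ρ] {σ : T → ℝ} {u : T → X → ℝ}

lemma ae_memLp_two_left (hu : AEStronglyMeasurable (fun p : T × X => u p.1 p.2) (ρ.prod μ))
    (hu2 : Integrable (fun p : T × X => u p.1 p.2 ^ 2) (ρ.prod μ)) :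
    ∀ᵐ t ∂ρ, MemLp (u t) 2 μ := by
  filter_upwards [hu.prodMk_left, hu2.prod_right_ae] with t h1 h2
  exact (memLp_two_iff_integrable_sq h1).2 h2

lemma ae_memLp_two_right (hu : AEStronglyMeasurable (fun p : T × X => u p.1 p.2) (ρ.prod μ))
    (hu2 : Integrable (fun p : T × X => u p.1 p.2 ^ 2) (ρ.prod μ)) :
    ∀ᵐ x ∂μ, MemLp (fun t => u t x) 2 ρ := by
  filter_upwards [hu.prodMk_right, hu2.prod_left_ae] with t h1 h2
  exact (memLp_two_iff_integrable_sq h1).2 h2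

lemma aestronglyMeasurable_superposedKernel
    (hσ : AEStronglyMeasurable σ ρ)
    (hu : AEStronglyMeasurable (fun p : T × X => u p.1 p.2) (ρ.prod μ)) :
    AEStronglyMeasurable (fun p : X × X => ∫ t, σ t * (u t p.1 * u t p.2) ∂ρ) (μ.prod μ) := by
  have h1 : Measure.QuasiMeasurePreserving (fun p : (X × X) × T => (p.2, p.1.1))
      ((μ.prod μ).prod ρ) (ρ.prod μ) :=
    (Measure.measurePreserving_swap (μ := μ) (ν := ρ)).quasiMeasurePreserving.comp
      (MeasureTheory.QuasiMeasurePreserving.prodMap Measure.quasiMeasurePreserving_fst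
        (Measure.QuasiMeasurePreserving.id ρ))
  have h2 : Measure.QuasiMeasurePreserving (fun p : (X × X) × T => (p.2, p.1.2))
      ((μ.prod μ).prod ρ) (ρ.prod μ) :=
    (Measure.measurePreserving_swap (μ := μ) (ν := ρ)).quasiMeasurePreserving.comp
      (MeasureTheory.QuasiMeasurePreserving.prodMap Measure.quasiMeasurePreserving_snd
        (Measure.QuasiMeasurePreserving.id ρ))
  have h : AEStronglyMeasurable (fun p : (X × X) × T => σ p.2 * (u p.2 p.1.1 * u p.2 p.1.2))
      ((μ.prod μ).prod ρ) :=
    hσ.comp_snd.mul ((hu.comp_quasiMeasurePreserving h1).mul (hu.comp_quasiMeasurePreserving h2))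
  exact h.integral_prod_right'

/-- Justifies Fubini in (t,x,y). For fixed t, Cauchy–Schwarz in x and in y bounds the inner integral
by ‖e‖‖e'‖ ∫ u(t,x)² dx, which is integrable in t. -/
lemma integrable_superposedKernel_mul (hσ : AEStronglyMeasurable σ ρ) (hσ1 : ∀ t, |σ t| ≤ 1)
    (hu : AEStronglyMeasurable (fun p : T × X => u p.1 p.2) (ρ.prod μ))
    (hu2 : Integrable (fun p : T × X => u p.1 p.2 ^ 2) (ρ.prod μ)) (e e' : Lp ℂ 2 μ) :
    Integrable (fun p : T × X × X => (σ p.1 : ℂ) *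
      (((u p.1 p.2.1 : ℂ) * (starRingEnd ℂ) (e p.2.1)) * ((u p.1 p.2.2 : ℂ) * e' p.2.2)))
      (ρ.prod (μ.prod μ)) := by
  have hL := ae_memLp_two_left hu hu2
  have huc : AEStronglyMeasurable (fun p : T × X => (u p.1 p.2 : ℂ)) (ρ.prod μ) :=
    Complex.continuous_ofReal.comp_aestronglyMeasurable hu
  have hσc : AEStronglyMeasurable (fun t => (σ t : ℂ)) ρ :=
    Complex.continuous_ofReal.comp_aestronglyMeasurable hσ
  have h1 : Measure.QuasiMeasurePreserving (fun p : T × X × X => (p.1, p.2.1))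
      (ρ.prod (μ.prod μ)) (ρ.prod μ) :=
    MeasureTheory.QuasiMeasurePreserving.prodMap (Measure.QuasiMeasurePreserving.id ρ)
      Measure.quasiMeasurePreserving_fst
  have h2 : Measure.QuasiMeasurePreserving (fun p : T × X × X => (p.1, p.2.2))
      (ρ.prod (μ.prod μ)) (ρ.prod μ) :=
    MeasureTheory.QuasiMeasurePreserving.prodMap (Measure.QuasiMeasurePreserving.id ρ)
      Measure.quasiMeasurePreserving_snd
  have he : AEStronglyMeasurable (fun x => (starRingEnd ℂ) (e x)) μ :=
    Complex.continuous_conj.comp_aestronglyMeasurable (Lp.aestronglyMeasurable e)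
  have hG : AEStronglyMeasurable (fun p : T × X × X => (σ p.1 : ℂ) *
      (((u p.1 p.2.1 : ℂ) * (starRingEnd ℂ) (e p.2.1)) * ((u p.1 p.2.2 : ℂ) * e' p.2.2)))
      (ρ.prod (μ.prod μ)) :=
    hσc.comp_fst.mul (((huc.comp_quasiMeasurePreserving h1).mul he.comp_fst.comp_snd).mul
      ((huc.comp_quasiMeasurePreserving h2).mul
        (Lp.aestronglyMeasurable e').comp_snd.comp_snd))
  have hi : ∀ᵐ t ∂ρ, ∀ e : Lp ℂ 2 μ, Integrable (fun x => (u t x : ℂ) * e x) μ := by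
    filter_upwards [hL] with t ht e
    exact MemLp.integrable_mul (p := 2) (q := 2) ht.ofReal (Lp.memLp e)
  have hi' : ∀ᵐ t ∂ρ, ∀ e : Lp ℂ 2 μ,
      Integrable (fun x => (u t x : ℂ) * (starRingEnd ℂ) (e x)) μ := by
    filter_upwards [hL] with t ht e
    exact MemLp.integrable_mul (p := 2) (q := 2) ht.ofReal (Lp.memLp e).star
  rw [integrable_prod_iff hG]
  refine ⟨?_, ?_⟩
  · filter_upwards [hi, hi'] with t h h'
    exact ((h' e).mul_prod (h e')).const_mul _
  · refine (hu2.integral_prod_left.mul_const (‖e‖ * ‖e'‖)).mono' hG.norm.integral_prod_right' ?_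
    filter_upwards [hL] with t ht
    rw [Real.norm_of_nonneg (integral_nonneg fun _ => norm_nonneg _)]
    simp only [norm_mul (σ t : ℂ), norm_mul ((u t _ : ℂ) * (starRingEnd ℂ) (e _))]
    rw [integral_const_mul, integral_prod_mul (fun x => ‖(u t x : ℂ) * (starRingEnd ℂ) (e x)‖)
      fun y => ‖(u t y : ℂ) * e' y‖]
    have e1 : ∫ x, ‖(u t x : ℂ) * (starRingEnd ℂ) (e x)‖ ∂μ = ∫ x, ‖(u t x : ℂ) * e x‖ ∂μ := by
      simp
    have h3 := integral_norm_ofReal_mul_le ht e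
    have h4 := integral_norm_ofReal_mul_le ht e'
    have h5 : ‖(σ t : ℂ)‖ ≤ 1 := by
      rw [Complex.norm_real]
      exact hσ1 t
    rw [e1]
    calc ‖(σ t : ℂ)‖ * ((∫ x, ‖(u t x : ℂ) * e x‖ ∂μ) * ∫ x, ‖(u t x : ℂ) * e' x‖ ∂μ)
        ≤ 1 * ((√(∫ x, u t x ^ 2 ∂μ) * ‖e‖) * (√(∫ x, u t x ^ 2 ∂μ) * ‖e'‖)) := by
          gcongr
      _ = √(∫ x, u t x ^ 2 ∂μ) * √(∫ x, u t x ^ 2 ∂μ) * (‖e‖ * ‖e'‖) := by ring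
      _ = _ := by rw [Real.mul_self_sqrt (integral_nonneg fun _ => sq_nonneg _)]

/-- The kernel `∫ σ(t) u(t,x) u(t,y) dt` with `|σ| ≤ 1` and `u` square integrable on the product
space defines a trace class operator on `L²`, with trace `∫∫ σ(t) u(t,x)² dx dt`. -/
lemma exists_integralOperator_hasTrace [SecondCountableTopology (Lp ℂ 2 μ)]
    (hσ : AEStronglyMeasurable σ ρ) (hσ1 : ∀ t, |σ t| ≤ 1)
    (hu : AEStronglyMeasurable (fun p : T × X => u p.1 p.2) (ρ.prod μ))
    (hu2 : Integrable (fun p : T × X => u p.1 p.2 ^ 2) (ρ.prod μ)) :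
    ∃ B : Lp ℂ 2 μ →L[ℂ] Lp ℂ 2 μ,
      (∀ g : Lp ℂ 2 μ,
        (∀ᵐ x ∂μ, Integrable (fun y => ((∫ t, σ t * (u t x * u t y) ∂ρ : ℝ) : ℂ) * g y) μ) ∧
        (B g : X → ℂ) =ᵐ[μ] fun x => ∫ y, ((∫ t, σ t * (u t x * u t y) ∂ρ : ℝ) : ℂ) * g y ∂μ) ∧
      HasTrace B ((∫ t, σ t * ∫ x, u t x ^ 2 ∂μ ∂ρ : ℝ) : ℂ) := by
  have hR := ae_memLp_two_right hu hu2
  have hL := ae_memLp_two_left hu hu2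
  -- By Cauchy–Schwarz in t the kernel is dominated by a(x)a(y) with this a, and a² is a marginal of
  -- u².
  have ha : MemLp (fun x => √(∫ t, u t x ^ 2 ∂ρ)) 2 μ := by
    have hi : Integrable (fun x => ∫ t, u t x ^ 2 ∂ρ) μ :=
      Integrable.integral_prod_right (f := fun p : T × X => u p.1 p.2 ^ 2) hu2
    refine (memLp_two_iff_integrable_sq
      (Real.continuous_sqrt.comp_aestronglyMeasurable hi.aestronglyMeasurable)).2 ?_
    refine hi.congr (Eventually.of_forall fun x => ?_)
    exact (Real.sq_sqrt (integral_nonneg fun t => sq_nonneg _)).symm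

  have hka : ∀ᵐ x ∂μ, ∀ᵐ y ∂μ, |∫ t, σ t * (u t x * u t y) ∂ρ| ≤
      √(∫ t, u t x ^ 2 ∂ρ) * √(∫ t, u t y ^ 2 ∂ρ) := by
    filter_upwards [hR] with x hx
    filter_upwards [hR] with y hy
    rw [← norm_toLp_eq_sqrt_integral_sq hx, ← norm_toLp_eq_sqrt_integral_sq hy]
    refine le_trans ?_ (integral_abs_mul_le_norm_toLp_mul hx hy)
    rw [← Real.norm_eq_abs]
    refine norm_integral_le_of_norm_le (hx.integrable_mul hy).abs (Eventually.of_forall fun t => ?_)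
    rw [Real.norm_eq_abs, abs_mul]
    exact mul_le_of_le_one_left (abs_nonneg _) (hσ1 t)
  obtain ⟨B, hB⟩ := exists_integralOperator (aestronglyMeasurable_superposedKernel hσ hu) ha hka
  refine ⟨B, hB, ?_⟩
  classical
  -- The value 0 is used only on the null set of t for which the slice u(t,·) is not in L².
  let v : T → Lp ℂ 2 μ := fun t =>
    if h : MemLp (fun x => (u t x : ℂ)) 2 μ then h.toLp _ else 0
  have hvc : ∀ᵐ t ∂ρ, (v t : X → ℂ) =ᵐ[μ] fun x => (u t x : ℂ) := by
    filter_upwards [hL] with t ht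
    have h : MemLp (fun x => (u t x : ℂ)) 2 μ := ht.ofReal
    simp only [v, dif_pos h]
    exact h.coeFn_toLp
  have huc : AEStronglyMeasurable (fun p : T × X => (u p.1 p.2 : ℂ)) (ρ.prod μ) :=
    Complex.continuous_ofReal.comp_aestronglyMeasurable hu
  have hvin : ∀ e : Lp ℂ 2 μ, ∀ᵐ t ∂ρ,
      inner ℂ e (v t) = ∫ x, (u t x : ℂ) * (starRingEnd ℂ) (e x) ∂μ := by
    intro e
    filter_upwards [hvc] with t ht
    rw [L2.inner_def]
    refine integral_congr_ae ?_
    filter_upwards [ht] with x hx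
    rw [hx]
    rfl
  have hv : ∀ e : Lp ℂ 2 μ, AEStronglyMeasurable (fun t => inner ℂ e (v t)) ρ := by
    intro e
    refine AEStronglyMeasurable.congr ?_ ((hvin e).mono fun _ h => h.symm)
    exact (huc.mul (Complex.continuous_conj.comp_aestronglyMeasurable
      (Lp.aestronglyMeasurable e)).comp_snd).integral_prod_right'
  have hvn : ∀ᵐ t ∂ρ, ‖v t‖ ^ 2 = ∫ x, u t x ^ 2 ∂μ := by
    filter_upwards [hvc] with t ht
    have h1 : ((‖v t‖ ^ 2 : ℝ) : ℂ) = inner ℂ (v t) (v t) := by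
      rw [inner_self_eq_norm_sq_to_K]
      push_cast
      rfl
    have h2 : inner ℂ (v t) (v t) = ((∫ x, u t x ^ 2 ∂μ : ℝ) : ℂ) := by
      rw [L2.inner_def, ← integral_complex_ofReal]
      refine integral_congr_ae ?_
      filter_upwards [ht] with x hx
      rw [hx]
      simp only [RCLike.inner_apply, Complex.conj_ofReal]
      push_cast
      ring
    exact_mod_cast h1.trans h2
  have hvi : Integrable (fun t => ‖v t‖ ^ 2) ρ := by
    refine Integrable.congr ?_ (hvn.mono fun _ h => h.symm)
    exact hu2.integral_prod_left
  have key : ∀ e e' : Lp ℂ 2 μ, inner ℂ e (B e') =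
      ∫ t, (σ t : ℂ) * (inner ℂ e (v t) * inner ℂ (v t) e') ∂ρ := by
    intro e e'
    have hG := integrable_superposedKernel_mul hσ hσ1 hu hu2 e e'
    have l1 := integral_prod _ hG
    have l2 := integral_prod_symm _ hG
    rw [integral_prod _ hG.integral_prod_right] at l2
    have r1 : inner ℂ e (B e') = ∫ x, ∫ y, ∫ t, (σ t : ℂ) *
        (((u t x : ℂ) * (starRingEnd ℂ) (e x)) * ((u t y : ℂ) * e' y)) ∂ρ ∂μ ∂μ := by
      rw [L2.inner_def]
      refine integral_congr_ae ?_
      filter_upwards [(hB e').2] with x hx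
      rw [hx]
      change (∫ y, ((∫ t, σ t * (u t x * u t y) ∂ρ : ℝ) : ℂ) * e' y ∂μ) * (starRingEnd ℂ) (e x) = _
      rw [← integral_mul_const]
      congr 1
      funext y
      rw [← integral_complex_ofReal, mul_assoc, ← integral_mul_const]
      congr 1
      funext t
      push_cast
      ring
    rw [r1]
    refine l2.symm.trans (l1.trans ?_)
    refine integral_congr_ae ?_
    filter_upwards [hvin e, hvin e'] with t h1 h2
    have h3 : inner ℂ (v t) e' = ∫ y, (u t y : ℂ) * e' y ∂μ := by
      rw [← inner_conj_symm, h2, ← integral_conj]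
      simp
    simp only [integral_const_mul]
    rw [integral_prod_mul (fun x => (u t x : ℂ) * (starRingEnd ℂ) (e x))
      fun y => (u t y : ℂ) * e' y, h1, h3]
  have := hasTrace_of_integral_rankOne hσ hσ1 hv hvi key
  rwa [integral_congr_ae (g := fun t => σ t * ∫ x, u t x ^ 2 ∂μ)] at this
  filter_upwards [hvn] with t ht
  rw [ht]

end SuperposedKernel

/-! ### The Bessel operator, its trace and the asymptotics of the mean -/

/-- Split at 1: g is bounded and h integrable on (0,1], while beyond 1 the roles are exchanged. -/
lemma integrableOn_mul_of_bounded {g h : ℝ → ℝ} {K : ℝ} (hg : ContinuousOn g (Ici 0))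
    (hgi : IntegrableOn g (Ioi 0)) (hh : ContinuousOn h (Ioi 0)) (hhi : IntegrableOn h (Ioc 0 1))
    (hK : ∀ s, 1 ≤ s → |h s| ≤ K) : IntegrableOn (fun s => g s * h s) (Ioi 0) := by
  rw [← Ioc_union_Ioi_eq_Ioi zero_le_one]
  refine IntegrableOn.union ?_ ?_
  · obtain ⟨C, hC⟩ := isCompact_Icc.exists_bound_of_continuousOn
      (hg.mono (fun s (hs : s ∈ Icc (0 : ℝ) 1) => hs.1))
    refine hhi.bdd_mul (c := C) ((hg.mono fun s hs => hs.1.le).aestronglyMeasurable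
      measurableSet_Ioc) ?_
    filter_upwards [ae_restrict_mem measurableSet_Ioc] with s hs
    exact hC s ⟨hs.1.le, hs.2⟩
  · refine Integrable.mul_bdd (c := K) (hgi.mono_set (Ioi_subset_Ioi zero_le_one))
      ((hh.mono (Ioi_subset_Ioi zero_le_one)).aestronglyMeasurable measurableSet_Ioi) ?_
    filter_upwards [ae_restrict_mem measurableSet_Ioi] with s hs
    exact hK s (le_of_lt hs)

lemma continuousOn_comp_div_const {g : ℝ → ℝ} (hg : ContinuousOn g (Ici 0)) {c : ℝ} (hc : 0 < c) :
    ContinuousOn (fun t => g (t / c)) (Ici 0) :=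
  hg.comp (by fun_prop) fun _ ht => div_nonneg ht hc.le

lemma integrableOn_comp_div_const {g : ℝ → ℝ} (hg : IntegrableOn g (Ioi 0)) {c : ℝ} (hc : 0 < c) :
    IntegrableOn (fun t => g (t / c)) (Ioi 0) := by
  have h := (integrableOn_Ioi_comp_mul_right_iff g 0 (inv_pos.2 hc)).2 (by simpa using hg)
  simpa only [div_eq_mul_inv] using h

lemma integrableOn_mul_besselN (ν : ℝ) (hν : -1 < ν) {g : ℝ → ℝ} (hg : ContinuousOn g (Ici 0))
    (hgi : IntegrableOn g (Ioi 0)) : IntegrableOn (fun s => g s * besselN ν s) (Ioi 0) := by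
  obtain ⟨C, hC, hb, -⟩ := besselN_asymptotics hν
  refine integrableOn_mul_of_bounded (K := C + 1 / Real.pi) hg hgi (continuousOn_besselN ν hν)
    (integrableOn_besselN ν hν 1) fun s hs => ?_
  have h1 := hb s hs
  have h2 : C / s ≤ C := div_le_self hC.le hs
  have h3 : 0 < 1 / Real.pi := by positivity
  rw [abs_le] at h1 ⊢
  constructor <;> linarith [h1.1, h1.2]

lemma integrableOn_mul_besselJ_sq_comp_mul (ν : ℝ) (hν : -1 < ν) {g : ℝ → ℝ}
    (hg : ContinuousOn g (Ici 0)) (hgi : IntegrableOn g (Ioi 0)) {x : ℝ} (hx : 0 < x) :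
    IntegrableOn (fun t => g t * (t * x * besselJ ν (t * x) ^ 2)) (Ioi 0) := by
  obtain ⟨K, hK, hb⟩ := exists_besselY_le ν hν
  have h : IntegrableOn (fun s => g (s / x) * (s * besselJ ν s ^ 2)) (Ioi 0) := by
    refine integrableOn_mul_of_bounded (K := K) (continuousOn_comp_div_const hg hx)
      (integrableOn_comp_div_const hgi hx) (continuousOn_mul_besselJ_sq ν hν)
      (integrableOn_mul_besselJ_sq ν hν 1) fun s hs => ?_
    have hs0 : 0 < s := by linarith
    rw [abs_of_nonneg (by positivity)]
    refine le_trans ?_ (hb s hs)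
    rw [besselY]
    nlinarith [mul_nonneg hs0.le (sq_nonneg (besselJ (ν + 1) s))]
  have h2 := (integrableOn_Ioi_comp_mul_right_iff _ 0 hx).2 (by simpa using h)
  refine IntegrableOn.congr_fun h2 (fun t _ => ?_) measurableSet_Ioi
  simp only [mul_div_cancel_right₀ t hx.ne']

/-- For each t the kernel factors through w(tx)w(ty) with w(s) = √s J_ν(s); this is the rank-one
structure. -/
lemma besselOpIntegrand_eq (ν : ℝ) (g : ℝ → ℝ) {x y t : ℝ} (hx : 0 < x) (ht : 0 < t) :
    besselOpIntegrand ν g x y t =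
      g t * ((√(t * x) * besselJ ν (t * x)) * (√(t * y) * besselJ ν (t * y))) := by
  have h : t * √(x * y) = √(t * x) * √(t * y) := by
    rw [Real.sqrt_mul hx.le, Real.sqrt_mul ht.le, Real.sqrt_mul ht.le]
    calc t * (√x * √y) = (√t * √t) * (√x * √y) := by rw [Real.mul_self_sqrt ht.le]
      _ = _ := by ring
  rw [besselOpIntegrand, h]
  ring

lemma continuousOn_sqrt_mul_besselJ (ν : ℝ) (hν : -1 < ν) :
    ContinuousOn (fun s => √s * besselJ ν s) (Ioi 0) :=
  Real.continuous_sqrt.continuousOn.mul (continuousOn_besselJ ν hν)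

lemma integrableOn_besselOpIntegrand (ν : ℝ) (hν : -1 < ν) {g : ℝ → ℝ}
    (hg : ContinuousOn g (Ici 0)) (hgi : IntegrableOn g (Ioi 0)) {x y : ℝ} (hx : 0 < x)
    (hy : 0 < y) : IntegrableOn (besselOpIntegrand ν g x y) (Ioi 0) := by
  have hw : ∀ {z : ℝ}, 0 < z →
      ContinuousOn (fun t => √(t * z) * besselJ ν (t * z)) (Ioi 0) := fun {z} hz =>
    (continuousOn_sqrt_mul_besselJ ν hν).comp (by fun_prop) fun t ht => mul_pos ht hz
  have hm : ContinuousOn (fun t =>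
      g t * ((√(t * x) * besselJ ν (t * x)) * (√(t * y) * besselJ ν (t * y)))) (Ioi 0) :=
    (hg.mono Ioi_subset_Ici_self).mul ((hw hx).mul (hw hy))
  have hi : IntegrableOn (fun t =>
      g t * ((√(t * x) * besselJ ν (t * x)) * (√(t * y) * besselJ ν (t * y)))) (Ioi 0) := by
    -- |w(tx)w(ty)| ≤ w(tx)² + w(ty)² reduces the claim to the diagonal cases.
    refine Integrable.mono' ((integrableOn_mul_besselJ_sq_comp_mul ν hν hg hgi hx).abs.add
      (integrableOn_mul_besselJ_sq_comp_mul ν hν hg hgi hy).abs)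
      (hm.aestronglyMeasurable measurableSet_Ioi) ?_
    filter_upwards [ae_restrict_mem measurableSet_Ioi] with t ht
    have ht' : 0 < t := ht
    simp only [Pi.add_apply]
    rw [Real.norm_eq_abs, abs_mul, abs_mul (g t), abs_mul (g t), ← mul_add]
    refine mul_le_mul_of_nonneg_left ?_ (abs_nonneg _)
    have e : ∀ z, 0 < z → |t * z * besselJ ν (t * z) ^ 2| =
        |√(t * z) * besselJ ν (t * z)| ^ 2 := by
      intro z hz
      have h0 : 0 ≤ t * z := (mul_pos ht' hz).le
      rw [sq_abs, mul_pow, Real.sq_sqrt h0, abs_of_nonneg (by positivity)]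
    rw [e x hx, e y hy, abs_mul]
    nlinarith [sq_nonneg (|√(t * x) * besselJ ν (t * x)| - |√(t * y) * besselJ ν (t * y)|),
      sq_nonneg (|√(t * x) * besselJ ν (t * x)|), sq_nonneg (|√(t * y) * besselJ ν (t * y)|)]
  exact IntegrableOn.congr_fun hi (fun t ht => (besselOpIntegrand_eq ν g hx ht).symm)
    measurableSet_Ioi

lemma integrableOn_mul_besselJ_sq_unit (ν : ℝ) (hν : -1 < ν) {t : ℝ} (ht : 0 < t) :
    IntegrableOn (fun x => t * x * besselJ ν (t * x) ^ 2) (Ioo 0 1) := by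
  have h : IntervalIntegrable (fun u => u * besselJ ν u ^ 2) volume 0 t :=
    (intervalIntegrable_iff_integrableOn_Ioc_of_le ht.le).2 (integrableOn_mul_besselJ_sq ν hν t)
  have h2 := h.comp_mul_left (c := t)
  rw [zero_div, div_self ht.ne', intervalIntegrable_iff_integrableOn_Ioo_of_le zero_le_one] at h2
  exact h2

/-- The identity behind mean = trace: the squared L²(0,1) norm of the rank-one vector at t is the
density at t. -/
lemma integral_mul_besselJ_sq_unit (ν : ℝ) (hν : -1 < ν) {t : ℝ} (ht : 0 < t) :
    ∫ x in Ioo (0 : ℝ) 1, t * x * besselJ ν (t * x) ^ 2 = besselN ν t := by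
  rw [← integral_Ioc_eq_integral_Ioo, ← intervalIntegral.integral_of_le zero_le_one,
    intervalIntegral.integral_comp_mul_left (fun u => u * besselJ ν u ^ 2) ht.ne', mul_zero,
    mul_one, integral_mul_besselJ_sq ν hν ht, besselN, smul_eq_mul]
  ring

lemma secondCountableTopology_L2Unit : SecondCountableTopology L2Unit := by
  have : Fact ((2 : ENNReal) ≠ ⊤) := ⟨by simp⟩
  infer_instance

/-- The operator with kernel `besselOpKernel ν g` is trace class, with trace `besselMean ν g`. -/
lemma exists_isIntegralOperator_hasTrace (ν : ℝ) (hν : -1 < ν) {g : ℝ → ℝ}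
    (hg : ContinuousOn g (Ici 0)) (hgi : IntegrableOn g (Ioi 0)) :
    ∃ B : L2Unit →L[ℂ] L2Unit,
      IsIntegralOperator (besselOpKernel ν g) B ∧ HasTrace B (besselMean ν g : ℂ) := by
  have := secondCountableTopology_L2Unit
  -- A sign that is never 0, so that g = s(g)|g|: the factor √|g| goes into the vectors u, and the
  -- sign becomes the weight σ with |σ| ≤ 1.
  let s : ℝ → ℝ := fun r => if 0 ≤ r then 1 else -1
  have hs : Measurable s := Measurable.ite measurableSet_Ici measurable_const measurable_const
  have hs1 : ∀ r, |s r| ≤ 1 := by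
    intro r
    by_cases h : 0 ≤ r <;> simp [s, h]
  have hsa : ∀ r, s r * |r| = r := by
    intro r
    by_cases h : 0 ≤ r
    · simp [s, h, abs_of_nonneg h]
    · simp [s, h, abs_of_neg (not_le.1 h)]
  let u : ℝ → ℝ → ℝ := fun t x => √|g t| * (√(t * x) * besselJ ν (t * x))
  have hu_sq : ∀ {t x : ℝ}, 0 < t → 0 < x →
      u t x ^ 2 = |g t| * (t * x * besselJ ν (t * x) ^ 2) := by
    intro t x ht hx
    simp only [u]
    rw [mul_pow, mul_pow, Real.sq_sqrt (abs_nonneg _), Real.sq_sqrt (mul_pos ht hx).le]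
  have hgm : AEStronglyMeasurable g (volume.restrict (Ioi 0)) := hgi.aestronglyMeasurable
  have hσ : AEStronglyMeasurable (fun t => s (g t)) (volume.restrict (Ioi 0)) :=
    (hs.comp_aemeasurable hgm.aemeasurable).aestronglyMeasurable
  have hu : AEStronglyMeasurable (fun p : ℝ × ℝ => u p.1 p.2)
      ((volume.restrict (Ioi 0)).prod (volume.restrict (Ioo (0 : ℝ) 1))) := by
    have h1 : AEStronglyMeasurable (fun t => √|g t|) (volume.restrict (Ioi 0)) :=
      (Real.continuous_sqrt.comp continuous_abs).comp_aestronglyMeasurable hgm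
    refine h1.comp_fst.mul ?_
    rw [Measure.prod_restrict]
    refine ContinuousOn.aestronglyMeasurable ?_ (measurableSet_Ioi.prod measurableSet_Ioo)
    exact (continuousOn_sqrt_mul_besselJ ν hν).comp (f := fun p : ℝ × ℝ => p.1 * p.2)
      (by fun_prop) fun p hp => mul_pos hp.1 hp.2.1
  have hint : ∀ t, 0 < t → ∫ x in Ioo (0 : ℝ) 1, u t x ^ 2 = |g t| * besselN ν t := by
    intro t ht
    rw [← integral_mul_besselJ_sq_unit ν hν ht, ← integral_const_mul]
    exact setIntegral_congr_fun measurableSet_Ioo fun x hx => hu_sq ht hx.1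
  have hu2 : Integrable (fun p : ℝ × ℝ => u p.1 p.2 ^ 2)
      ((volume.restrict (Ioi 0)).prod (volume.restrict (Ioo (0 : ℝ) 1))) := by
    refine (integrable_prod_iff (hu.pow 2)).2 ?_
    refine ⟨?_, ?_⟩
    · filter_upwards [ae_restrict_mem measurableSet_Ioi] with t ht
      exact IntegrableOn.congr_fun ((integrableOn_mul_besselJ_sq_unit ν hν ht).const_mul |g t|)
        (fun x hx => (hu_sq ht hx.1).symm) measurableSet_Ioo
    · refine IntegrableOn.congr_fun (integrableOn_mul_besselN ν hν hg hgi).abs (fun t ht => ?_)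
        measurableSet_Ioi
      have ht' : 0 < t := ht
      simp only [Pi.pow_apply, norm_pow, Real.norm_eq_abs, sq_abs]
      rw [hint t ht, abs_mul, abs_of_nonneg (besselN_nonneg ν hν ht')]
  obtain ⟨B, hB, hT⟩ := exists_integralOperator_hasTrace (σ := fun t => s (g t)) hσ
    (fun t => hs1 _) hu hu2
  have hk : ∀ x ∈ Ioo (0 : ℝ) 1, ∀ y ∈ Ioo (0 : ℝ) 1,
      ∫ t in Ioi 0, s (g t) * (u t x * u t y) = besselOpKernel ν g x y := by
    intro x hx y hy
    refine setIntegral_congr_fun measurableSet_Ioi fun t ht => ?_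
    simp only [u]
    rw [besselOpIntegrand_eq ν g hx.1 ht]
    nth_rewrite 4 [← hsa (g t)]
    rw [← Real.mul_self_sqrt (abs_nonneg (g t)), Real.sqrt_mul_self (Real.sqrt_nonneg _)]
    ring
  refine ⟨B, fun h => ⟨?_, ?_⟩, ?_⟩
  · filter_upwards [(hB h).1, ae_restrict_mem measurableSet_Ioo] with x h1 hx
    refine Integrable.congr h1 ?_
    filter_upwards [ae_restrict_mem measurableSet_Ioo] with y hy
    rw [hk x hx y hy]
  · filter_upwards [(hB h).2, ae_restrict_mem measurableSet_Ioo] with x h1 hx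
    rw [h1]
    refine setIntegral_congr_fun measurableSet_Ioo fun y hy => ?_
    simp only [hk x hx y hy]
  · have e : besselMean ν g =
        ∫ t in Ioi 0, s (g t) * ∫ x in Ioo (0 : ℝ) 1, u t x ^ 2 := by
      rw [besselMean_eq ν hν]
      refine setIntegral_congr_fun measurableSet_Ioi fun t ht => ?_
      simp only [hint t ht]
      rw [← mul_assoc, hsa]
    rw [e]
    exact hT

/-- The asymptotics of the mean of the linear statistic. -/
lemma besselMean_asymptotics (ν : ℝ) (hν : -1 < ν) {f : ℝ → ℝ} (hf : ContinuousOn f (Ici 0))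
    (hfi : IntegrableOn f (Ioi 0)) (hbv : ∃ δ > 0, BoundedVariationOn f (Icc 0 δ)) :
    (fun α : ℝ => besselMean ν (fun t => f (t / α)) -
        (α / Real.pi * (∫ t in Ioi (0 : ℝ), f t) - ν / 2 * f 0))
      =o[atTop] (fun _ => (1 : ℝ)) := by
  rw [Asymptotics.isLittleO_one_iff]
  obtain ⟨C, hC, hb, hP⟩ := besselN_asymptotics hν
  have hT := tendsto_integral_mul_dilation (M := fun s => besselN ν s - 1 / Real.pi)
    ((continuousOn_besselN ν hν).sub continuousOn_const)
    (fun R => integrableOn_besselN_sub_const ν hν _ R) hC hb hP hf hfi hbv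
  have hT2 := hT.sub_const (f 0 * -(ν / 2))
  rw [sub_self] at hT2
  refine hT2.congr' ?_
  filter_upwards [eventually_gt_atTop 0] with α hα
  have hi := integrableOn_comp_div_const hfi hα
  -- Multiplied by the limit 1/π of the density, this is the main term; N - 1/π supplies -(ν/2)
  -- f(0).
  have h1 : ∫ s in Ioi (0 : ℝ), f (s / α) = α * ∫ t in Ioi (0 : ℝ), f t := by
    have := integral_comp_mul_right_Ioi f 0 (inv_pos.2 hα)
    simpa [div_eq_mul_inv] using this
  have h2 : ∫ s in Ioi (0 : ℝ), f (s / α) * (besselN ν s - 1 / Real.pi) =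
      besselMean ν (fun t => f (t / α)) - (∫ s in Ioi (0 : ℝ), f (s / α)) * (1 / Real.pi) := by
    rw [besselMean_eq ν hν, ← integral_mul_const, ← integral_sub
      (integrableOn_mul_besselN ν hν (continuousOn_comp_div_const hf hα) hi) (hi.mul_const _)]
    simp only [mul_sub]
  rw [h2, h1]
  ring

end

theorem mainTheorem6 (ν : ℝ) (hν : -1 < ν) (f : ℝ → ℝ)
    (hf_cont : ContinuousOn f (Ici 0))
    (hf_int : IntegrableOn f (Ioi 0))
    (hf_lim : Tendsto f atTop (𝓝 0))
    (hf_bv : ∃ δ > 0, BoundedVariationOn f (Icc 0 δ)) :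
    (∀ α : ℝ, 0 < α →
      IntegrableOn (fun x => f (√x / α) * besselDensity ν x) (Ioi 0) ∧
      (∀ x ∈ Ioo (0 : ℝ) 1, ∀ y ∈ Ioo (0 : ℝ) 1,
        IntegrableOn (besselOpIntegrand ν (fun t => f (t / α)) x y) (Ioi 0)) ∧
      ∃ B : L2Unit →L[ℂ] L2Unit,
        IsIntegralOperator (besselOpKernel ν (fun t => f (t / α))) B ∧
        HasTrace B (besselMean ν (fun t => f (t / α)) : ℂ)) ∧
    (fun α : ℝ => besselMean ν (fun t => f (t / α)) -
        (α / Real.pi * (∫ t in Ioi (0 : ℝ), f t) - ν / 2 * f 0))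
      =o[atTop] (fun _ => (1 : ℝ)) := by
  refine ⟨fun α hα => ?_, besselMean_asymptotics ν hν hf_cont hf_int hf_bv⟩
  have hc := continuousOn_comp_div_const hf_cont hα
  have hi := integrableOn_comp_div_const hf_int hα
  refine ⟨?_, fun x hx y hy => integrableOn_besselOpIntegrand ν hν hc hi hx.1 hy.1,
    exists_isIntegralOperator_hasTrace ν hν hc hi⟩
  exact (integrableOn_besselDensity_iff ν hν fun t => f (t / α)).2
    (integrableOn_mul_besselN ν hν hc hi)
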